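/- All manifolds are smooth, finite-dimensional, without boundary, Hausdorff and second countable. For a Riemannian metric $g$, $S$ denotes the Ricci tensor, $R$ the scalar curvature and $\mathcal L_U g$ the Lie derivative. Given real constants $\alpha,\beta,\lambda,\mu$, a smooth vector field $U$ and a smooth $1$-form $\eta$ on a Riemannian manifold $(M,g)$, the data $(M,g,U,\lambda,\mu,\alpha,\beta)$ is an *$\eta$-Ricci-Yamabe soliton of type $(\alpha,\beta)$ with potential field $U$* if $$\mathcal L_U g+2\alpha S+(2\lambda-\beta R)\,g+2\mu\,\eta\otimes\eta=0 .$$ A Riemannian manifold $(N,g_N)$ is *$\eta$-Einstein with respect to a smooth $1$-form $\theta$* if $S_N=a\,g_N+b\,\theta\otimes\theta$ for some smooth functions $a,b$ on $N$. Let $(M,g)$ and $(N,g_N)$ be connected Riemannian manifolds with $\dim M>\dim N$, and let $\pi:(M,g)\to(N,g_N)$ be a Riemannian submersion with connected fibres: a smooth surjective submersion such that $\pi_*$ preserves the lengths of horizontal vectors. Here a tangent vector is vertical if it lies in $\ker\pi_*$, and horizontal if it is orthogonal to $\ker\pi_*$. Let $(M,g,U,\lambda,\mu,\alpha,\beta)$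 be an $\eta$-Ricci-Yamabe soliton of type $(\alpha,\beta)$, and suppose that the horizontal distribution $\mathcal H=(\ker\pi_*)^\perp$ is parallel: $\nabla_vX$ is horizontal for every smooth horizontal vector field $X$ and every tangent vector $v$, where $\nabla$ is the Levi-Civita connection of $g$. 1. If $U$ is vertical and $\alpha\neq0$, then $(N,g_N)$ is $\eta$-Einstein: there is a smooth $1$-form $\theta$ on $N$ with respect to which $(N,g_N)$ is $\eta$-Einstein. If moreover $\mu\ne0$, and $\dim N\neq1$ or $\beta=0$, then $\theta$ can be chosen to be induced by $\eta$, that is, $\eta(X)=\theta(\pi_*X)$ for every horizontal vector $X$. 2. Suppose that $U$ is horizontal; if $\mu\neq0$, suppose also that $\pi_*U$ is a well-defined vector field on $N$ (i.e. $U$ is $\pi$-related to a vector field on $N$), and that $\dim N\ne1$ or $\beta=0$. Then there are a smooth vector field $U_N$ on $N$ with $\pi_*U=U_N$, a smooth $1$-form $\theta$ on $N$ and a constant $\lambda_N\in\mathbb R$ such that $(N,g_N,U_N,\lambda_N,\mu,\alpha,\beta)$, with the $1$-form $\theta$, is an $\eta$-Ricci-Yamabe soliton of type $(\alpha,\beta)$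 with potential field $U_N$. If $\mu\neq0$, then $\theta$ can be chosen to be induced by $\eta$. -/

import Mathlib

open Bundle Module
open scoped Manifold ContDiff Topology

noncomputable section

namespace RicciYamabe

section Coordinates

/-!
Local Riemannian geometry of a metric `G` defined on (an open part of) a finite-dimensional
real vector space `E`. The coefficients of all tensors refer to constant vector fields on `E`.
-/

variable {E : Type*} [NormedAddCommGroup E] [NormedSpace ℝ E]

/-- The Christoffel symbols of the first kind, `w ↦ Γ(u, v; w)` where
`Γ(u, v; w) = (∂ᵤ G(v, w) + ∂ᵥ G(u, w) - ∂_w G(u, v)) / 2`. -/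
def christoffelFirst (G : E → E →L[ℝ] E →L[ℝ] ℝ) (y u v : E) : E →L[ℝ] ℝ :=
  (2⁻¹ : ℝ) • (fderiv ℝ G y u v + fderiv ℝ G y v u - fderiv ℝ (fun z => G z u v) y)

/-- The Christoffel symbols of the second kind: `Γ(u, v)` is the vector `∇ᵤ v` (for constant
fields `u`, `v`) that satisfies `G(Γ(u, v), w) = Γ(u, v; w)` for all `w`. -/
def christoffel (G : E → E →L[ℝ] E →L[ℝ] ℝ) (y u v : E) : E :=
  (G y).inverse (christoffelFirst G y u v)

/-- The curvature tensor `R(u, v) w = ∇ᵤ ∇ᵥ w - ∇ᵥ ∇ᵤ w` (for constant fields `u`, `v`, `w`). -/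
def curvature (G : E → E →L[ℝ] E →L[ℝ] ℝ) (y u v w : E) : E :=
  fderiv ℝ (fun z => christoffel G z v w) y u - fderiv ℝ (fun z => christoffel G z u w) y v
    + christoffel G y u (christoffel G y v w) - christoffel G y v (christoffel G y u w)

/-- The Ricci tensor `S(v, w) = trace (u ↦ R(u, v) w)`. -/
def ricciCoord [FiniteDimensional ℝ E] (G : E → E →L[ℝ] E →L[ℝ] ℝ) (y v w : E) : ℝ :=
  ∑ i, (finBasis ℝ E).coord i (curvature G y (finBasis ℝ E i) v w)

/-- The scalar curvature `∑ g^{ij} S_{ij}`, with `g^{ij}` the inverse of the Gram matrix of `G`. -/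
def scalarCoord [FiniteDimensional ℝ E] (G : E → E →L[ℝ] E →L[ℝ] ℝ) (y : E) : ℝ :=
  ∑ i, ∑ j, (Matrix.of fun k l => G y (finBasis ℝ E k) (finBasis ℝ E l))⁻¹ i j *
    ricciCoord G y (finBasis ℝ E i) (finBasis ℝ E j)

end Coordinates

section Manifold

variable {E : Type*} [NormedAddCommGroup E] [NormedSpace ℝ E]
  {M : Type*} [TopologicalSpace M] [ChartedSpace E M]
  [IsManifold 𝓘(ℝ, E) ∞ M]

/-- Smooth vector fields. -/
def IsSmoothField (X : ∀ p : M, TangentSpace 𝓘(ℝ, E) p) : Prop :=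
  ContMDiff 𝓘(ℝ, E) 𝓘(ℝ, E).tangent ∞
    (fun p => (⟨p, X p⟩ : TangentBundle 𝓘(ℝ, E) M))

/-- Smooth differential `1`-forms. -/
def IsSmoothForm (θ : ∀ p : M, TangentSpace 𝓘(ℝ, E) p →L[ℝ] ℝ) : Prop :=
  ContMDiff 𝓘(ℝ, E) (𝓘(ℝ, E).prod 𝓘(ℝ, E →L[ℝ] ℝ)) ∞
    (fun p => TotalSpace.mk' (E →L[ℝ] ℝ)
      (E := fun p : M => TangentSpace 𝓘(ℝ, E) p →L[ℝ] ℝ) p (θ p))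

variable (E M) in
/-- Smooth Riemannian metrics on `M`. -/
abbrev Metric : Type _ :=
  ContMDiffRiemannianMetric 𝓘(ℝ, E) ∞ E (TangentSpace 𝓘(ℝ, E) : M → Type _)

/-- The metric `g` read in the chart around `c`, a field of bilinear forms on `E`. -/
def metricInChart (g : Metric E M) (c : M) (y : E) : E →L[ℝ] E →L[ℝ] ℝ :=
  let p : M := (extChartAt 𝓘(ℝ, E) c).symm y
  let A : E →L[ℝ] E := mfderiv 𝓘(ℝ, E) 𝓘(ℝ, E) (extChartAt 𝓘(ℝ, E) c).symm y
  let B : E →L[ℝ] E →L[ℝ] ℝ := g.inner p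
  B.bilinearComp A A

/-- The vector field `X` read in the chart around `c`. -/
def fieldInChart (X : ∀ p : M, TangentSpace 𝓘(ℝ, E) p) (c : M) (y : E) : E :=
  VectorField.mpullback 𝓘(ℝ, E) 𝓘(ℝ, E) (extChartAt 𝓘(ℝ, E) c).symm X y

/-- The components of a tangent vector at `p` in the chart around `p`. -/
def vectorInChart (p : M) (v : TangentSpace 𝓘(ℝ, E) p) : E :=
  mfderiv 𝓘(ℝ, E) 𝓘(ℝ, E) (extChartAt 𝓘(ℝ, E) p) p v

/-- The Levi-Civita derivative `∇ᵥ X` at `p`: in coordinates, `∂ᵥ X + Γ(v, X)`. -/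
def covDeriv (g : Metric E M) (X : ∀ p : M, TangentSpace 𝓘(ℝ, E) p) (p : M)
    (v : TangentSpace 𝓘(ℝ, E) p) : TangentSpace 𝓘(ℝ, E) p :=
  let y : E := extChartAt 𝓘(ℝ, E) p p
  let u : E := vectorInChart p v
  (mfderiv 𝓘(ℝ, E) 𝓘(ℝ, E) (extChartAt 𝓘(ℝ, E) p) p).inverse
    (fderiv ℝ (fieldInChart X p) y u
      + christoffel (metricInChart g p) y u (fieldInChart X p y))

/-- The Lie derivative `(L_X g)(v, w)` at `p`: in coordinates,
`∂_X g(v, w) + g(∂ᵥ X, w) + g(v, ∂_w X)`. -/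
def lieDerivMetric (g : Metric E M) (X : ∀ p : M, TangentSpace 𝓘(ℝ, E) p) (p : M)
    (v w : TangentSpace 𝓘(ℝ, E) p) : ℝ :=
  let G := metricInChart g p
  let Y := fieldInChart X p
  let y : E := extChartAt 𝓘(ℝ, E) p p
  let v' : E := vectorInChart p v
  let w' : E := vectorInChart p w
  fderiv ℝ G y (Y y) v' w' + G y (fderiv ℝ Y y v') w' + G y v' (fderiv ℝ Y y w')

/-- The Ricci tensor of `g`. -/
def ricci [FiniteDimensional ℝ E] (g : Metric E M) (p : M) (v w : TangentSpace 𝓘(ℝ, E) p) : ℝ :=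
  ricciCoord (metricInChart g p) (extChartAt 𝓘(ℝ, E) p p) (vectorInChart p v) (vectorInChart p w)

/-- The scalar curvature of `g`. -/
def scalarCurvature [FiniteDimensional ℝ E] (g : Metric E M) (p : M) : ℝ :=
  scalarCoord (metricInChart g p) (extChartAt 𝓘(ℝ, E) p p)

/-- `(M, g, U, lam, mu, α, β)` with the `1`-form `η` is an `η`-Ricci-Yamabe soliton of type
`(α, β)`: `L_U g + 2 α S + (2 lam - β R) g + 2 mu η ⊗ η = 0`. -/
structure IsEtaRicciYamabeSoliton [FiniteDimensional ℝ E] (g : Metric E M)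
    (U : ∀ p : M, TangentSpace 𝓘(ℝ, E) p) (η : ∀ p : M, TangentSpace 𝓘(ℝ, E) p →L[ℝ] ℝ)
    (lam mu α β : ℝ) : Prop where
  smooth_field : IsSmoothField U
  smooth_form : IsSmoothForm η
  equation : ∀ (p : M) (v w : TangentSpace 𝓘(ℝ, E) p),
    lieDerivMetric g U p v w + 2 * α * ricci g p v w
      + (2 * lam - β * scalarCurvature g p) * g.inner p v w + 2 * mu * (η p v * η p w) = 0

/-- `(M, g)` is `η`-Einstein: `S = a g + b η ⊗ η` for smooth functions `a`, `b`. -/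
def IsEtaEinstein [FiniteDimensional ℝ E] (g : Metric E M) (η : ∀ p : M, TangentSpace 𝓘(ℝ, E) p →L[ℝ] ℝ) : Prop :=
  IsSmoothForm η ∧ ∃ a b : M → ℝ, ContMDiff 𝓘(ℝ, E) 𝓘(ℝ, ℝ) ∞ a ∧
    ContMDiff 𝓘(ℝ, E) 𝓘(ℝ, ℝ) ∞ b ∧ ∀ (p : M) (v w : TangentSpace 𝓘(ℝ, E) p),
      ricci g p v w = a p * g.inner p v w + b p * (η p v * η p w)

end Manifold

section Submersion

variable {E : Type*} [NormedAddCommGroup E] [NormedSpace ℝ E]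
  {F : Type*} [NormedAddCommGroup F] [NormedSpace ℝ F]
  {M : Type*} [TopologicalSpace M] [ChartedSpace E M]
  {N : Type*} [TopologicalSpace N] [ChartedSpace F N]

/-- A tangent vector is vertical if it lies in the kernel of the differential of `f`. -/
def IsVertical (f : M → N) (p : M) (v : TangentSpace 𝓘(ℝ, E) p) : Prop :=
  mfderiv 𝓘(ℝ, E) 𝓘(ℝ, F) f p v = 0

/-- `U` is `f`-related to the vector field `W` on `N`, i.e. `f_* U = W`. -/
def IsRelatedField (f : M → N) (U : ∀ p : M, TangentSpace 𝓘(ℝ, E) p)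
    (W : ∀ q : N, TangentSpace 𝓘(ℝ, F) q) : Prop :=
  ∀ p : M, mfderiv 𝓘(ℝ, E) 𝓘(ℝ, F) f p (U p) = W (f p)

variable [IsManifold 𝓘(ℝ, E) ∞ M] [IsManifold 𝓘(ℝ, F) ∞ N]

/-- A tangent vector is horizontal if it is orthogonal to all vertical vectors. -/
def IsHorizontal (g : Metric E M) (f : M → N) (p : M) (v : TangentSpace 𝓘(ℝ, E) p) : Prop :=
  ∀ u : TangentSpace 𝓘(ℝ, E) p, IsVertical (F := F) f p u → g.inner p v u = 0

/-- Riemannian submersions `f : (M, g) → (N, gN)`. -/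
structure IsRiemannianSubmersion (g : Metric E M) (gN : Metric F N) (f : M → N) : Prop where
  dim_lt : finrank ℝ F < finrank ℝ E
  smooth : ContMDiff 𝓘(ℝ, E) 𝓘(ℝ, F) ∞ f
  surjective : Function.Surjective f
  surjective_mfderiv : ∀ p : M, Function.Surjective (mfderiv 𝓘(ℝ, E) 𝓘(ℝ, F) f p)
  isometry : ∀ (p : M) (v : TangentSpace 𝓘(ℝ, E) p), IsHorizontal (F := F) g f p v →
    gN.inner (f p) (mfderiv 𝓘(ℝ, E) 𝓘(ℝ, F) f p v) (mfderiv 𝓘(ℝ, E) 𝓘(ℝ, F) f p v)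
      = g.inner p v v

/-- The horizontal distribution is parallel: `∇ᵥ X` is horizontal for every smooth horizontal
vector field `X` and every tangent vector `v`. -/
def IsHorizontalParallel (g : Metric E M) (f : M → N) : Prop :=
  ∀ X : ∀ p : M, TangentSpace 𝓘(ℝ, E) p, IsSmoothField X →
    (∀ p, IsHorizontal (F := F) g f p (X p)) →
    ∀ (p : M) (v : TangentSpace 𝓘(ℝ, E) p), IsHorizontal (F := F) g f p (covDeriv g X p v)

/-- The form `θ` on `N` is induced by the form `η` on `M`: `η(X) = θ(f_* X)` for horizontal `X`. -/
def IsInducedForm (g : Metric E M) (f : M → N)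
    (η : ∀ p : M, TangentSpace 𝓘(ℝ, E) p →L[ℝ] ℝ)
    (θ : ∀ q : N, TangentSpace 𝓘(ℝ, F) q →L[ℝ] ℝ) : Prop :=
  ∀ (p : M) (v : TangentSpace 𝓘(ℝ, E) p), IsHorizontal (F := F) g f p v →
    η p v = θ (f p) (mfderiv 𝓘(ℝ, E) 𝓘(ℝ, F) f p v)

end Submersion

end RicciYamabe

end

noncomputable section

namespace RicciYamabe

/-! ### Connections `∂ + A` on a vector space: curvature, Bianchi identities, affine maps. -/

section Connection

set_option synthInstance.maxHeartbeats 200000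

variable {E : Type*} [NormedAddCommGroup E] [NormedSpace ℝ E]
  {F : Type*} [NormedAddCommGroup F] [NormedSpace ℝ F]
  {H : Type*} [NormedAddCommGroup H] [NormedSpace ℝ H]

/-! Parallelism of the horizontal distribution makes π totally geodesic. In charts, with Γ and Γ_N
the Levi-Civita connections of g and g_N, this says D²φ(u, v) = Dφ(Γ(u, v)) − Γ_N(Dφ u, Dφ v)
(`IsSubmersionOn.isAffineAt`, and `isAffineAt_chartMap` for arbitrary charts). Differentiating this
identity shows that dπ intertwines the curvature tensors and their covariant derivatives
(`IsAffineAt.curv`, `IsAffineAt.curvDeriv`); no local splitting of M as a product is used.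
Consequently S(v, w) = S_N(π_*v, π_*w) as soon as w is horizontal, and if U is π-related to W, then
dπ(∇_v U) = ∇_{π_*v} W, so that L_U g and L_W g_N agree on horizontal vectors.

On the horizontal lifts at p of vectors a, b in the tangent space of N at π(p), the soliton equation
therefore reads L_W g_N + 2α S_N + (2λ − βR(p)) g_N + 2μ η_p ⊗ η_p = 0, where η_p(a) is η of the
lift of a (`soliton_horizontal`). Only R(p) and η_p depend on the position of p in its fibre.
Compare two points of one fibre. If μ = 0 and dim N > 0, or if dim N ≥ 2, the coefficient of g_N is
determined (`IsInner.coeff_eq`), so βR descends. If μ ≠ 0, then η_p ⊗ η_p is constant on the fibre,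
η_p is constant up to sign, and continuity together with connectedness of the fibre fixes the sign
(`descendAt_eq_of_mul_self_eq`). Smoothness on N comes from local sections of π. This is
`exists_descent`.

For part 1, a vertical U is related to W = 0, and the descended equation is solved for S_N. When it
is not available, dim N ≤ 1, so S_N = 0 and θ = 0 serves.

For part 2 with μ = 0, put a vertical v and the horizontal vector w = ∇_v U into the equation: only
|∇_v U|² survives, so U is parallel along the fibres and π_*U is constant along them. It remains to
replace βR by βR_N. By the contracted second Bianchi identity dR = 2 div S, and div S on a
horizontal vector equals div S_N on its image. Hence, when β ≠ 0, the descended R minus R_N is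
locally constant (`exists_scalarCurvature_eq_add_const`), so it is a constant k on the connected N,
and λ_N = λ − βk/2. -/

theorem fderiv_clm_apply_const_apply {c : E → F →L[ℝ] H} {y : E} (hc : DifferentiableAt ℝ c y)
    (w : F) (z : E) : fderiv ℝ (fun x => c x w) y z = fderiv ℝ c y z w := by
  rw [fderiv_clm_apply hc (differentiableAt_const w)]
  simp

theorem fderiv_clm_apply_apply {c : E → F →L[ℝ] H} {u : E → F} {y : E}
    (hc : DifferentiableAt ℝ c y) (hu : DifferentiableAt ℝ u y) (z : E) :
    fderiv ℝ (fun x => c x (u x)) y z = fderiv ℝ c y z (u y) + c y (fderiv ℝ u y z) := by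
  rw [fderiv_clm_apply hc hu]
  simp [add_comm]

theorem fderiv_apply_congr {f g : E → F} {y : E} (h : f =ᶠ[𝓝 y] g) (z : E) :
    fderiv ℝ f y z = fderiv ℝ g y z := by
  rw [h.fderiv_eq]

theorem fderiv_comp_apply {c : F → H} {u : E → F} {y : E}
    (hc : DifferentiableAt ℝ c (u y)) (hu : DifferentiableAt ℝ u y) (z : E) :
    fderiv ℝ (fun x => c (u x)) y z = fderiv ℝ c (u y) (fderiv ℝ u y z) := by
  have := fderiv_comp y hc hu
  simp only [Function.comp_def] at this
  rw [this]; rfl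

section

variable {H₁ H₂ H₃ : Type*} [NormedAddCommGroup H₁] [NormedSpace ℝ H₁] [NormedAddCommGroup H₂]
  [NormedSpace ℝ H₂] [NormedAddCommGroup H₃] [NormedSpace ℝ H₃]

theorem differentiableAt_clm_apply₂ {B : E → H₁ →L[ℝ] H₂ →L[ℝ] H} {a : E → H₁} {b : E → H₂} {y : E}
    (hB : DifferentiableAt ℝ B y) (ha : DifferentiableAt ℝ a y) (hb : DifferentiableAt ℝ b y) :
    DifferentiableAt ℝ (fun x => B x (a x) (b x)) y :=
  (hB.clm_apply ha).clm_apply hb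

theorem fderiv_clm_apply₂ {B : E → H₁ →L[ℝ] H₂ →L[ℝ] H} {a : E → H₁} {b : E → H₂} {y : E}
    (hB : DifferentiableAt ℝ B y) (ha : DifferentiableAt ℝ a y) (hb : DifferentiableAt ℝ b y)
    (z : E) : fderiv ℝ (fun x => B x (a x) (b x)) y z
      = fderiv ℝ B y z (a y) (b y) + B y (fderiv ℝ a y z) (b y) + B y (a y) (fderiv ℝ b y z) := by
  rw [fderiv_clm_apply_apply (hB.clm_apply ha) hb, fderiv_clm_apply_apply hB ha]
  rfl

theorem fderiv_clm_apply₃ {B : E → H₁ →L[ℝ] H₂ →L[ℝ] H₃ →L[ℝ] H} {a : E → H₁} {b : E → H₂}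
    {c : E → H₃} {y : E} (hB : DifferentiableAt ℝ B y) (ha : DifferentiableAt ℝ a y)
    (hb : DifferentiableAt ℝ b y) (hc : DifferentiableAt ℝ c y) (z : E) :
    fderiv ℝ (fun x => B x (a x) (b x) (c x)) y z
      = fderiv ℝ B y z (a y) (b y) (c y) + B y (fderiv ℝ a y z) (b y) (c y)
        + B y (a y) (fderiv ℝ b y z) (c y) + B y (a y) (b y) (fderiv ℝ c y z) := by
  rw [fderiv_clm_apply_apply ((hB.clm_apply ha).clm_apply hb) hc, fderiv_clm_apply₂ hB ha hb]
  rfl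

end

/-- The curvature of the connection `∂ + A`. -/
def connCurv (A : E → E →L[ℝ] E →L[ℝ] E) (y u v w : E) : E :=
  fderiv ℝ A y u v w - fderiv ℝ A y v u w + A y u (A y v w) - A y v (A y u w)

/-- The covariant derivative `(∇_z R)(u, v) w` of the curvature of `∂ + A`. -/
def connCurvDeriv (A : E → E →L[ℝ] E →L[ℝ] E) (y z u v w : E) : E :=
  fderiv ℝ (fun x => connCurv A x u v w) y z + A y z (connCurv A y u v w)
    - connCurv A y (A y z u) v w - connCurv A y u (A y z v) w - connCurv A y u v (A y z w)

variable {A : E → E →L[ℝ] E →L[ℝ] E} {y : E}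

theorem differentiableAt_of_contDiffAt_infty {f : E → F} (hf : ContDiffAt ℝ ∞ f y) :
    DifferentiableAt ℝ f y := hf.differentiableAt (by simp)

theorem contDiffAt_infty_fderiv {f : E → F} (hf : ContDiffAt ℝ ∞ f y) :
    ContDiffAt ℝ ∞ (fderiv ℝ f) y := hf.fderiv_right (m := ∞) (by simp)

theorem fderiv_fderiv_symm {f : E → F} (hf : ContDiffAt ℝ ∞ f y) (u v : E) :
    fderiv ℝ (fderiv ℝ f) y u v = fderiv ℝ (fderiv ℝ f) y v u :=
  (hf.isSymmSndFDerivAt (by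
    simpa [minSmoothness_of_isRCLikeNormedField] using
      (WithTop.coe_le_coe.2 le_top : ((2 : ℕ∞) : WithTop ℕ∞) ≤ ∞))).eq u v

theorem contDiffAt_connCurv (hA : ContDiffAt ℝ ∞ A y) (u v w : E) :
    ContDiffAt ℝ ∞ (fun x => connCurv A x u v w) y := by
  have := contDiffAt_infty_fderiv hA
  unfold connCurv
  fun_prop

theorem fderiv_connCurv (hA : ContDiffAt ℝ ∞ A y) (z u v w : E) :
    fderiv ℝ (fun x => connCurv A x u v w) y z =
      fderiv ℝ (fderiv ℝ A) y z u v w - fderiv ℝ (fderiv ℝ A) y z v u w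
      + (fderiv ℝ A y z u (A y v w) + A y u (fderiv ℝ A y z v w))
      - (fderiv ℝ A y z v (A y u w) + A y v (fderiv ℝ A y z u w)) := by
  have h1 := contDiffAt_infty_fderiv hA
  have d1 := differentiableAt_of_contDiffAt_infty h1
  have d := differentiableAt_of_contDiffAt_infty hA
  have e1 (u v w : E) : fderiv ℝ (fun x => fderiv ℝ A x u v w) y z
      = fderiv ℝ (fderiv ℝ A) y z u v w := by
    rw [fderiv_clm_apply_const_apply (by fun_prop), fderiv_clm_apply_const_apply (by fun_prop),
      fderiv_clm_apply_const_apply d1]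
  have e2 (u v w : E) : fderiv ℝ (fun x => A x u (A x v w)) y z
      = fderiv ℝ A y z u (A y v w) + A y u (fderiv ℝ A y z v w) := by
    rw [fderiv_clm_apply_apply (by fun_prop) (by fun_prop), fderiv_clm_apply_const_apply d,
      fderiv_clm_apply_const_apply (by fun_prop), fderiv_clm_apply_const_apply d]
  unfold connCurv
  rw [fderiv_fun_sub (by fun_prop) (by fun_prop), fderiv_fun_add (by fun_prop) (by fun_prop),
    fderiv_fun_sub (by fun_prop) (by fun_prop)]
  simp only [_root_.sub_apply, _root_.add_apply, e1, e2]

theorem connCurv_skew (A : E → E →L[ℝ] E →L[ℝ] E) (y u v w : E) :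
    connCurv A y u v w = - connCurv A y v u w := by
  unfold connCurv; abel

/-- Differentiating torsion-freeness makes DA symmetric in its last two arguments; this is why
symmetry of A is needed near y and not only at y. -/
theorem connCurv_bianchi (hs : ∀ᶠ x in 𝓝 y, ∀ u v, A x u v = A x v u)
    (hA : ContDiffAt ℝ ∞ A y) (u v w : E) :
    connCurv A y u v w + connCurv A y v w u + connCurv A y w u v = 0 := by
  have d := differentiableAt_of_contDiffAt_infty hA
  have key (z u v : E) : fderiv ℝ A y z u v = fderiv ℝ A y z v u := by
    have : (fun x => A x u v) =ᶠ[𝓝 y] (fun x => A x v u) := by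
      filter_upwards [hs] with x hx using hx u v
    have := fderiv_apply_congr this z
    rwa [fderiv_clm_apply_const_apply (by fun_prop), fderiv_clm_apply_const_apply d,
      fderiv_clm_apply_const_apply (by fun_prop), fderiv_clm_apply_const_apply d] at this
  have hs := hs.self_of_nhds
  unfold connCurv
  rw [key u v w, key v w u, key w u v, hs v w, hs u w, hs u v]
  abel

theorem connCurvDeriv_skew (A : E → E →L[ℝ] E →L[ℝ] E) (y z u v w : E) :
    connCurvDeriv A y z u v w = - connCurvDeriv A y z v u w := by
  have : (fun x => connCurv A x u v w) = fun x => - connCurv A x v u w := by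
    ext x; exact connCurv_skew A x u v w
  unfold connCurvDeriv
  rw [this, fderiv_fun_neg, connCurv_skew A y u v w, connCurv_skew A y (A y z u) v w,
    connCurv_skew A y u (A y z v), connCurv_skew A y u v (A y z w)]
  simp
  abel

theorem connCurvDeriv_bianchi (hs : ∀ᶠ x in 𝓝 y, ∀ u v, A x u v = A x v u)
    (hA : ∀ᶠ x in 𝓝 y, ContDiffAt ℝ ∞ A x) (z u v w : E) :
    connCurvDeriv A y z u v w + connCurvDeriv A y z v w u + connCurvDeriv A y z w u v = 0 := by
  have hA' := hA.self_of_nhds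
  have B := connCurv_bianchi hs hA'
  have D : fderiv ℝ (fun x => connCurv A x u v w) y z + fderiv ℝ (fun x => connCurv A x v w u) y z
      + fderiv ℝ (fun x => connCurv A x w u v) y z = 0 := by
    have h1 := differentiableAt_of_contDiffAt_infty (contDiffAt_connCurv hA' u v w)
    have h2 := differentiableAt_of_contDiffAt_infty (contDiffAt_connCurv hA' v w u)
    have h3 := differentiableAt_of_contDiffAt_infty (contDiffAt_connCurv hA' w u v)
    have : (fun x => connCurv A x u v w + connCurv A x v w u + connCurv A x w u v)
        =ᶠ[𝓝 y] fun _ => (0 : E) := by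
      filter_upwards [hs.eventually_nhds, hA] with x hx hx' using connCurv_bianchi hx hx' u v w
    have := fderiv_apply_congr this z
    rw [fderiv_fun_add (by fun_prop) (by fun_prop), fderiv_fun_add (by fun_prop) (by fun_prop)]
      at this
    simpa using this
  have B0 := congrArg (A y z) (B u v w)
  have B1 := B (A y z u) v w
  have B2 := B u (A y z v) w
  have B3 := B u v (A y z w)
  simp only [map_add, map_zero] at B0
  unfold connCurvDeriv
  linear_combination (norm := module) D + B0 - B1 - B2 - B3

/-- The second derivatives of A cancel in pairs by symmetry of D²A, the remaining terms by
torsion-freeness. Here symmetry of A at y alone suffices. -/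
theorem connCurvDeriv_second_bianchi (hs : ∀ u v, A y u v = A y v u)
    (hA : ContDiffAt ℝ ∞ A y) (z u v w : E) :
    connCurvDeriv A y z u v w + connCurvDeriv A y u v z w + connCurvDeriv A y v z u w = 0 := by
  have s := fderiv_fderiv_symm hA
  unfold connCurvDeriv
  rw [fderiv_connCurv hA, fderiv_connCurv hA, fderiv_connCurv hA]
  unfold connCurv
  rw [s u z, s v z, s v u, hs u z, hs v z, hs v u]
  simp only [map_add, map_sub, _root_.sub_apply, _root_.add_apply]
  abel

/-- The map `φ` is affine at `y` for the connections `∂ + A` and `∂ + A'`: its second fundamental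
form vanishes there. -/
def IsAffineAt (A : E → E →L[ℝ] E →L[ℝ] E) (A' : F → F →L[ℝ] F →L[ℝ] F) (φ : E → F) (y : E) :
    Prop :=
  ∀ u v, fderiv ℝ (fderiv ℝ φ) y u v
    = fderiv ℝ φ y (A y u v) - A' (φ y) (fderiv ℝ φ y u) (fderiv ℝ φ y v)

/-- The chain rule for second fundamental forms. It carries affineness from one pair of charts to
any other through the transition maps. -/
theorem IsAffineAt.comp {G : Type*} [NormedAddCommGroup G] [NormedSpace ℝ G]
    {A' : F → F →L[ℝ] F →L[ℝ] F} {A'' : G → G →L[ℝ] G →L[ℝ] G} {φ : E → F} {ψ : F → G}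
    (hψ : IsAffineAt A' A'' ψ (φ y)) (hφ : IsAffineAt A A' φ y)
    (hcψ : ∀ᶠ x in 𝓝 (φ y), ContDiffAt ℝ ∞ ψ x) (hcφ : ∀ᶠ x in 𝓝 y, ContDiffAt ℝ ∞ φ x) :
    IsAffineAt A A'' (ψ ∘ φ) y := by
  intro u v
  have cψ := hcψ.self_of_nhds
  have cφ := hcφ.self_of_nhds
  have dψ := differentiableAt_of_contDiffAt_infty cψ
  have dφ := differentiableAt_of_contDiffAt_infty cφ
  have ddψ := differentiableAt_of_contDiffAt_infty (contDiffAt_infty_fderiv cψ)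
  have ddφ := differentiableAt_of_contDiffAt_infty (contDiffAt_infty_fderiv cφ)
  have e : fderiv ℝ (ψ ∘ φ) =ᶠ[𝓝 y] fun x => (fderiv ℝ ψ (φ x)).comp (fderiv ℝ φ x) := by
    filter_upwards [hcφ, dφ.continuousAt.eventually hcψ] with x h1 h2
    exact fderiv_comp x (differentiableAt_of_contDiffAt_infty h2)
      (differentiableAt_of_contDiffAt_infty h1)
  have ed : DifferentiableAt ℝ (fun x => fderiv ℝ ψ (φ x)) y := ddψ.comp y dφ
  have e2 : fderiv ℝ (fderiv ℝ (ψ ∘ φ)) y u v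
      = fderiv ℝ (fderiv ℝ ψ) (φ y) (fderiv ℝ φ y u) (fderiv ℝ φ y v)
        + fderiv ℝ ψ (φ y) (fderiv ℝ (fderiv ℝ φ) y u v) := by
    rw [e.fderiv_eq, ← fderiv_clm_apply_const_apply (by fun_prop)]
    simp only [ContinuousLinearMap.comp_apply]
    rw [fderiv_clm_apply_apply ed (by fun_prop), fderiv_clm_apply_const_apply ddφ]
    congr 1
    have := fderiv_comp y ddψ dφ
    simp only [Function.comp_def] at this
    rw [this]; rfl
  rw [e2, hψ, hφ, e.self_of_nhds]
  simp

end Connection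

/-! ### Trilinear tensors, and the effect of affine maps on R and ∇R. -/

section Connection

set_option synthInstance.maxHeartbeats 200000

variable {E : Type*} [NormedAddCommGroup E] [NormedSpace ℝ E]
  {F : Type*} [NormedAddCommGroup F] [NormedSpace ℝ F]
  {H : Type*} [NormedAddCommGroup H] [NormedSpace ℝ H]

variable {A : E → E →L[ℝ] E →L[ℝ] E} {y : E}

/-- The map `R : E × E × E → E` is linear in each argument. -/
structure IsTrilinear (R : E → E → E → E) : Prop where
  add₁ : ∀ a b v w, R (a + b) v w = R a v w + R b v w
  smul₁ : ∀ (r : ℝ) a v w, R (r • a) v w = r • R a v w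
  add₂ : ∀ a b v w, R v (a + b) w = R v a w + R v b w
  smul₂ : ∀ (r : ℝ) a v w, R v (r • a) w = r • R v a w
  add₃ : ∀ a b v w, R v w (a + b) = R v w a + R v w b
  smul₃ : ∀ (r : ℝ) a v w, R v w (r • a) = r • R v w a

theorem clm_add_apply₃ {V₁ V₂ V₃ : Type*} [NormedAddCommGroup V₁] [NormedSpace ℝ V₁]
    [NormedAddCommGroup V₂] [NormedSpace ℝ V₂] [NormedAddCommGroup V₃] [NormedSpace ℝ V₃]
    (D : E →L[ℝ] V₁ →L[ℝ] V₂ →L[ℝ] V₃) (a b : E) (v : V₁) (w : V₂) :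
    D (a + b) v w = D a v w + D b v w := by
  rw [ContinuousLinearMap.map_add₂, _root_.add_apply]

theorem clm_smul_apply₃ {V₁ V₂ V₃ : Type*} [NormedAddCommGroup V₁] [NormedSpace ℝ V₁]
    [NormedAddCommGroup V₂] [NormedSpace ℝ V₂] [NormedAddCommGroup V₃] [NormedSpace ℝ V₃]
    (D : E →L[ℝ] V₁ →L[ℝ] V₂ →L[ℝ] V₃) (r : ℝ) (a : E) (v : V₁) (w : V₂) :
    D (r • a) v w = r • D a v w := by
  rw [ContinuousLinearMap.map_smul₂, _root_.smul_apply]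

theorem isTrilinear_clm (D : E →L[ℝ] E →L[ℝ] E →L[ℝ] E) : IsTrilinear (fun u v w => D u v w) where
  add₁ a b v w := clm_add_apply₃ D a b v w
  smul₁ r a v w := clm_smul_apply₃ D r a v w
  add₂ a b v w := ContinuousLinearMap.map_add₂ (D v) a b w
  smul₂ r a v w := ContinuousLinearMap.map_smul₂ (D v) r a w
  add₃ a b v w := ContinuousLinearMap.map_add (D v w) a b
  smul₃ r a v w := ContinuousLinearMap.map_smul (D v w) r a

theorem isTrilinear_clm_comp (B : E →L[ℝ] E →L[ℝ] E) :
    IsTrilinear (fun u v w => B u (B v w)) where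
  add₁ a b v w := B.map_add₂ a b _
  smul₁ r a v w := B.map_smul₂ r a _
  add₂ a b v w := by rw [B.map_add₂, map_add]
  smul₂ r a v w := by rw [B.map_smul₂, map_smul]
  add₃ a b v w := by rw [map_add, map_add]
  smul₃ r a v w := by rw [map_smul, map_smul]

theorem IsTrilinear.add {R S : E → E → E → E} (hR : IsTrilinear R) (hS : IsTrilinear S) :
    IsTrilinear (fun u v w => R u v w + S u v w) where
  add₁ a b v w := by rw [hR.add₁, hS.add₁]; abel
  smul₁ r a v w := by rw [hR.smul₁, hS.smul₁, smul_add]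
  add₂ a b v w := by rw [hR.add₂, hS.add₂]; abel
  smul₂ r a v w := by rw [hR.smul₂, hS.smul₂, smul_add]
  add₃ a b v w := by rw [hR.add₃, hS.add₃]; abel
  smul₃ r a v w := by rw [hR.smul₃, hS.smul₃, smul_add]

theorem IsTrilinear.sub {R S : E → E → E → E} (hR : IsTrilinear R) (hS : IsTrilinear S) :
    IsTrilinear (fun u v w => R u v w - S u v w) where
  add₁ a b v w := by rw [hR.add₁, hS.add₁]; abel
  smul₁ r a v w := by rw [hR.smul₁, hS.smul₁, smul_sub]
  add₂ a b v w := by rw [hR.add₂, hS.add₂]; abel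
  smul₂ r a v w := by rw [hR.smul₂, hS.smul₂, smul_sub]
  add₃ a b v w := by rw [hR.add₃, hS.add₃]; abel
  smul₃ r a v w := by rw [hR.smul₃, hS.smul₃, smul_sub]

theorem IsTrilinear.swap {R : E → E → E → E} (hR : IsTrilinear R) :
    IsTrilinear (fun u v w => R v u w) where
  add₁ a b v w := hR.add₂ a b v w
  smul₁ r a v w := hR.smul₂ r a v w
  add₂ a b v w := hR.add₁ a b v w
  smul₂ r a v w := hR.smul₁ r a v w
  add₃ a b v w := hR.add₃ a b w v
  smul₃ r a v w := hR.smul₃ r a w v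

section

variable {R : E → E → E → E} (hR : IsTrilinear R) (L : E →L[ℝ] E)
include hR

theorem IsTrilinear.comp₀ : IsTrilinear (fun u v w => L (R u v w)) where
  add₁ a b v w := by rw [hR.add₁, map_add]
  smul₁ r a v w := by rw [hR.smul₁, map_smul]
  add₂ a b v w := by rw [hR.add₂, map_add]
  smul₂ r a v w := by rw [hR.smul₂, map_smul]
  add₃ a b v w := by rw [hR.add₃, map_add]
  smul₃ r a v w := by rw [hR.smul₃, map_smul]

theorem IsTrilinear.comp₁ : IsTrilinear (fun u v w => R (L u) v w) where
  add₁ a b v w := by rw [map_add, hR.add₁]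
  smul₁ r a v w := by rw [map_smul, hR.smul₁]
  add₂ a b v w := hR.add₂ _ _ _ _
  smul₂ r a v w := hR.smul₂ _ _ _ _
  add₃ a b v w := hR.add₃ _ _ _ _
  smul₃ r a v w := hR.smul₃ _ _ _ _

theorem IsTrilinear.comp₂ : IsTrilinear (fun u v w => R u (L v) w) where
  add₁ a b v w := hR.add₁ _ _ _ _
  smul₁ r a v w := hR.smul₁ _ _ _ _
  add₂ a b v w := by rw [map_add, hR.add₂]
  smul₂ r a v w := by rw [map_smul, hR.smul₂]
  add₃ a b v w := hR.add₃ _ _ _ _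
  smul₃ r a v w := hR.smul₃ _ _ _ _

theorem IsTrilinear.comp₃ : IsTrilinear (fun u v w => R u v (L w)) where
  add₁ a b v w := hR.add₁ _ _ _ _
  smul₁ r a v w := hR.smul₁ _ _ _ _
  add₂ a b v w := hR.add₂ _ _ _ _
  smul₂ r a v w := hR.smul₂ _ _ _ _
  add₃ a b v w := by rw [map_add, hR.add₃]
  smul₃ r a v w := by rw [map_smul, hR.smul₃]

end

section

variable {R : E → E → E → E} (hR : IsTrilinear R) (a b v w : E)
include hR

theorem IsTrilinear.sub₁ : R (a - b) v w = R a v w - R b v w := by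
  rw [sub_eq_add_neg, ← neg_one_smul ℝ b, hR.add₁, hR.smul₁, neg_one_smul, ← sub_eq_add_neg]

theorem IsTrilinear.sub₂ : R v (a - b) w = R v a w - R v b w := hR.swap.sub₁ a b v w

theorem IsTrilinear.sub₃ : R v w (a - b) = R v w a - R v w b := by
  rw [sub_eq_add_neg, ← neg_one_smul ℝ b, hR.add₃, hR.smul₃, neg_one_smul, ← sub_eq_add_neg]

end

theorem isTrilinear_connCurv (A : E → E →L[ℝ] E →L[ℝ] E) (y : E) :
    IsTrilinear (connCurv A y) :=
  (((isTrilinear_clm (fderiv ℝ A y)).sub (isTrilinear_clm (fderiv ℝ A y)).swap).add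
    (isTrilinear_clm_comp (A y))).sub (isTrilinear_clm_comp (A y)).swap

theorem isTrilinear_connCurvDeriv (hA : ContDiffAt ℝ ∞ A y) (z : E) :
    IsTrilinear (connCurvDeriv A y z) := by
  have T := isTrilinear_connCurv A y
  have hD : IsTrilinear (fun u v w => fderiv ℝ (fun x => connCurv A x u v w) y z) := by
    have d (u v w : E) := differentiableAt_of_contDiffAt_infty (contDiffAt_connCurv hA u v w)
    refine ⟨fun a b v w => ?_, fun r a v w => ?_, fun a b v w => ?_, fun r a v w => ?_,
      fun a b v w => ?_, fun r a v w => ?_⟩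
    · rw [← _root_.add_apply, ← fderiv_fun_add (d _ _ _) (d _ _ _)]
      simp only [(isTrilinear_connCurv A _).add₁]
    · rw [← _root_.smul_apply, ← fderiv_fun_const_smul (d _ _ _)]
      simp only [(isTrilinear_connCurv A _).smul₁]
    · rw [← _root_.add_apply, ← fderiv_fun_add (d _ _ _) (d _ _ _)]
      simp only [(isTrilinear_connCurv A _).add₂]
    · rw [← _root_.smul_apply, ← fderiv_fun_const_smul (d _ _ _)]
      simp only [(isTrilinear_connCurv A _).smul₂]
    · rw [← _root_.add_apply, ← fderiv_fun_add (d _ _ _) (d _ _ _)]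
      simp only [(isTrilinear_connCurv A _).add₃]
    · rw [← _root_.smul_apply, ← fderiv_fun_const_smul (d _ _ _)]
      simp only [(isTrilinear_connCurv A _).smul₃]
  exact (((hD.add (T.comp₀ (A y z))).sub (T.comp₁ (A y z))).sub (T.comp₂ (A y z))).sub
    (T.comp₃ (A y z))

variable {A' : F → F →L[ℝ] F →L[ℝ] F} {φ : E → F}

/-- Differentiate D²φ(v, w) = Dφ(A(v, w)) − A'(Dφ v, Dφ w) along u and antisymmetrise in u, v: the
third derivative of φ drops out. -/
theorem IsAffineAt.curv (h : ∀ᶠ x in 𝓝 y, IsAffineAt A A' φ x) (cφ : ContDiffAt ℝ ∞ φ y)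
    (hA : ContDiffAt ℝ ∞ A y) (hA' : ContDiffAt ℝ ∞ A' (φ y)) (u v w : E) :
    fderiv ℝ φ y (connCurv A y u v w)
      = connCurv A' (φ y) (fderiv ℝ φ y u) (fderiv ℝ φ y v) (fderiv ℝ φ y w) := by
  have dφ := differentiableAt_of_contDiffAt_infty cφ
  have c1 := contDiffAt_infty_fderiv cφ
  have c2 := contDiffAt_infty_fderiv c1
  have d1 := differentiableAt_of_contDiffAt_infty c1
  have d2 := differentiableAt_of_contDiffAt_infty c2
  have dA := differentiableAt_of_contDiffAt_infty hA
  have dA' := differentiableAt_of_contDiffAt_infty hA'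
  have key (u v w : E) : fderiv ℝ (fderiv ℝ (fderiv ℝ φ)) y u v w
      = fderiv ℝ (fderiv ℝ φ) y u (A y v w) + fderiv ℝ φ y (fderiv ℝ A y u v w)
        - (fderiv ℝ A' (φ y) (fderiv ℝ φ y u) (fderiv ℝ φ y v) (fderiv ℝ φ y w)
          + A' (φ y) (fderiv ℝ (fderiv ℝ φ) y u v) (fderiv ℝ φ y w)
          + A' (φ y) (fderiv ℝ φ y v) (fderiv ℝ (fderiv ℝ φ) y u w)) := by
    have e : (fun x => fderiv ℝ (fderiv ℝ φ) x v w) =ᶠ[𝓝 y] fun x => fderiv ℝ φ x (A x v w)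
        - A' (φ x) (fderiv ℝ φ x v) (fderiv ℝ φ x w) := by
      filter_upwards [h] with x hx using hx v w
    have e' := fderiv_apply_congr e u
    have ed : DifferentiableAt ℝ (fun x => A' (φ x)) y := dA'.comp y dφ
    have ee := fderiv_comp_apply dA' dφ u
    rw [fderiv_clm_apply_const_apply (by fun_prop), fderiv_clm_apply_const_apply d2,
      fderiv_fun_sub (by fun_prop)
        (differentiableAt_clm_apply₂ ed (by fun_prop) (by fun_prop)),
      _root_.sub_apply,
      fderiv_clm_apply_apply d1 (by fun_prop), fderiv_clm_apply_const_apply (by fun_prop),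
      fderiv_clm_apply_const_apply dA,
      fderiv_clm_apply₂ ed (by fun_prop) (by fun_prop), fderiv_clm_apply_const_apply d1,
      fderiv_clm_apply_const_apply d1, ee] at e'
    exact e'
  have k1 := key u v w
  have k2 := key v u w
  -- D³φ is symmetric in u and v, so its two expressions may be equated; the remaining second
  -- derivatives are then eliminated by affineness.
  rw [fderiv_fderiv_symm c1 u v, k2] at k1
  have h0 := h.self_of_nhds
  unfold IsAffineAt at h0
  rw [fderiv_fderiv_symm cφ v u] at k1
  simp only [h0 u (A y v w), h0 v (A y u w), h0 u w, h0 v w] at k1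
  unfold connCurv
  simp only [map_add, map_sub] at k1 ⊢
  linear_combination (norm := module) k1.symm

theorem ContDiffAt.differentiableAt_comp_and_fderiv_comp {c : F → H}
    (hc : ContDiffAt ℝ ∞ c (φ y)) (dφ : DifferentiableAt ℝ φ y) (z : E) :
    DifferentiableAt ℝ (fun x => c (φ x)) y ∧ DifferentiableAt ℝ (fun x => fderiv ℝ c (φ x)) y ∧
    fderiv ℝ (fun x => c (φ x)) y z = fderiv ℝ c (φ y) (fderiv ℝ φ y z) ∧
    fderiv ℝ (fun x => fderiv ℝ c (φ x)) y z = fderiv ℝ (fderiv ℝ c) (φ y) (fderiv ℝ φ y z) := by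
  have dc := differentiableAt_of_contDiffAt_infty hc
  have dc' := differentiableAt_of_contDiffAt_infty (contDiffAt_infty_fderiv hc)
  exact ⟨dc.comp y dφ, DifferentiableAt.comp (g := fderiv ℝ c) y dc' dφ,
    fderiv_comp_apply dc dφ z, fderiv_comp_apply dc' dφ z⟩

theorem fderiv_sub_add_sub {p q r s : E → F} (hp : DifferentiableAt ℝ p y)
    (hq : DifferentiableAt ℝ q y) (hr : DifferentiableAt ℝ r y) (hs : DifferentiableAt ℝ s y)
    (z : E) : fderiv ℝ (fun x => p x - q x + r x - s x) y z
      = fderiv ℝ p y z - fderiv ℝ q y z + fderiv ℝ r y z - fderiv ℝ s y z := by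
  rw [fderiv_fun_sub (by fun_prop) hs, fderiv_fun_add (by fun_prop) hr, fderiv_fun_sub hp hq]
  rfl

/-- The product rule for a trilinear form evaluated on moving vectors, with coefficients moving
along φ. -/
theorem fderiv_connCurv_comp (hA' : ContDiffAt ℝ ∞ A' (φ y)) (dφ : DifferentiableAt ℝ φ y)
    {a b c : E → F} (da : DifferentiableAt ℝ a y) (db : DifferentiableAt ℝ b y)
    (dc : DifferentiableAt ℝ c y) (z : E) :
    fderiv ℝ (fun x => connCurv A' (φ x) (a x) (b x) (c x)) y z
      = fderiv ℝ (fun x => connCurv A' x (a y) (b y) (c y)) (φ y) (fderiv ℝ φ y z)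
        + connCurv A' (φ y) (fderiv ℝ a y z) (b y) (c y)
        + connCurv A' (φ y) (a y) (fderiv ℝ b y z) (c y)
        + connCurv A' (φ y) (a y) (b y) (fderiv ℝ c y z) := by
  obtain ⟨ed, ed1, ee, ee1⟩ := ContDiffAt.differentiableAt_comp_and_fderiv_comp hA' dφ z
  have f2 {b c : E → F} (db : DifferentiableAt ℝ b y) (dc : DifferentiableAt ℝ c y) :
      DifferentiableAt ℝ (fun x => A' (φ x) (b x) (c x)) y :=
    differentiableAt_clm_apply₂ ed db dc
  have f3 {a b c : E → F} (da : DifferentiableAt ℝ a y) (db : DifferentiableAt ℝ b y)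
      (dc : DifferentiableAt ℝ c y) :
      DifferentiableAt ℝ (fun x => A' (φ x) (a x) (A' (φ x) (b x) (c x))) y := f2 da (f2 db dc)
  have f4 {a b c : E → F} (da : DifferentiableAt ℝ a y) (db : DifferentiableAt ℝ b y)
      (dc : DifferentiableAt ℝ c y) :
      DifferentiableAt ℝ (fun x => fderiv ℝ A' (φ x) (a x) (b x) (c x)) y :=
    differentiableAt_clm_apply₂ (ed1.clm_apply da) db dc
  have L := fderiv_sub_add_sub (f4 da db dc) (f4 db da dc) (f3 da db dc) (f3 db da dc) z
  rw [fderiv_clm_apply₃ ed1 da db dc z, fderiv_clm_apply₃ ed1 db da dc z,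
    fderiv_clm_apply₂ ed da (f2 db dc) z, fderiv_clm_apply₂ ed db (f2 da dc) z,
    fderiv_clm_apply₂ ed db dc z, fderiv_clm_apply₂ ed da dc z, ee, ee1] at L
  have R := fderiv_connCurv hA' (fderiv ℝ φ y z) (a y) (b y) (c y)
  rw [R]
  refine L.trans ?_
  unfold connCurv
  rw [map_add, map_add, map_add, map_add]
  abel

/-- Differentiate the identity `IsAffineAt.curv`, which holds near y, and replace each second
derivative of φ by its value from affineness. The A-terms and A'-terms are exactly the corrections
that turn ∂R into ∇R on either side. -/
theorem IsAffineAt.curvDeriv (h : ∀ᶠ x in 𝓝 y, IsAffineAt A A' φ x)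
    (hcφ : ∀ᶠ x in 𝓝 y, ContDiffAt ℝ ∞ φ x)
    (hcA : ∀ᶠ x in 𝓝 y, ContDiffAt ℝ ∞ A x)
    (hcA' : ∀ᶠ x in 𝓝 (φ y), ContDiffAt ℝ ∞ A' x) (z u v w : E) :
    fderiv ℝ φ y (connCurvDeriv A y z u v w)
      = connCurvDeriv A' (φ y) (fderiv ℝ φ y z) (fderiv ℝ φ y u) (fderiv ℝ φ y v)
          (fderiv ℝ φ y w) := by
  have cφ := hcφ.self_of_nhds
  have hA := hcA.self_of_nhds
  have hA' := hcA'.self_of_nhds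
  have dφ := differentiableAt_of_contDiffAt_infty cφ
  have c1 := contDiffAt_infty_fderiv cφ
  have d1 := differentiableAt_of_contDiffAt_infty c1
  have dK := differentiableAt_of_contDiffAt_infty (contDiffAt_connCurv hA u v w)
  have K := IsAffineAt.curv h cφ hA hA'
  have e : (fun x => fderiv ℝ φ x (connCurv A x u v w)) =ᶠ[𝓝 y] fun x =>
      connCurv A' (φ x) (fderiv ℝ φ x u) (fderiv ℝ φ x v) (fderiv ℝ φ x w) := by
    filter_upwards [h.eventually_nhds, hcφ, hcA, dφ.continuousAt.eventually hcA'] with x h1 h2 h3 h4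
    exact IsAffineAt.curv h1 h2 h3 h4 u v w
  have e' := fderiv_apply_congr e z
  rw [fderiv_clm_apply_apply d1 dK] at e'
  have h0 := h.self_of_nhds
  unfold IsAffineAt at h0
  have g := fderiv_connCurv_comp hA' dφ (a := fun x => fderiv ℝ φ x u)
    (b := fun x => fderiv ℝ φ x v) (c := fun x => fderiv ℝ φ x w) (by fun_prop) (by fun_prop)
    (by fun_prop) z
  rw [fderiv_clm_apply_const_apply d1, fderiv_clm_apply_const_apply d1,
    fderiv_clm_apply_const_apply d1] at g
  rw [g] at e'
  have k0 := h0 z (connCurv A y u v w)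
  rw [k0] at e'
  have T := isTrilinear_connCurv A' (φ y)
  rw [h0 z u, h0 z v, h0 z w, T.sub₁, T.sub₂, T.sub₃, ← K, ← K, ← K, K u v w] at e'
  unfold connCurvDeriv
  rw [map_sub, map_sub, map_sub, map_add]
  linear_combination (norm := module) e'

end Connection

/-! ### Traces, algebraic curvature tensors, and orthogonal submersions of inner product spaces. -/

section LinearAlgebra

variable {E : Type*} [NormedAddCommGroup E] [NormedSpace ℝ E]
  {F : Type*} [NormedAddCommGroup F] [NormedSpace ℝ F]

/-- Symmetric positive definite bilinear forms. -/
structure IsInner (B : E →L[ℝ] E →L[ℝ] ℝ) : Prop where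
  symm : ∀ v w, B v w = B w v
  pos : ∀ v, v ≠ 0 → 0 < B v v

namespace IsInner

variable {B : E →L[ℝ] E →L[ℝ] ℝ} (hB : IsInner B)
include hB

theorem eq_zero_of_self {v : E} (h : B v v = 0) : v = 0 := by
  by_contra hv
  exact (hB.pos v hv).ne' h

theorem ext {v v' : E} (h : ∀ w, B v w = B v' w) : v = v' := by
  rw [← sub_eq_zero]
  apply hB.eq_zero_of_self
  rw [B.map_sub₂, h, sub_self]

variable [FiniteDimensional ℝ E]

theorem isInvertible : B.IsInvertible := by
  have hinj : Function.Injective (B : E →ₗ[ℝ] E →L[ℝ] ℝ) := by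
    intro v w h
    exact hB.ext fun z => congrArg (fun L : E →L[ℝ] ℝ => L z) h
  have hdim : finrank ℝ E = finrank ℝ (E →L[ℝ] ℝ) := by
    rw [← (LinearMap.toContinuousLinearMap : (E →ₗ[ℝ] ℝ) ≃ₗ[ℝ] (E →L[ℝ] ℝ)).finrank_eq]
    exact (Subspace.dual_finrank_eq (K := ℝ) (V := E)).symm
  refine ⟨(LinearEquiv.ofInjectiveOfFinrankEq _ hinj hdim).toContinuousLinearEquiv, ?_⟩
  ext v w
  rfl

theorem apply_inverse (ℓ : E →L[ℝ] ℝ) (w : E) : B (B.inverse ℓ) w = ℓ w := by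
  obtain ⟨e, he⟩ := hB.isInvertible
  rw [← he, ContinuousLinearMap.inverse_equiv]
  simp

theorem exists_orthonormal_basis :
    ∃ o : Basis (Fin (finrank ℝ E)) ℝ E, ∀ i j, B (o i) (o j) = if i = j then 1 else 0 := by
  let B' : E →ₗ[ℝ] E →ₗ[ℝ] ℝ := LinearMap.mk₂ ℝ (fun v w => B v w)
    (fun a b c => B.map_add₂ a b c) (fun r a c => B.map_smul₂ r a c)
    (fun a b c => map_add _ _ _) (fun r a c => map_smul _ _ _)
  have hs : B'.IsSymm := ⟨fun v w => hB.symm v w⟩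
  obtain ⟨v, hv⟩ := LinearMap.BilinForm.exists_orthogonal_basis hs
  have hpos i : 0 < B (v i) (v i) := hB.pos _ (v.ne_zero i)
  let w : ∀ i, ℝˣ := fun i => Units.mk0 (Real.sqrt (B (v i) (v i)))⁻¹
    (inv_ne_zero (Real.sqrt_ne_zero'.2 (hpos i)))
  refine ⟨v.unitsSMul w, fun i j => ?_⟩
  rw [Basis.unitsSMul_apply, Basis.unitsSMul_apply]
  have e : B (w i • v i) (w j • v j)
      = (Real.sqrt (B (v i) (v i)))⁻¹ * ((Real.sqrt (B (v j) (v j)))⁻¹ * B (v i) (v j)) := by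
    change B ((Real.sqrt (B (v i) (v i)))⁻¹ • v i) ((Real.sqrt (B (v j) (v j)))⁻¹ • v j) = _
    rw [B.map_smul₂, map_smul]; rfl
  rw [e]
  split_ifs with h
  · subst h
    have := Real.mul_self_sqrt (hpos i).le
    have h0 := Real.sqrt_ne_zero'.2 (hpos i)
    field_simp
    rw [sq, this]
  · have : B (v i) (v j) = 0 := hv h
    rw [this]; simp

theorem trace_eq_sum {ι : Type*} [Fintype ι] [DecidableEq ι] (o : Basis ι ℝ E)
    (ho : ∀ i j, B (o i) (o j) = if i = j then 1 else 0) (T : E →ₗ[ℝ] E) :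
    LinearMap.trace ℝ E T = ∑ i, B (T (o i)) (o i) := by
  have hr (x : E) (i : ι) : o.repr x i = B x (o i) := by
    conv_rhs => rw [← o.sum_repr x]
    rw [map_sum, _root_.sum_apply]
    simp [ho]
  rw [LinearMap.trace_eq_matrix_trace ℝ o, Matrix.trace]
  simp [LinearMap.toMatrix_apply, hr]

theorem trace_eq_of_adjoint {T S : E →ₗ[ℝ] E} (h : ∀ u z, B (T u) z = B u (S z)) :
    LinearMap.trace ℝ E T = LinearMap.trace ℝ E S := by
  obtain ⟨o, ho⟩ := hB.exists_orthonormal_basis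
  rw [hB.trace_eq_sum o ho, hB.trace_eq_sum o ho]
  simp only [h]
  exact Finset.sum_congr rfl fun i _ => hB.symm _ _

/-- The trace of a bilinear form with respect to `B` in terms of the Gram matrix of a basis. -/
theorem sum_inv_gram_mul {ι : Type*} [Fintype ι] [DecidableEq ι] (e : Basis ι ℝ E)
    (S : E → E → ℝ) (Q : E →ₗ[ℝ] E) (hQ : ∀ v w, B (Q v) w = S v w) :
    ∑ i, ∑ j, (Matrix.of fun k l => B (e k) (e l))⁻¹ i j * S (e i) (e j)
      = LinearMap.trace ℝ E Q := by
  set g : Matrix ι ι ℝ := Matrix.of fun k l => B (e k) (e l) with hg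
  have hdet : IsUnit g.det := by
    -- A kernel vector of the Gram matrix gives the coordinates of a vector orthogonal to every
    -- basis vector.
    rw [← Matrix.isUnit_iff_isUnit_det, ← Matrix.mulVec_injective_iff_isUnit,
      ← Matrix.coe_mulVecLin, ← LinearMap.ker_eq_bot, LinearMap.ker_eq_bot']
    intro c hc
    have hz (k) : B (e k) (∑ l, c l • e l) = 0 := by
      have := congrFun hc k
      rw [Matrix.mulVecLin_apply, Matrix.mulVec, dotProduct] at this
      simp only [hg, Matrix.of_apply, Pi.zero_apply] at this
      rw [map_sum, ← this]
      simp only [map_smul, smul_eq_mul, mul_comm]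
    have : ∑ l, c l • e l = 0 := by
      refine hB.ext fun w => ?_
      generalize ∑ l, c l • e l = z at hz
      rw [hB.symm, map_zero, _root_.zero_apply, ← e.sum_repr w, map_sum, _root_.sum_apply]
      refine Finset.sum_eq_zero fun k _ => ?_
      rw [B.map_smul₂, hz, smul_zero]
    have h2 := Fintype.linearIndependent_iff.1 e.linearIndependent c this
    exact funext h2
  have hS (i j) : S (e i) (e j) = ∑ k, LinearMap.toMatrix e e Q k i * g k j := by
    rw [← hQ]
    conv_lhs => rw [← e.sum_repr (Q (e i))]
    rw [map_sum, _root_.sum_apply]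
    refine Finset.sum_congr rfl fun k _ => ?_
    rw [B.map_smul₂, LinearMap.toMatrix_apply]; rfl
  have hsymm : g.transpose = g := by
    ext i j; exact hB.symm _ _
  rw [LinearMap.trace_eq_matrix_trace ℝ e]
  -- With [Q] the matrix of Q, S(e i, e j) is the (j, i) entry of g[Q], so the double sum is the
  -- trace of g⁻¹g[Q].
  have : ∀ i j, S (e i) (e j) = (g * LinearMap.toMatrix e e Q) j i := by
    intro i j
    rw [hS, Matrix.mul_apply]
    refine Finset.sum_congr rfl fun k _ => ?_
    rw [mul_comm, ← hsymm, Matrix.transpose_apply, hsymm]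
  simp only [this]
  change ∑ i, ∑ j, g⁻¹ i j * (g * LinearMap.toMatrix e e Q) j i = _
  simp only [← Matrix.mul_apply]
  rw [← Matrix.mul_assoc, Matrix.nonsing_inv_mul _ hdet, Matrix.one_mul]
  rfl

end IsInner

/-- Since T kills ker D, it factors as (T ∘ L) ∘ D for any linear section L of D; cyclicity of the
trace then moves the computation to F. -/
theorem trace_eq_of_semiconj [FiniteDimensional ℝ E] [FiniteDimensional ℝ F] {T : E →ₗ[ℝ] E}
    {T' : F →ₗ[ℝ] F} {D : E →ₗ[ℝ] F} (hD : Function.Surjective D)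
    (h : ∀ u, D (T u) = T' (D u)) (hk : ∀ u, D u = 0 → T u = 0) :
    LinearMap.trace ℝ E T = LinearMap.trace ℝ F T' := by
  obtain ⟨L, hL⟩ := D.exists_rightInverse_of_surjective (LinearMap.range_eq_top.2 hD)
  have e1 : T = (T ∘ₗ L) ∘ₗ D := by
    ext u
    have := hk (u - L (D u)) (by
      rw [map_sub, ← LinearMap.comp_apply D L, hL]; simp)
    rw [map_sub, sub_eq_zero] at this
    exact this
  have e2 : D ∘ₗ (T ∘ₗ L) = T' := by
    ext u
    rw [LinearMap.comp_apply, LinearMap.comp_apply, h, ← LinearMap.comp_apply D L, hL]; rfl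
  rw [e1, LinearMap.trace_comp_comm', e2]

/-- The linear map `u ↦ R(u, v) w`. -/
def IsTrilinear.toLinearMap {R : E → E → E → E} (hR : IsTrilinear R) (v w : E) : E →ₗ[ℝ] E where
  toFun u := R u v w
  map_add' a b := hR.add₁ a b v w
  map_smul' r a := hR.smul₁ r a v w

section Ricci

variable [FiniteDimensional ℝ E] [FiniteDimensional ℝ F]

/-- The Ricci contraction of `R`. -/
def ricTrace (R : E → E → E → E) (v w : E) : ℝ :=
  ∑ i, (finBasis ℝ E).coord i (R (finBasis ℝ E i) v w)

theorem IsTrilinear.ricTrace_eq {R : E → E → E → E} (hR : IsTrilinear R) (v w : E) :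
    ricTrace R v w = LinearMap.trace ℝ E (hR.toLinearMap v w) := by
  rw [LinearMap.trace_eq_matrix_trace ℝ (finBasis ℝ E), Matrix.trace]
  simp only [Matrix.diag_apply, LinearMap.toMatrix_apply]
  rfl

/-- The algebraic symmetries of a curvature tensor. -/
structure IsCurvatureLike (B : E →L[ℝ] E →L[ℝ] ℝ) (R : E → E → E → E) : Prop where
  tri : IsTrilinear R
  skew : ∀ u v w, R u v w = - R v u w
  bianchi : ∀ u v w, R u v w + R v w u + R w u v = 0
  skew_inner : ∀ u v w z, B (R u v w) z = - B (R u v z) w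

namespace IsCurvatureLike

variable {B : E →L[ℝ] E →L[ℝ] ℝ} {R : E → E → E → E}

/-- The octahedron argument: four cyclic identities, combined by means of the two skew-symmetries.
-/
theorem pair_symm (h : IsCurvatureLike B R) (u v w z : E) :
    B (R u v w) z = B (R w z u) v := by
  have b (a b c d) : B (R a b c) d + B (R b c a) d + B (R c a b) d = 0 := by
    rw [← B.map_add₂, ← B.map_add₂, h.bianchi, map_zero]; rfl
  have s (a b c d) : B (R a b c) d = - B (R b a c) d := by
    rw [h.skew a b c, map_neg]; rfl
  have t := h.skew_inner
  have b1 := b u v w z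
  have b2 := b v w z u
  have b3 := b w z u v
  have b4 := b z u v w
  linarith [s u v w z, s v w u z, s w u v z, t u v w z, t v w u z, t w u v z, t v w z u,
    t w z v u, t z v w u, s w z v u, s z v w u, s z u w v, t w z u v, t z u w v, t u w z v,
    s u w z v, t z u v w, t u v z w, t v z u w, s v z u w, s z v u w, t z v u w]

/-- By pair symmetry, u ↦ R(u, v)w and u ↦ R(u, w)v are adjoint to each other, so they have the same
trace. -/
theorem ricTrace_symm (hB : IsInner B) (h : IsCurvatureLike B R) (v w : E) :
    ricTrace R v w = ricTrace R w v := by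
  rw [h.tri.ricTrace_eq, h.tri.ricTrace_eq]
  apply hB.trace_eq_of_adjoint
  intro u z
  change B (R u v w) z = B u (R z w v)
  rw [h.pair_symm, h.skew w z u, hB.symm u, map_neg, _root_.neg_apply, h.skew_inner z w u v,
    neg_neg]

end IsCurvatureLike

/-- The contracted second Bianchi identity. -/
theorem contracted_bianchi {B : E →L[ℝ] E →L[ℝ] ℝ} (hB : IsInner B) {D : E → E → E → E → E}
    (hD : ∀ z, IsCurvatureLike B (D z))
    (h : ∀ z u v w, D z u v w + D u v z w + D v z u w = 0) {ι : Type*} [Fintype ι]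
    [DecidableEq ι] (o : Basis ι ℝ E) (ho : ∀ i j, B (o i) (o j) = if i = j then 1 else 0)
    (x : E) :
    ∑ j, ricTrace (D x) (o j) (o j) = 2 * ∑ j, ricTrace (D (o j)) x (o j) := by
  have t (z v w) : ricTrace (D z) v w = ∑ i, B (D z (o i) v w) (o i) := by
    rw [(hD z).tri.ricTrace_eq, hB.trace_eq_sum o ho]; rfl
  simp only [t]
  -- The second Bianchi identity splits each summand into two divergence terms, which are
  -- interchanged by swapping i and j.
  have e (i j) : B (D x (o i) (o j) (o j)) (o i)
      = B (D (o i) (o j) x (o i)) (o j) + B (D (o j) (o i) x (o j)) (o i) := by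
    have h1 := h x (o i) (o j) (o j)
    have h2 : B (D x (o i) (o j) (o j)) (o i) + B (D (o i) (o j) x (o j)) (o i)
        + B (D (o j) x (o i) (o j)) (o i) = 0 := by
      rw [← B.map_add₂, ← B.map_add₂, h1, map_zero]; rfl
    have h3 := (hD (o i)).skew_inner (o j) x (o j) (o i)
    have h4 : B (D (o j) x (o i) (o j)) (o i) = - B (D (o j) (o i) x (o j)) (o i) := by
      rw [(hD (o j)).skew x, map_neg]; rfl
    linarith
  simp only [e, Finset.sum_add_distrib]
  rw [Finset.sum_comm, two_mul]

/-- `v` is orthogonal to the kernel of `D`. -/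
def IsHor (B : E →L[ℝ] E →L[ℝ] ℝ) (D : E →L[ℝ] F) (v : E) : Prop := ∀ u, D u = 0 → B v u = 0

/-- `D` is surjective and isometric on the orthogonal complement of its kernel. -/
structure IsOrthSubmersion (B : E →L[ℝ] E →L[ℝ] ℝ) (B' : F →L[ℝ] F →L[ℝ] ℝ) (D : E →L[ℝ] F) :
    Prop where
  surj : Function.Surjective D
  isometry : ∀ v, IsHor B D v → B' (D v) (D v) = B v v

/-- The horizontal lift, the adjoint of `D`. -/
def horLift (B : E →L[ℝ] E →L[ℝ] ℝ) (B' : F →L[ℝ] F →L[ℝ] ℝ) (D : E →L[ℝ] F) (a : F) : E :=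
  B.inverse ((B' a).comp D)

namespace IsOrthSubmersion

variable {B : E →L[ℝ] E →L[ℝ] ℝ} {B' : F →L[ℝ] F →L[ℝ] ℝ} {D : E →L[ℝ] F}

theorem _root_.RicciYamabe.IsInner.apply_horLift (hB : IsInner B) (B' : F →L[ℝ] F →L[ℝ] ℝ)
    (D : E →L[ℝ] F) (a : F) (u : E) : B (horLift B B' D a) u = B' a (D u) := by
  rw [horLift, hB.apply_inverse]; rfl

theorem _root_.RicciYamabe.IsInner.isHor_horLift (hB : IsInner B) (B' : F →L[ℝ] F →L[ℝ] ℝ)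
    (D : E →L[ℝ] F) (a : F) : IsHor B D (horLift B B' D a) := by
  intro u hu
  rw [hB.apply_horLift, hu, map_zero]

variable (hB : IsInner B) (hB' : IsInner B') (h : IsOrthSubmersion B B' D)
include hB hB' h

theorem isometry₂ {v w : E} (hv : IsHor B D v) (hw : IsHor B D w) :
    B' (D v) (D w) = B v w := by
  have hvw : IsHor B D (v + w) := fun u hu => by
    rw [B.map_add₂, hv u hu, hw u hu, add_zero]
  have e := h.isometry _ hvw
  simp only [map_add, _root_.add_apply, h.isometry v hv, h.isometry w hw,
    hB.symm w v, hB'.symm (D w) (D v)] at e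
  linarith

/-- If the lift of b lies in ker D, it is both horizontal and vertical, hence zero, and then b = 0.
So D ∘ lift is injective, therefore bijective, and the isometry property forces it to be the
identity. -/
theorem apply_horLift (a : F) : D (horLift B B' D a) = a := by
  let L : F →ₗ[ℝ] E :=
    { toFun := horLift B B' D
      map_add' := fun a b => hB.ext fun u => by
        simp only [hB.apply_horLift, map_add, _root_.add_apply]
      map_smul' := fun r a => hB.ext fun u => by
        simp only [hB.apply_horLift, map_smul, _root_.smul_apply, RingHom.id_apply] }
  have hinj : Function.Injective ((D : E →ₗ[ℝ] F) ∘ₗ L) := by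
    rw [← LinearMap.ker_eq_bot, LinearMap.ker_eq_bot']
    intro b hb
    have hb' : D (horLift B B' D b) = 0 := hb
    have h0 : horLift B B' D b = 0 := hB.eq_zero_of_self (hB.isHor_horLift B' D b _ hb')
    obtain ⟨u, hu⟩ := h.surj b
    apply hB'.eq_zero_of_self
    have := hB.apply_horLift B' D b u
    rw [h0, hu, map_zero] at this
    exact this.symm
  have hsurj := LinearMap.injective_iff_surjective.1 hinj
  apply hB'.ext
  intro c
  obtain ⟨b, rfl⟩ := hsurj c
  change B' _ (D (horLift B B' D b)) = B' a (D (horLift B B' D b))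
  rw [h.isometry₂ hB hB' (hB.isHor_horLift B' D a) (hB.isHor_horLift B' D b), hB.apply_horLift]

/-- Subtracting from u the lift of Du leaves a vertical vector, which v does not see. -/
theorem inner_eq {v : E} (hv : IsHor B D v) (u : E) : B v u = B' (D v) (D u) := by
  have hk : D (u - horLift B B' D (D u)) = 0 := by
    rw [map_sub, h.apply_horLift hB hB', sub_self]
  have h1 := hv _ hk
  rw [map_sub, sub_eq_zero] at h1
  rw [h1, ← h.isometry₂ hB hB' hv (hB.isHor_horLift B' D _), h.apply_horLift hB hB']

theorem horLift_apply {v : E} (hv : IsHor B D v) : horLift B B' D (D v) = v :=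
  hB.ext fun u => by rw [hB.apply_horLift, h.inner_eq hB hB' hv]

/-- D intertwines the two endomorphisms whose traces are compared, so it is enough that u ↦ R(u, v)w
kills vertical u. For such u, R(u, v) has vertical values because D R(u, v)z = R'(0, Dv)Dz = 0. By
skewness |R(u, v)w|² = −⟨R(u, v)R(u, v)w, w⟩, which vanishes as w is horizontal. -/
theorem ricTrace_eq {R : E → E → E → E} {R' : F → F → F → F} (hR : IsTrilinear R)
    (hR' : IsTrilinear R') (hs : ∀ u v w z, B (R u v w) z = - B (R u v z) w)
    (hRR' : ∀ u v w, D (R u v w) = R' (D u) (D v) (D w)) (v : E) {w : E} (hw : IsHor B D w) :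
    ricTrace R v w = ricTrace R' (D v) (D w) := by
  rw [hR.ricTrace_eq, hR'.ricTrace_eq]
  have zero (a b : F) : R' 0 a b = 0 := by
    have := hR'.smul₁ 0 0 a b
    rwa [zero_smul, zero_smul] at this
  refine trace_eq_of_semiconj (D := (D : E →ₗ[ℝ] F)) h.surj (fun u => hRR' u v w) fun u hu => ?_
  have hu' : D u = 0 := hu
  have hv0 (z : E) : D (R u v z) = 0 := by rw [hRR', hu', zero]
  apply hB.eq_zero_of_self
  change B (R u v w) (R u v w) = 0
  rw [hs, hB.symm, hw _ (hv0 _), neg_zero]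

/-- The divergence of the Ricci tensor, applied to a horizontal vector, is preserved. -/
theorem sum_ricTrace_eq {R : E → E → E → E → E} {R' : F → F → F → F → F}
    (hadd' : ∀ a b u v w, R' (a + b) u v w = R' a u v w + R' b u v w)
    (hsmul' : ∀ (r : ℝ) a u v w, R' (r • a) u v w = r • R' a u v w)
    (hR : ∀ z, IsCurvatureLike B (R z)) (hR' : ∀ z, IsCurvatureLike B' (R' z))
    (hRR' : ∀ z u v w, D (R z u v w) = R' (D z) (D u) (D v) (D w))
    {ι : Type*} [Fintype ι] [DecidableEq ι] (o : Basis ι ℝ E)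
    (ho : ∀ i j, B (o i) (o j) = if i = j then 1 else 0)
    {ι' : Type*} [Fintype ι'] [DecidableEq ι'] (o' : Basis ι' ℝ F)
    (ho' : ∀ i j, B' (o' i) (o' j) = if i = j then 1 else 0) {x : E} (hx : IsHor B D x) :
    ∑ j, ricTrace (R (o j)) x (o j) = ∑ j, ricTrace (R' (o' j)) (D x) (o' j) := by
  -- `ricTrace_eq` wants the horizontal vector in the last slot; symmetry of the Ricci trace brings
  -- x there.
  have key (u w : E) : ricTrace (R u) x w = ricTrace (R' (D u)) (D x) (D w) := by
    rw [(hR u).ricTrace_symm hB, (hR' (D u)).ricTrace_symm hB',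
      h.ricTrace_eq hB hB' (hR u).tri (hR' (D u)).tri (hR u).skew_inner (hRR' u) w hx]
  let ℓ (a : F) : F →L[ℝ] ℝ := LinearMap.toContinuousLinearMap
    { toFun := fun c => ricTrace (R' a) (D x) c
      map_add' := fun c d => by
        simp only [ricTrace, (hR' a).tri.add₃, map_add, Finset.sum_add_distrib]
      map_smul' := fun r c => by
        simp only [ricTrace, (hR' a).tri.smul₃, map_smul, Finset.smul_sum, RingHom.id_apply] }
  have hℓ (a c : F) : B' (B'.inverse (ℓ a)) c = ricTrace (R' a) (D x) c := hB'.apply_inverse _ _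
  let Q' : F →ₗ[ℝ] F :=
    { toFun := fun a => B'.inverse (ℓ a)
      map_add' := fun a b => hB'.ext fun c => by
        rw [B'.map_add₂]
        simp only [hℓ, ricTrace, hadd', map_add, Finset.sum_add_distrib]
      map_smul' := fun r a => hB'.ext fun c => by
        rw [RingHom.id_apply, B'.map_smul₂]
        simp only [hℓ, ricTrace, hsmul', map_smul, Finset.smul_sum] }
  let L : F →ₗ[ℝ] E :=
    { toFun := horLift B B' D
      map_add' := fun a b => hB.ext fun u => by
        simp only [hB.apply_horLift, map_add, _root_.add_apply]
      map_smul' := fun r a => hB.ext fun u => by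
        simp only [hB.apply_horLift, map_smul, _root_.smul_apply, RingHom.id_apply] }
  -- L is the lift, adjoint to D. In an orthonormal basis tr(L Q' D) is the sum on E, and cyclicity
  -- with D L = id turns it into tr Q', the sum on F.
  have t1 : LinearMap.trace ℝ E ((L ∘ₗ Q') ∘ₗ (D : E →ₗ[ℝ] F))
      = ∑ j, ricTrace (R (o j)) x (o j) := by
    rw [hB.trace_eq_sum o ho]
    refine Finset.sum_congr rfl fun j _ => ?_
    change B (horLift B B' D (B'.inverse (ℓ (D (o j))))) (o j) = _
    rw [hB.apply_horLift, hℓ, key]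
  have t2 : LinearMap.trace ℝ F Q' = ∑ j, ricTrace (R' (o' j)) (D x) (o' j) := by
    rw [hB'.trace_eq_sum o' ho']
    exact Finset.sum_congr rfl fun j _ => hℓ _ _
  rw [← t1, ← t2, LinearMap.trace_comp_comm']
  congr 1
  ext a
  exact h.apply_horLift hB hB' _

end IsOrthSubmersion

end Ricci

end LinearAlgebra

/-! ### Levi-Civita connection, Ricci and scalar curvature of a metric on an open set. -/

section LocalMetric

set_option synthInstance.maxHeartbeats 200000

variable {E : Type*} [NormedAddCommGroup E] [NormedSpace ℝ E] [FiniteDimensional ℝ E]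

/-- A smooth Riemannian metric on an open subset of a vector space. -/
structure IsMetricOn (G : E → E →L[ℝ] E →L[ℝ] ℝ) (s : Set E) : Prop where
  isOpen : IsOpen s
  smooth : ∀ y ∈ s, ContDiffAt ℝ ∞ G y
  isInner : ∀ y ∈ s, IsInner (G y)

theorem contDiffAt_clm_of_apply {F H : Type*} [NormedAddCommGroup F] [NormedSpace ℝ F]
    [NormedAddCommGroup H] [NormedSpace ℝ H]
    {f : F → E →L[ℝ] H} {y : F} (h : ∀ v, ContDiffAt ℝ ∞ (fun x => f x v) y) :
    ContDiffAt ℝ ∞ f y := by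
  let d := finrank ℝ E
  have hd : d = finrank ℝ (Fin d → ℝ) := (finrank_fin_fun ℝ).symm
  let e₁ := ContinuousLinearEquiv.ofFinrankEq hd
  let e₂ := (e₁.arrowCongr (1 : H ≃L[ℝ] H)).trans (ContinuousLinearEquiv.piRing (Fin d))
  rw [← Function.id_comp f, ← e₂.symm_comp_self]
  exact e₂.symm.contDiff.contDiffAt.comp y (contDiffAt_pi.mpr fun i => h _)

/-- The Koszul form `w ↦ (D(u, v, w) + D(v, u, w) - D(w, u, v)) / 2`. -/
def koszulForm (D : E →L[ℝ] E →L[ℝ] E →L[ℝ] ℝ) (u v : E) : E →L[ℝ] ℝ :=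
  (2⁻¹ : ℝ) • (D u v + D v u - (D.flip u).flip v)

omit [FiniteDimensional ℝ E] in
theorem koszulForm_apply (D : E →L[ℝ] E →L[ℝ] E →L[ℝ] ℝ) (u v w : E) :
    koszulForm D u v w = 2⁻¹ * (D u v w + D v u w - D w u v) := rfl

/-- The Levi-Civita connection as a field of bilinear maps. -/
def conn (G : E → E →L[ℝ] E →L[ℝ] ℝ) (y : E) : E →L[ℝ] E →L[ℝ] E :=
  LinearMap.toContinuousLinearMap
    ((LinearMap.toContinuousLinearMap : (E →ₗ[ℝ] E) ≃ₗ[ℝ] (E →L[ℝ] E)).toLinearMap ∘ₗ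
      LinearMap.mk₂ ℝ (fun u v => (G y).inverse (koszulForm (fderiv ℝ G y) u v))
        (fun a b v => by
          rw [← map_add]; congr 1; ext w
          rw [_root_.add_apply, koszulForm_apply, koszulForm_apply, koszulForm_apply,
            clm_add_apply₃, ContinuousLinearMap.map_add₂, ContinuousLinearMap.map_add₂]
          ring)
        (fun r a v => by
          rw [← map_smul]; congr 1; ext w
          rw [_root_.smul_apply, koszulForm_apply, koszulForm_apply,
            clm_smul_apply₃, ContinuousLinearMap.map_smul₂, ContinuousLinearMap.map_smul₂]
          simp only [smul_eq_mul]; ring)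
        (fun v a b => by
          rw [← map_add]; congr 1; ext w
          rw [_root_.add_apply, koszulForm_apply, koszulForm_apply, koszulForm_apply,
            clm_add_apply₃, ContinuousLinearMap.map_add₂, map_add]
          ring)
        (fun r v a => by
          rw [← map_smul]; congr 1; ext w
          rw [_root_.smul_apply, koszulForm_apply, koszulForm_apply,
            clm_smul_apply₃, ContinuousLinearMap.map_smul₂, map_smul]
          simp only [smul_eq_mul]; ring))

theorem conn_def (G : E → E →L[ℝ] E →L[ℝ] ℝ) (y u v : E) :
    conn G y u v = (G y).inverse (koszulForm (fderiv ℝ G y) u v) := rfl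

namespace IsMetricOn

variable {G : E → E →L[ℝ] E →L[ℝ] ℝ} {s : Set E} (hG : IsMetricOn G s) {y : E} (hy : y ∈ s)
include hG hy

theorem eventually_mem : ∀ᶠ x in 𝓝 y, x ∈ s := hG.isOpen.mem_nhds hy

theorem differentiableAt : DifferentiableAt ℝ G y :=
  differentiableAt_of_contDiffAt_infty (hG.smooth y hy)

theorem fderiv_symm (u v w : E) : fderiv ℝ G y u v w = fderiv ℝ G y u w v := by
  have d := hG.differentiableAt hy
  have e : (fun x => G x v w) =ᶠ[𝓝 y] fun x => G x w v := by
    filter_upwards [hG.eventually_mem hy] with x hx using (hG.isInner x hx).symm v w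
  have := fderiv_apply_congr e u
  rwa [fderiv_clm_apply_const_apply (by fun_prop), fderiv_clm_apply_const_apply d,
    fderiv_clm_apply_const_apply (by fun_prop), fderiv_clm_apply_const_apply d] at this

/-- `conn` uses the derivative of the whole form G, whereas `christoffelFirst` differentiates the
function z ↦ G z u v; the two agree where G is differentiable. -/
theorem conn_apply (u v : E) : conn G y u v = christoffel G y u v := by
  have d := hG.differentiableAt hy
  rw [conn_def, christoffel, christoffelFirst]
  congr 1
  ext w
  rw [koszulForm_apply, _root_.smul_apply, _root_.sub_apply, _root_.add_apply]
  rw [fderiv_clm_apply_const_apply (by fun_prop), fderiv_clm_apply_const_apply d]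
  rfl

theorem inner_conn (u v w : E) : G y (conn G y u v) w
    = 2⁻¹ * (fderiv ℝ G y u v w + fderiv ℝ G y v u w - fderiv ℝ G y w u v) := by
  rw [conn_def, (hG.isInner y hy).apply_inverse]
  rfl

theorem conn_symm (u v : E) : conn G y u v = conn G y v u := by
  refine (hG.isInner y hy).ext fun w => ?_
  rw [hG.inner_conn hy, hG.inner_conn hy, hG.fderiv_symm hy w u v]
  ring

theorem fderiv_eq (u v w : E) :
    fderiv ℝ G y u v w = G y (conn G y u v) w + G y v (conn G y u w) := by
  rw [(hG.isInner y hy).symm v, hG.inner_conn hy, hG.inner_conn hy, hG.fderiv_symm hy w u v,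
    hG.fderiv_symm hy u w v]
  rw [hG.fderiv_symm hy v u w]
  ring

/-- Inversion is smooth at invertible maps, and a positive definite form on a finite-dimensional
space is invertible. -/
theorem contDiffAt_inverse_apply {F : Type*} [NormedAddCommGroup F] [NormedSpace ℝ F]
    {k : F → E →L[ℝ] ℝ} {j : F → E} {x : F} (hj : ContDiffAt ℝ ∞ j x) (hjx : j x = y)
    (hk : ContDiffAt ℝ ∞ k x) : ContDiffAt ℝ ∞ (fun z => (G (j z)).inverse (k z)) x := by
  subst hjx
  obtain ⟨e, he⟩ := (hG.isInner _ hy).isInvertible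
  have h1 : ContDiffAt ℝ ∞ (ContinuousLinearMap.inverse : (E →L[ℝ] E →L[ℝ] ℝ) → _) (G (j x)) := by
    rw [← he]; exact contDiffAt_map_inverse e
  exact (h1.comp x ((hG.smooth _ hy).comp x hj)).clm_apply hk

theorem contDiffAt_conn : ContDiffAt ℝ ∞ (conn G) y := by
  refine contDiffAt_clm_of_apply fun u => contDiffAt_clm_of_apply fun v => ?_
  have h1 := contDiffAt_infty_fderiv (hG.smooth y hy)
  refine hG.contDiffAt_inverse_apply hy contDiffAt_id rfl ?_
  refine contDiffAt_clm_of_apply fun w => ?_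
  simp only [koszulForm_apply]
  fun_prop

theorem eventually_conn_symm : ∀ᶠ x in 𝓝 y, ∀ u v, conn G x u v = conn G x v u := by
  filter_upwards [hG.eventually_mem hy] with x hx using hG.conn_symm hx

theorem eventually_contDiffAt_conn : ∀ᶠ x in 𝓝 y, ContDiffAt ℝ ∞ (conn G) x := by
  filter_upwards [hG.eventually_mem hy] with x hx using hG.contDiffAt_conn hx

theorem curvature_eq (u v w : E) : curvature G y u v w = connCurv (conn G) y u v w := by
  have d := differentiableAt_of_contDiffAt_infty (hG.contDiffAt_conn hy)
  have e (u v w : E) : fderiv ℝ (fun z => christoffel G z v w) y u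
      = fderiv ℝ (conn G) y u v w := by
    have : (fun z => christoffel G z v w) =ᶠ[𝓝 y] fun z => conn G z v w := by
      filter_upwards [hG.eventually_mem hy] with x hx using (hG.conn_apply hx v w).symm
    rw [fderiv_apply_congr this, fderiv_clm_apply_const_apply (by fun_prop),
      fderiv_clm_apply_const_apply d]
  rw [curvature, e, e, connCurv]
  simp only [hG.conn_apply hy]

/-- The second derivatives of x ↦ G x w z commute. Expanding both orders by metric compatibility
leaves ⟨R(u, v)w, z⟩ + ⟨w, R(u, v)z⟩ = 0. -/
theorem connCurv_skew_inner (u v w z : E) :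
    G y (connCurv (conn G) y u v w) z = - G y (connCurv (conn G) y u v z) w := by
  have dA := differentiableAt_of_contDiffAt_infty (hG.contDiffAt_conn hy)
  have d := hG.differentiableAt hy
  have I := hG.isInner y hy
  have cq : ContDiffAt ℝ ∞ (fun x => G x w z) y := by
    have := hG.smooth y hy
    fun_prop
  have d1 := differentiableAt_of_contDiffAt_infty (contDiffAt_infty_fderiv cq)
  have key (v u : E) : fderiv ℝ (fderiv ℝ (fun x => G x w z)) y v u
      = G y (conn G y v (conn G y u w)) z + G y (conn G y u w) (conn G y v z)
        + G y (fderiv ℝ (conn G) y v u w) z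
        + (G y (conn G y v w) (conn G y u z) + G y w (conn G y v (conn G y u z))
        + G y w (fderiv ℝ (conn G) y v u z)) := by
    have e : (fun x => fderiv ℝ (fun x => G x w z) x u) =ᶠ[𝓝 y]
        fun x => G x (conn G x u w) z + G x w (conn G x u z) := by
      filter_upwards [hG.eventually_mem hy] with x hx
      have dx := hG.differentiableAt hx
      rw [fderiv_clm_apply_const_apply (by fun_prop), fderiv_clm_apply_const_apply dx,
        hG.fderiv_eq hx u w z]
    have dc (w : E) : DifferentiableAt ℝ (fun x => conn G x u w) y := by fun_prop
    have e' := fderiv_apply_congr e v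
    rw [fderiv_clm_apply_const_apply d1, fderiv_fun_add
        (differentiableAt_clm_apply₂ d (dc w) (differentiableAt_const z))
        (differentiableAt_clm_apply₂ d (differentiableAt_const w) (dc z)), _root_.add_apply,
      fderiv_clm_apply₂ d (dc w) (differentiableAt_const z),
      fderiv_clm_apply₂ d (differentiableAt_const w) (dc z),
      fderiv_clm_apply_const_apply (by fun_prop), fderiv_clm_apply_const_apply dA,
      fderiv_clm_apply_const_apply (by fun_prop), fderiv_clm_apply_const_apply dA,
      hG.fderiv_eq hy, hG.fderiv_eq hy] at e'
    rw [e']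
    simp
  have k1 := key v u
  have k2 := key u v
  rw [fderiv_fderiv_symm cq v u, k2] at k1
  rw [I.symm (connCurv (conn G) y u v z)]
  unfold connCurv
  simp only [map_add, map_sub, _root_.add_apply, _root_.sub_apply]
  linarith

theorem isCurvatureLike_connCurv : IsCurvatureLike (G y) (connCurv (conn G) y) where
  tri := isTrilinear_connCurv _ _
  skew := connCurv_skew _ _
  bianchi := connCurv_bianchi (hG.eventually_conn_symm hy) (hG.contDiffAt_conn hy)
  skew_inner := hG.connCurv_skew_inner hy

theorem connCurvDeriv_skew_inner (x u v w z : E) :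
    G y (connCurvDeriv (conn G) y x u v w) z = - G y (connCurvDeriv (conn G) y x u v z) w := by
  have hA := hG.contDiffAt_conn hy
  have d := hG.differentiableAt hy
  have dK (w : E) := differentiableAt_of_contDiffAt_infty (contDiffAt_connCurv hA u v w)
  have S := hG.connCurv_skew_inner hy
  have D (w z : E) : fderiv ℝ (fun p => G p (connCurv (conn G) p u v w) z) y x
      = G y (conn G y x (connCurv (conn G) y u v w)) z
        + G y (connCurv (conn G) y u v w) (conn G y x z)
        + G y (fderiv ℝ (fun p => connCurv (conn G) p u v w) y x) z := by
    rw [fderiv_clm_apply₂ d (dK w) (differentiableAt_const z), hG.fderiv_eq hy]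
    simp
  have e : (fun p => G p (connCurv (conn G) p u v w) z) =ᶠ[𝓝 y]
      fun p => - G p (connCurv (conn G) p u v z) w := by
    filter_upwards [hG.eventually_mem hy] with p hp using hG.connCurv_skew_inner hp u v w z
  have e' := fderiv_apply_congr e x
  rw [fderiv_fun_neg, _root_.neg_apply, D, D] at e'
  unfold connCurvDeriv
  simp only [map_add, map_sub, _root_.add_apply, _root_.sub_apply]
  have s1 := S (conn G y x u) v w z
  have s2 := S u (conn G y x v) w z
  have s3 := S u v (conn G y x w) z
  have s4 := S u v (conn G y x z) w
  linarith

theorem isCurvatureLike_connCurvDeriv (z : E) :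
    IsCurvatureLike (G y) (connCurvDeriv (conn G) y z) where
  tri := isTrilinear_connCurvDeriv (hG.contDiffAt_conn hy) z
  skew := connCurvDeriv_skew _ _ z
  bianchi := connCurvDeriv_bianchi (hG.eventually_conn_symm hy)
    (hG.eventually_contDiffAt_conn hy) z
  skew_inner := hG.connCurvDeriv_skew_inner hy z

theorem ricciCoord_eq (v w : E) : ricciCoord G y v w = ricTrace (connCurv (conn G) y) v w := by
  simp only [ricciCoord, ricTrace, hG.curvature_eq hy]

theorem contDiffAt_ricciCoord (v w : E) : ContDiffAt ℝ ∞ (fun x => ricciCoord G x v w) y := by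
  have e : (fun x => ricciCoord G x v w) =ᶠ[𝓝 y]
      fun x => ricTrace (connCurv (conn G) x) v w := by
    filter_upwards [hG.eventually_mem hy] with x hx using hG.ricciCoord_eq hx v w
  refine ContDiffAt.congr_of_eventuallyEq ?_ e
  unfold ricTrace
  refine ContDiffAt.sum fun i _ => ?_
  have := contDiffAt_connCurv (hG.contDiffAt_conn hy) (finBasis ℝ E i) v w
  exact ((LinearMap.toContinuousLinearMap ((finBasis ℝ E).coord i)).contDiff.contDiffAt).comp y this

end IsMetricOn

theorem IsTrilinear.isLinearMap_ricTrace {R : E → E → E → E} (hR : IsTrilinear R) (v : E) :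
    IsLinearMap ℝ (ricTrace R v) where
  map_add c d := by simp only [ricTrace, hR.add₃, map_add, Finset.sum_add_distrib]
  map_smul r c := by simp only [ricTrace, hR.smul₃, map_smul, Finset.smul_sum]

/-- The Ricci operator of `G`. -/
def ricOp (G : E → E →L[ℝ] E →L[ℝ] ℝ) (y : E) : E →L[ℝ] E :=
  LinearMap.toContinuousLinearMap
    { toFun := fun v => (G y).inverse (LinearMap.toContinuousLinearMap
        ((isTrilinear_connCurv (conn G) y).isLinearMap_ricTrace v).mk')
      map_add' := fun a b => by
        rw [← map_add]; congr 1; ext w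
        change ricTrace _ _ _ = ricTrace _ _ _ + ricTrace _ _ _
        simp only [ricTrace, (isTrilinear_connCurv (conn G) y).add₂, map_add,
          Finset.sum_add_distrib]
      map_smul' := fun r a => by
        rw [RingHom.id_apply, ← map_smul]; congr 1; ext w
        change ricTrace _ _ _ = r • ricTrace _ _ _
        simp only [ricTrace, (isTrilinear_connCurv (conn G) y).smul₂, map_smul,
          Finset.smul_sum] }

namespace IsMetricOn

variable {G : E → E →L[ℝ] E →L[ℝ] ℝ} {s : Set E} (hG : IsMetricOn G s) {y : E} (hy : y ∈ s)
include hG hy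

theorem inner_ricOp (v w : E) : G y (ricOp G y v) w = ricciCoord G y v w := by
  rw [hG.ricciCoord_eq hy]
  exact (hG.isInner y hy).apply_inverse _ _

theorem contDiffAt_ricOp : ContDiffAt ℝ ∞ (ricOp G) y := by
  refine contDiffAt_clm_of_apply fun v => ?_
  refine hG.contDiffAt_inverse_apply hy contDiffAt_id rfl ?_
  refine contDiffAt_clm_of_apply fun w => ?_
  refine (hG.contDiffAt_ricciCoord hy v w).congr_of_eventuallyEq ?_
  filter_upwards [hG.eventually_mem hy] with x hx using (hG.ricciCoord_eq hx v w).symm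

theorem scalarCoord_eq : scalarCoord G y = LinearMap.trace ℝ E (ricOp G y) :=
  (hG.isInner y hy).sum_inv_gram_mul (finBasis ℝ E) (ricciCoord G y) _ (hG.inner_ricOp hy)

theorem scalarCoord_eq_sum : scalarCoord G y
    = ∑ i, (finBasis ℝ E).coord i (ricOp G y (finBasis ℝ E i)) := by
  rw [hG.scalarCoord_eq hy, LinearMap.trace_eq_matrix_trace ℝ (finBasis ℝ E), Matrix.trace]
  simp only [Matrix.diag_apply, LinearMap.toMatrix_apply]
  rfl

theorem contDiffAt_scalarCoord : ContDiffAt ℝ ∞ (scalarCoord G) y := by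
  have e : scalarCoord G =ᶠ[𝓝 y]
      fun x => ∑ i, (finBasis ℝ E).coord i (ricOp G x (finBasis ℝ E i)) := by
    filter_upwards [hG.eventually_mem hy] with x hx using hG.scalarCoord_eq_sum hx
  refine ContDiffAt.congr_of_eventuallyEq ?_ e
  refine ContDiffAt.sum fun i _ => ?_
  exact ((LinearMap.toContinuousLinearMap ((finBasis ℝ E).coord i)).contDiff.contDiffAt).comp y
    ((hG.contDiffAt_ricOp hy).clm_apply contDiffAt_const)

theorem fderiv_scalarCoord_eq_trace (x : E) :
    fderiv ℝ (scalarCoord G) y x = LinearMap.trace ℝ E (fderiv ℝ (ricOp G) y x) := by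
  have e : scalarCoord G =ᶠ[𝓝 y]
      fun x => ∑ i, (finBasis ℝ E).coord i (ricOp G x (finBasis ℝ E i)) := by
    filter_upwards [hG.eventually_mem hy] with x hx using hG.scalarCoord_eq_sum hx
  have d := differentiableAt_of_contDiffAt_infty (hG.contDiffAt_ricOp hy)
  rw [fderiv_apply_congr e, LinearMap.trace_eq_matrix_trace ℝ (finBasis ℝ E), Matrix.trace]
  simp only [Matrix.diag_apply, LinearMap.toMatrix_apply]
  have dd (i) : DifferentiableAt ℝ
      (fun x => (finBasis ℝ E).coord i (ricOp G x (finBasis ℝ E i))) y :=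
    ((LinearMap.toContinuousLinearMap ((finBasis ℝ E).coord i)).differentiableAt).comp y
      (d.clm_apply (differentiableAt_const _))
  rw [fderiv_fun_sum fun i _ => dd i, _root_.sum_apply]
  refine Finset.sum_congr rfl fun i _ => ?_
  have := fderiv_comp_apply (c := LinearMap.toContinuousLinearMap ((finBasis ℝ E).coord i))
    (u := fun x => ricOp G x (finBasis ℝ E i)) (y := y)
    (ContinuousLinearMap.differentiableAt _) (d.clm_apply (differentiableAt_const _)) x
  refine this.trans ?_
  rw [ContinuousLinearMap.fderiv, fderiv_clm_apply_const_apply d]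
  rfl

/-- Contraction commutes with ∇: the terms Γ_x ∘ R(·, v)w and R(Γ_x ·, v)w have equal traces and
cancel, so only the corrections in v and w remain. -/
theorem fderiv_ricciCoord (x v w : E) : fderiv ℝ (fun p => ricciCoord G p v w) y x
    = ricTrace (connCurvDeriv (conn G) y x) v w
      + ricciCoord G y (conn G y x v) w + ricciCoord G y v (conn G y x w) := by
  have hA := hG.contDiffAt_conn hy
  have T := isTrilinear_connCurv (conn G) y
  have TD := isTrilinear_connCurvDeriv hA x
  have e : (fun p => ricciCoord G p v w) =ᶠ[𝓝 y]
      fun p => ∑ i, LinearMap.toContinuousLinearMap ((finBasis ℝ E).coord i)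
        (connCurv (conn G) p (finBasis ℝ E i) v w) := by
    filter_upwards [hG.eventually_mem hy] with p hp using hG.ricciCoord_eq hp v w
  have dK (u v w : E) := differentiableAt_of_contDiffAt_infty (contDiffAt_connCurv hA u v w)
  have dd (i) : DifferentiableAt ℝ (fun p => LinearMap.toContinuousLinearMap
      ((finBasis ℝ E).coord i) (connCurv (conn G) p (finBasis ℝ E i) v w)) y :=
    (ContinuousLinearMap.differentiableAt _).comp y (dK _ v w)
  rw [fderiv_apply_congr e, fderiv_fun_sum fun i _ => dd i, _root_.sum_apply]
  have t : ∀ i, fderiv ℝ (fun p => LinearMap.toContinuousLinearMap ((finBasis ℝ E).coord i)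
        (connCurv (conn G) p (finBasis ℝ E i) v w)) y x
      = (finBasis ℝ E).coord i
        (fderiv ℝ (fun p => connCurv (conn G) p (finBasis ℝ E i) v w) y x) := by
    intro i
    rw [fderiv_comp_apply (ContinuousLinearMap.differentiableAt _) (dK _ v w),
      ContinuousLinearMap.fderiv]
    rfl
  simp only [t]
  have c : LinearMap.trace ℝ E ((conn G y x : E →ₗ[ℝ] E) ∘ₗ T.toLinearMap v w)
      = LinearMap.trace ℝ E (T.toLinearMap v w ∘ₗ (conn G y x : E →ₗ[ℝ] E)) :=
    LinearMap.trace_comp_comm' _ _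
  rw [LinearMap.trace_eq_matrix_trace ℝ (finBasis ℝ E),
    LinearMap.trace_eq_matrix_trace ℝ (finBasis ℝ E), Matrix.trace, Matrix.trace] at c
  simp only [Matrix.diag_apply, LinearMap.toMatrix_apply] at c
  rw [hG.ricciCoord_eq hy, hG.ricciCoord_eq hy]
  have c' : ∑ i, (finBasis ℝ E).coord i (conn G y x (connCurv (conn G) y (finBasis ℝ E i) v w))
      = ∑ i, (finBasis ℝ E).coord i (connCurv (conn G) y (conn G y x (finBasis ℝ E i)) v w) := c
  simp only [ricTrace, connCurvDeriv, map_add, map_sub, Finset.sum_add_distrib,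
    Finset.sum_sub_distrib, c']
  ring

/-- With Q the Ricci operator, tr ∂_xQ = tr ∇_xQ because the commutator [Γ_x, Q] is traceless, and
⟨(∇_xQ)v, w⟩ = (∇_xS)(v, w). The basis has to be orthonormal only at y. -/
theorem fderiv_scalarCoord {ι : Type*} [Fintype ι] [DecidableEq ι] (o : Basis ι ℝ E)
    (ho : ∀ i j, G y (o i) (o j) = if i = j then 1 else 0) (x : E) :
    fderiv ℝ (scalarCoord G) y x
      = ∑ j, ricTrace (connCurvDeriv (conn G) y x) (o j) (o j) := by
  have d := differentiableAt_of_contDiffAt_infty (hG.contDiffAt_ricOp hy)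
  have dG := hG.differentiableAt hy
  rw [hG.fderiv_scalarCoord_eq_trace hy]
  have c : LinearMap.trace ℝ E ((conn G y x : E →ₗ[ℝ] E) ∘ₗ (ricOp G y : E →ₗ[ℝ] E))
      = LinearMap.trace ℝ E ((ricOp G y : E →ₗ[ℝ] E) ∘ₗ (conn G y x : E →ₗ[ℝ] E)) :=
    LinearMap.trace_comp_comm' _ _
  have c2 : LinearMap.trace ℝ E (fderiv ℝ (ricOp G) y x)
      = LinearMap.trace ℝ E ((fderiv ℝ (ricOp G) y x : E →ₗ[ℝ] E)
        + (conn G y x : E →ₗ[ℝ] E) ∘ₗ (ricOp G y : E →ₗ[ℝ] E)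
        - (ricOp G y : E →ₗ[ℝ] E) ∘ₗ (conn G y x : E →ₗ[ℝ] E)) := by
    rw [map_sub, map_add, c]; ring
  rw [c2, (hG.isInner y hy).trace_eq_sum o ho]
  refine Finset.sum_congr rfl fun j _ => ?_
  have key (v w : E) : G y (fderiv ℝ (ricOp G) y x v + conn G y x (ricOp G y v)
      - ricOp G y (conn G y x v)) w = ricTrace (connCurvDeriv (conn G) y x) v w := by
    have e : (fun p => G p (ricOp G p v) w) =ᶠ[𝓝 y] fun p => ricciCoord G p v w := by
      filter_upwards [hG.eventually_mem hy] with p hp using hG.inner_ricOp hp v w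
    have e' := fderiv_apply_congr e x
    rw [hG.fderiv_ricciCoord hy, fderiv_clm_apply₂ dG (d.clm_apply (differentiableAt_const v))
      (differentiableAt_const w), fderiv_clm_apply_const_apply d, hG.fderiv_eq hy,
      ← hG.inner_ricOp hy, ← hG.inner_ricOp hy] at e'
    simp only [fderiv_fun_const, Pi.zero_apply, _root_.zero_apply, map_zero, add_zero] at e'
    rw [(G y).map_sub₂, (G y).map_add₂]
    linarith
  exact key (o j) (o j)

end IsMetricOn

end LocalMetric

/-! ### Riemannian submersions between open sets: total geodesy and its consequences. -/

section LocalSubmersion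

set_option synthInstance.maxHeartbeats 200000

variable {E : Type*} [NormedAddCommGroup E] [NormedSpace ℝ E] [FiniteDimensional ℝ E]
  {F : Type*} [NormedAddCommGroup F] [NormedSpace ℝ F] [FiniteDimensional ℝ F]

/-- Riemannian submersions between open subsets of vector spaces. -/
structure IsSubmersionOn (G : E → E →L[ℝ] E →L[ℝ] ℝ) (G' : F → F →L[ℝ] F →L[ℝ] ℝ) (φ : E → F)
    (s : Set E) (t : Set F) : Prop where
  metric : IsMetricOn G s
  metric' : IsMetricOn G' t
  mapsTo : ∀ y ∈ s, φ y ∈ t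
  smooth : ∀ y ∈ s, ContDiffAt ℝ ∞ φ y
  orth : ∀ y ∈ s, IsOrthSubmersion (G y) (G' (φ y)) (fderiv ℝ φ y)

/-- The covariant derivative `∂ᵥ Y + Γ(v, Y)` in coordinates. -/
def localCov (G : E → E →L[ℝ] E →L[ℝ] ℝ) (Y : E → E) (y v : E) : E :=
  fderiv ℝ Y y v + christoffel G y v (Y y)

theorem IsMetricOn.localCov_eq {G : E → E →L[ℝ] E →L[ℝ] ℝ} {s : Set E} (hG : IsMetricOn G s)
    {y : E} (hy : y ∈ s) (Y : E → E) (v : E) :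
    localCov G Y y v = fderiv ℝ Y y v + conn G y v (Y y) := by
  rw [localCov, hG.conn_apply hy]

theorem IsMetricOn.lieDeriv_eq {G : E → E →L[ℝ] E →L[ℝ] ℝ} {s : Set E} (hG : IsMetricOn G s)
    {y : E} (hy : y ∈ s) (Y : E → E) (v w : E) :
    fderiv ℝ G y (Y y) v w + G y (fderiv ℝ Y y v) w + G y v (fderiv ℝ Y y w)
      = G y (localCov G Y y v) w + G y v (localCov G Y y w) := by
  rw [hG.fderiv_eq hy, hG.localCov_eq hy, hG.localCov_eq hy, (G y).map_add₂, map_add,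
    hG.conn_symm hy (Y y), hG.conn_symm hy (Y y)]
  ring

/-- The horizontal lift of the constant vector field `a`. -/
def liftField (G : E → E →L[ℝ] E →L[ℝ] ℝ) (G' : F → F →L[ℝ] F →L[ℝ] ℝ) (φ : E → F) (a : F)
    (x : E) : E :=
  horLift (G x) (G' (φ x)) (fderiv ℝ φ x) a

namespace IsSubmersionOn

variable {G : E → E →L[ℝ] E →L[ℝ] ℝ} {G' : F → F →L[ℝ] F →L[ℝ] ℝ} {φ : E → F}
  {s : Set E} {t : Set F} (h : IsSubmersionOn G G' φ s t) {y : E} (hy : y ∈ s)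
include h hy

theorem contDiffAt_liftField (a : F) : ContDiffAt ℝ ∞ (liftField G G' φ a) y := by
  refine h.metric.contDiffAt_inverse_apply hy contDiffAt_id rfl ?_
  refine contDiffAt_clm_of_apply fun w => ?_
  have h1 : ContDiffAt ℝ ∞ (fun x => G' (φ x)) y :=
    (h.metric'.smooth _ (h.mapsTo y hy)).comp y (h.smooth y hy)
  have h2 := contDiffAt_infty_fderiv (h.smooth y hy)
  exact (h1.clm_apply contDiffAt_const).clm_apply (h2.clm_apply contDiffAt_const)

theorem apply_liftField (a : F) : fderiv ℝ φ y (liftField G G' φ a y) = a :=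
  (h.orth y hy).apply_horLift (h.metric.isInner y hy) (h.metric'.isInner _ (h.mapsTo y hy)) a

theorem inner_liftField (a : F) (u : E) :
    G y (liftField G G' φ a y) u = G' (φ y) a (fderiv ℝ φ y u) :=
  (h.metric.isInner y hy).apply_horLift _ _ _ _

theorem fderiv_apply_comp {Y : E → E} (hY : DifferentiableAt ℝ Y y) (v : E) :
    fderiv ℝ (fun x => fderiv ℝ φ x (Y x)) y v
      = fderiv ℝ (fderiv ℝ φ) y v (Y y) + fderiv ℝ φ y (fderiv ℝ Y y v) :=
  fderiv_clm_apply_apply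
    (differentiableAt_of_contDiffAt_infty (contDiffAt_infty_fderiv (h.smooth y hy))) hY v

/-- Differentiate ⟨X_a, u⟩ = ⟨a, Dφ u⟩ along z, where X_a is the lift of a. The expression paired
with a is the second fundamental form σ(z, u) of φ. -/
theorem inner_localCov_liftField (a : F) (z u : E) :
    G y (localCov G (liftField G G' φ a) y z) u
      = G' (φ y) (conn G' (φ y) (fderiv ℝ φ y z) a) (fderiv ℝ φ y u)
        + G' (φ y) a (fderiv ℝ (fderiv ℝ φ) y z u - fderiv ℝ φ y (conn G y z u)
          + conn G' (φ y) (fderiv ℝ φ y z) (fderiv ℝ φ y u)) := by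
  have hX := differentiableAt_of_contDiffAt_infty (h.contDiffAt_liftField hy a)
  have dG := h.metric.differentiableAt hy
  have dG' := h.metric'.differentiableAt (h.mapsTo y hy)
  have dφ := differentiableAt_of_contDiffAt_infty (h.smooth y hy)
  have ddφ := differentiableAt_of_contDiffAt_infty (contDiffAt_infty_fderiv (h.smooth y hy))
  have dc : DifferentiableAt ℝ (fun x => G' (φ x)) y :=
    DifferentiableAt.comp (g := G') y dG' dφ
  have e : (fun x => G x (liftField G G' φ a x) u) =ᶠ[𝓝 y]
      fun x => G' (φ x) a (fderiv ℝ φ x u) := by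
    filter_upwards [h.metric.eventually_mem hy] with x hx using h.inner_liftField hx a u
  have e' := fderiv_apply_congr e z
  rw [fderiv_clm_apply₂ dG hX (differentiableAt_const u),
    fderiv_clm_apply₂ dc (differentiableAt_const a) (ddφ.clm_apply (differentiableAt_const u)),
    fderiv_comp_apply (c := G') (u := φ) dG' dφ z, fderiv_clm_apply_const_apply ddφ, h.metric.fderiv_eq hy,
    h.metric'.fderiv_eq (h.mapsTo y hy), h.inner_liftField hy] at e'
  simp only [fderiv_fun_const, Pi.zero_apply, _root_.zero_apply, map_zero, add_zero] at e'
  rw [h.metric.localCov_eq hy, (G y).map_add₂]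
  simp only [map_add, map_sub]
  linarith

/-- If the horizontal lifts of constant fields have horizontal covariant derivatives, then `φ` is
affine. -/
theorem isAffineAt (hpar : ∀ a z, IsHor (G y) (fderiv ℝ φ y)
    (localCov G (liftField G G' φ a) y z)) : IsAffineAt (conn G) (conn G') φ y := by
  have hI := h.metric.isInner y hy
  have hI' := h.metric'.isInner _ (h.mapsTo y hy)
  have c2 := h.smooth y hy
  set σ : E → E → F := fun z u => fderiv ℝ (fderiv ℝ φ) y z u - fderiv ℝ φ y (conn G y z u)
    + conn G' (φ y) (fderiv ℝ φ y z) (fderiv ℝ φ y u) with hσ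
  have σsymm (z u) : σ z u = σ u z := by
    simp only [hσ]
    rw [fderiv_fderiv_symm c2, h.metric.conn_symm hy, h.metric'.conn_symm (h.mapsTo y hy)]
  have key (a : F) (z u : E) : G y (localCov G (liftField G G' φ a) y z) u
      = G' (φ y) (conn G' (φ y) (fderiv ℝ φ y z) a) (fderiv ℝ φ y u) + G' (φ y) a (σ z u) :=
    h.inner_localCov_liftField hy a z u
  -- This comes from differentiating Dφ(X_a) = a.
  have hDcov (a : F) (z : E) : fderiv ℝ φ y (localCov G (liftField G G' φ a) y z)
      = conn G' (φ y) (fderiv ℝ φ y z) a - σ z (liftField G G' φ a y) := by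
    have hX := differentiableAt_of_contDiffAt_infty (h.contDiffAt_liftField hy a)
    have e : (fun x => fderiv ℝ φ x (liftField G G' φ a x)) =ᶠ[𝓝 y] fun _ => a := by
      filter_upwards [h.metric.eventually_mem hy] with x hx using h.apply_liftField hx a
    have e' := fderiv_apply_congr e z
    rw [h.fderiv_apply_comp hy hX] at e'
    simp only [fderiv_fun_const, Pi.zero_apply, _root_.zero_apply] at e'
    rw [h.metric.localCov_eq hy, map_add]
    simp only [hσ, h.apply_liftField hy]
    linear_combination (norm := module) e'
  -- Test the horizontality of ∇_z X_a against the vertical vector u, with the choice a = σ(z, u).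
  have hker (z u : E) (hu : fderiv ℝ φ y u = 0) : σ z u = 0 := by
    apply hI'.eq_zero_of_self
    have := hpar (σ z u) z u hu
    rw [key, hu, map_zero, zero_add] at this
    exact this
  -- As ∇_z X_a is horizontal, its product with u can be computed after applying Dφ; compare the
  -- outcome with `key`.
  have hskew (z u : E) (a : F) : G' (φ y) (σ z (liftField G G' φ a y)) (fderiv ℝ φ y u)
      + G' (φ y) a (σ z u) = 0 := by
    have h1 := key a z u
    rw [(h.orth y hy).inner_eq hI hI' (hpar a z), hDcov, (G' (φ y)).map_sub₂] at h1
    linarith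
  have hlift (a b c : F) : G' (φ y)
      (σ (liftField G G' φ a y) (liftField G G' φ b y)) c
      = - G' (φ y) (σ (liftField G G' φ a y) (liftField G G' φ c y)) b := by
    have := hskew (liftField G G' φ a y) (liftField G G' φ c y) b
    rw [h.apply_liftField hy, hI'.symm b] at this
    linarith
  -- The trilinear form ⟨σ(X_a, X_b), c⟩ is symmetric in a, b and skew in b, c, hence zero.
  have hlift0 (a b : F) : σ (liftField G G' φ a y) (liftField G G' φ b y) = 0 := by
    refine hI'.ext fun c => ?_
    rw [map_zero, _root_.zero_apply]
    have h1 := hlift a b c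
    have h2 := hlift b c a
    have h3 := hlift c a b
    rw [σsymm (liftField G G' φ a y) (liftField G G' φ c y)] at h1
    rw [σsymm (liftField G G' φ b y) (liftField G G' φ a y)] at h2
    rw [σsymm (liftField G G' φ c y) (liftField G G' φ b y)] at h3
    linarith
  have hσ0 (z u : E) : σ z u = 0 := by
    have add (z u u') : σ z (u + u') = σ z u + σ z u' := by
      simp only [hσ, map_add]; abel
    have dec (u : E) : ∃ k, fderiv ℝ φ y k = 0 ∧ u = k + liftField G G' φ (fderiv ℝ φ y u) y :=
      ⟨u - liftField G G' φ (fderiv ℝ φ y u) y, by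
        rw [map_sub, h.apply_liftField hy, sub_self], by abel⟩
    obtain ⟨k, hk, hku⟩ := dec u
    obtain ⟨k', hk', hkz⟩ := dec z
    rw [hku, add, hker z k hk, zero_add, σsymm, hkz, add, hker _ k' hk', zero_add, hlift0]
  intro u v
  have := hσ0 u v
  simp only [hσ] at this
  linear_combination (norm := module) this

theorem apply_localCov (haff : IsAffineAt (conn G) (conn G') φ y) {Y : E → E}
    (hY : DifferentiableAt ℝ Y y) (v : E) :
    fderiv ℝ φ y (localCov G Y y v) = fderiv ℝ (fun x => fderiv ℝ φ x (Y x)) y v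
      + conn G' (φ y) (fderiv ℝ φ y v) (fderiv ℝ φ y (Y y)) := by
  rw [h.metric.localCov_eq hy, h.fderiv_apply_comp hy hY, haff, map_add]
  abel

theorem apply_localCov_of_related (haff : IsAffineAt (conn G) (conn G') φ y) {Y : E → E}
    (hY : DifferentiableAt ℝ Y y) {W : F → F} (hW : DifferentiableAt ℝ W (φ y))
    (hYW : ∀ᶠ x in 𝓝 y, fderiv ℝ φ x (Y x) = W (φ x)) (v : E) :
    fderiv ℝ φ y (localCov G Y y v) = localCov G' W (φ y) (fderiv ℝ φ y v) := by
  have e : (fun x => fderiv ℝ φ x (Y x)) =ᶠ[𝓝 y] fun x => W (φ x) := hYW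
  rw [h.apply_localCov hy haff hY, h.metric'.localCov_eq (h.mapsTo y hy), fderiv_apply_congr e,
    fderiv_comp_apply hW (differentiableAt_of_contDiffAt_infty (h.smooth y hy)),
    hYW.self_of_nhds]

variable (haff : ∀ x ∈ s, IsAffineAt (conn G) (conn G') φ x)
include haff

theorem eventually_isAffineAt : ∀ᶠ x in 𝓝 y, IsAffineAt (conn G) (conn G') φ x := by
  filter_upwards [h.metric.eventually_mem hy] with x hx using haff x hx

theorem ricciCoord_eq (v : E) {w : E} (hw : IsHor (G y) (fderiv ℝ φ y) w) :
    ricciCoord G y v w = ricciCoord G' (φ y) (fderiv ℝ φ y v) (fderiv ℝ φ y w) := by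
  rw [h.metric.ricciCoord_eq hy, h.metric'.ricciCoord_eq (h.mapsTo y hy)]
  have hc := h.metric.isCurvatureLike_connCurv hy
  exact (h.orth y hy).ricTrace_eq (h.metric.isInner y hy) (h.metric'.isInner _ (h.mapsTo y hy))
    hc.tri (isTrilinear_connCurv _ _) hc.skew_inner
    (IsAffineAt.curv (h.eventually_isAffineAt hy haff) (h.smooth y hy)
      (h.metric.contDiffAt_conn hy) (h.metric'.contDiffAt_conn (h.mapsTo y hy))) v hw

/-- Intended for transition maps between charts: it makes the scalar curvature independent of the
chart. -/
theorem scalarCoord_eq_of_injective (hinj : Function.Injective (fderiv ℝ φ y)) :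
    scalarCoord G y = scalarCoord G' (φ y) := by
  have hI := h.metric.isInner y hy
  have hI' := h.metric'.isInner _ (h.mapsTo y hy)
  have hor (w : E) : IsHor (G y) (fderiv ℝ φ y) w := fun u hu => by
    rw [hinj (hu.trans (map_zero _).symm), map_zero]
  rw [h.metric.scalarCoord_eq hy, h.metric'.scalarCoord_eq (h.mapsTo y hy)]
  refine trace_eq_of_semiconj (D := (fderiv ℝ φ y : E →ₗ[ℝ] F)) (h.orth y hy).surj
    (fun u => ?_) fun u hu => ?_
  · refine hI'.ext fun c => ?_
    obtain ⟨w, rfl⟩ := (h.orth y hy).surj c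
    change G' (φ y) (fderiv ℝ φ y (ricOp G y u)) _ = G' (φ y) (ricOp G' (φ y) (fderiv ℝ φ y u)) _
    rw [h.metric'.inner_ricOp (h.mapsTo y hy), ← h.ricciCoord_eq hy haff u (hor w),
      ← h.metric.inner_ricOp hy, ← (h.orth y hy).inner_eq hI hI' (hor _)]
  · have hu' : fderiv ℝ φ y u = 0 := hu
    rw [hinj (hu'.trans (map_zero _).symm)]
    exact map_zero _

/-- The scalar curvatures themselves may differ, since the fibres may be curved. Their differentials
agree on horizontal vectors because dR = 2 div S and φ carries ∇R to ∇R_N. -/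
theorem fderiv_scalarCoord_eq {x : E} (hx : IsHor (G y) (fderiv ℝ φ y) x) :
    fderiv ℝ (scalarCoord G) y x
      = fderiv ℝ (scalarCoord G') (φ y) (fderiv ℝ φ y x) := by
  have hy' := h.mapsTo y hy
  have hI := h.metric.isInner y hy
  have hI' := h.metric'.isInner _ hy'
  obtain ⟨o, ho⟩ := hI.exists_orthonormal_basis
  obtain ⟨o', ho'⟩ := hI'.exists_orthonormal_basis
  have hA := h.metric.contDiffAt_conn hy
  have hA' := h.metric'.contDiffAt_conn hy'
  have hD := h.metric.isCurvatureLike_connCurvDeriv hy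
  have hD' := h.metric'.isCurvatureLike_connCurvDeriv hy'
  rw [h.metric.fderiv_scalarCoord hy o ho, h.metric'.fderiv_scalarCoord hy' o' ho',
    contracted_bianchi hI hD
      (connCurvDeriv_second_bianchi (h.metric.conn_symm hy) hA) o ho,
    contracted_bianchi hI' hD'
      (connCurvDeriv_second_bianchi (h.metric'.conn_symm hy') hA') o' ho']
  congr 1
  refine (h.orth y hy).sum_ricTrace_eq hI hI' (fun a b u v w => ?_) (fun r a u v w => ?_) hD hD'
    (IsAffineAt.curvDeriv (h.eventually_isAffineAt hy haff) ?_
      (h.metric.eventually_contDiffAt_conn hy) (h.metric'.eventually_contDiffAt_conn hy'))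
    o ho o' ho' hx
  · have T := isTrilinear_connCurv (conn G') (φ y)
    simp only [connCurvDeriv, map_add, _root_.add_apply, T.add₁, T.add₂, T.add₃]
    abel
  · have T := isTrilinear_connCurv (conn G') (φ y)
    simp only [connCurvDeriv, map_smul, _root_.smul_apply, T.smul₁, T.smul₂, T.smul₃]
    module
  · filter_upwards [h.metric.eventually_mem hy] with x hx using h.smooth x hx

end IsSubmersionOn

end LocalSubmersion

/-! ### Metrics, fields and forms read in a chart. -/

section Charts

variable {E : Type*} [NormedAddCommGroup E] [NormedSpace ℝ E]
  {F : Type*} [NormedAddCommGroup F] [NormedSpace ℝ F]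
  {M : Type*} [TopologicalSpace M] [ChartedSpace E M] [IsManifold 𝓘(ℝ, E) ∞ M]
  {N : Type*} [TopologicalSpace N] [ChartedSpace F N] [IsManifold 𝓘(ℝ, F) ∞ N]

theorem contMDiffAt_tangentMap {f : M → N} {u : Set M} (hu : IsOpen u)
    (hf : ContMDiffOn 𝓘(ℝ, E) 𝓘(ℝ, F) ∞ f u) (p : TangentBundle 𝓘(ℝ, E) M) (hp : p.proj ∈ u) :
    ContMDiffAt 𝓘(ℝ, E).tangent 𝓘(ℝ, F).tangent ∞ (tangentMap 𝓘(ℝ, E) 𝓘(ℝ, F) f) p := by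
  have h := hf.contMDiffOn_tangentMapWithin (m := ∞) (by simp) hu.uniqueMDiffOn
  have ho : IsOpen (TotalSpace.proj (F := E) (E := (TangentSpace 𝓘(ℝ, E) : M → Type _)) ⁻¹' u) :=
    hu.preimage (FiberBundle.continuous_proj E _)
  refine (h.contMDiffAt (ho.mem_nhds hp)).congr_of_eventuallyEq ?_
  filter_upwards [ho.mem_nhds hp] with q hq
  exact (tangentMapWithin_eq_tangentMap (hu.uniqueMDiffOn _ hq)
    ((hf.contMDiffAt (hu.mem_nhds hq)).mdifferentiableAt (by simp))).symm

/-- The derivative of the inverse of the chart around `c`. -/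
def chartSymmDeriv (c : M) (y : E) : E →L[ℝ] E :=
  mfderiv 𝓘(ℝ, E) 𝓘(ℝ, E) (extChartAt 𝓘(ℝ, E) c).symm y

/-- The derivative of the chart around `c`. -/
def chartDeriv (c p : M) : E →L[ℝ] E :=
  mfderiv 𝓘(ℝ, E) 𝓘(ℝ, E) (extChartAt 𝓘(ℝ, E) c) p

theorem contMDiffAt_chart_symm {c : M} {y : E} (hy : y ∈ (extChartAt 𝓘(ℝ, E) c).target) :
    ContMDiffAt 𝓘(ℝ, E) 𝓘(ℝ, E) ∞ (extChartAt 𝓘(ℝ, E) c).symm y :=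
  (contMDiffOn_extChartAt_symm c).contMDiffAt ((isOpen_extChartAt_target c).mem_nhds hy)

theorem contMDiffAt_chart {c p : M} (hp : p ∈ (extChartAt 𝓘(ℝ, E) c).source) :
    ContMDiffAt 𝓘(ℝ, E) 𝓘(ℝ, E) ∞ (extChartAt 𝓘(ℝ, E) c) p :=
  contMDiffAt_extChartAt' (by rwa [extChartAt_source] at hp)

theorem chartDeriv_chartSymmDeriv {c : M} {y : E} (hy : y ∈ (extChartAt 𝓘(ℝ, E) c).target)
    (u : E) : chartDeriv c ((extChartAt 𝓘(ℝ, E) c).symm y) (chartSymmDeriv c y u) = u := by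
  have h := mfderiv_extChartAt_comp_mfderivWithin_extChartAt_symm (I := 𝓘(ℝ, E)) hy
  rw [ModelWithCorners.range_eq_univ, mfderivWithin_univ] at h
  exact congrArg (fun L : E →L[ℝ] E => L u) h

theorem chartSymmDeriv_chartDeriv {c : M} {y : E} (hy : y ∈ (extChartAt 𝓘(ℝ, E) c).target)
    (u : E) : chartSymmDeriv c y (chartDeriv c ((extChartAt 𝓘(ℝ, E) c).symm y) u) = u := by
  have h := mfderivWithin_extChartAt_symm_comp_mfderiv_extChartAt (I := 𝓘(ℝ, E)) hy
  rw [ModelWithCorners.range_eq_univ, mfderivWithin_univ] at h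
  exact congrArg (fun L : E →L[ℝ] E => L u) h

theorem chartDeriv_self (c : M) (u : E) : chartDeriv c c u = u :=
  congrArg (fun L : E →L[ℝ] E => L u) (mfderiv_extChartAt_self (I := 𝓘(ℝ, E)) (x := c))

theorem chartSymmDeriv_self (c : M) (u : E) :
    chartSymmDeriv c (extChartAt 𝓘(ℝ, E) c c) u = u := by
  have h := mfderivWithin_range_extChartAt_symm (I := 𝓘(ℝ, E)) (x := c)
  rw [ModelWithCorners.range_eq_univ, mfderivWithin_univ] at h
  exact congrArg (fun L : E →L[ℝ] E => L u) h

theorem contMDiffAt_chartSymmDeriv {c : M} {y : E} (hy : y ∈ (extChartAt 𝓘(ℝ, E) c).target)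
    {Y : E → E} (hY : ContDiffAt ℝ ∞ Y y) :
    ContMDiffAt 𝓘(ℝ, E) 𝓘(ℝ, E).tangent ∞
      (fun z => (⟨(extChartAt 𝓘(ℝ, E) c).symm z, chartSymmDeriv c z (Y z)⟩ :
        TangentBundle 𝓘(ℝ, E) M)) y := by
  have h1 : ContMDiffAt 𝓘(ℝ, E) 𝓘(ℝ, E).tangent ∞
      (fun z : E => (⟨z, Y z⟩ : TangentBundle 𝓘(ℝ, E) E)) y :=
    contMDiffAt_vectorSpace_iff_contDiffAt.2 hY
  exact ContMDiffAt.comp (g := tangentMap 𝓘(ℝ, E) 𝓘(ℝ, E) (extChartAt 𝓘(ℝ, E) c).symm) y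
    (contMDiffAt_tangentMap (isOpen_extChartAt_target c) (contMDiffOn_extChartAt_symm c) _ hy) h1

theorem metricInChart_apply (g : Metric E M) (c : M) (y u v : E) :
    metricInChart g c y u v = g.inner ((extChartAt 𝓘(ℝ, E) c).symm y)
      (chartSymmDeriv c y u) (chartSymmDeriv c y v) := rfl

/-- The scalar product at `p`, as a form on the model space. -/
def innerAt (g : Metric E M) (p : M) : E →L[ℝ] E →L[ℝ] ℝ := g.inner p

theorem isInner_innerAt (g : Metric E M) (p : M) : IsInner (innerAt g p) where
  symm v w := g.symm p v w
  pos v hv := g.pos p v hv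

theorem metricInChart_self (g : Metric E M) (c : M) :
    metricInChart g c (extChartAt 𝓘(ℝ, E) c c) = innerAt g c := by
  ext u v
  rw [metricInChart_apply, chartSymmDeriv_self, chartSymmDeriv_self]
  change innerAt g _ u v = innerAt g c u v
  rw [extChartAt_to_inv]

theorem metricInChart_chartDeriv (g : Metric E M) {c p : M}
    (hp : p ∈ (extChartAt 𝓘(ℝ, E) c).source) (u v : E) :
    metricInChart g c (extChartAt 𝓘(ℝ, E) c p) (chartDeriv c p u) (chartDeriv c p v)
      = innerAt g p u v := by
  obtain ⟨y, hy, rfl⟩ : ∃ y ∈ (extChartAt 𝓘(ℝ, E) c).target, (extChartAt 𝓘(ℝ, E) c).symm y = p :=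
    ⟨_, (extChartAt 𝓘(ℝ, E) c).map_source hp, (extChartAt 𝓘(ℝ, E) c).left_inv hp⟩
  rw [(extChartAt 𝓘(ℝ, E) c).right_inv hy, metricInChart_apply, chartSymmDeriv_chartDeriv hy,
    chartSymmDeriv_chartDeriv hy]
  rfl

theorem contDiffAt_formInChart {θ : ∀ p : M, TangentSpace 𝓘(ℝ, E) p →L[ℝ] ℝ}
    (hθ : IsSmoothForm θ) {c : M} {y : E} (hy : y ∈ (extChartAt 𝓘(ℝ, E) c).target)
    {Y : E → E} (hY : ContDiffAt ℝ ∞ Y y) :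
    ContDiffAt ℝ ∞ (fun z => θ ((extChartAt 𝓘(ℝ, E) c).symm z) (chartSymmDeriv c z (Y z))) y := by
  have h : ContMDiffAt 𝓘(ℝ, E) (𝓘(ℝ, E).prod 𝓘(ℝ)) ∞
      (fun z => TotalSpace.mk' ℝ (E := Bundle.Trivial M ℝ) ((extChartAt 𝓘(ℝ, E) c).symm z)
        (θ ((extChartAt 𝓘(ℝ, E) c).symm z) (chartSymmDeriv c z (Y z)))) y := by
    apply ContMDiffAt.clm_bundle_apply (F₁ := E)
    · exact ContMDiffAt.comp y hθ.contMDiffAt (contMDiffAt_chart_symm hy)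
    · exact contMDiffAt_chartSymmDeriv hy hY
  simp only [contMDiffAt_totalSpace] at h
  exact h.2.contDiffAt

theorem contDiffAt_metricInChart_apply (g : Metric E M) {c : M} {y : E}
    (hy : y ∈ (extChartAt 𝓘(ℝ, E) c).target) {Y Z : E → E} (hY : ContDiffAt ℝ ∞ Y y)
    (hZ : ContDiffAt ℝ ∞ Z y) :
    ContDiffAt ℝ ∞ (fun z => metricInChart g c z (Y z) (Z z)) y := by
  have h : ContMDiffAt 𝓘(ℝ, E) (𝓘(ℝ, E).prod 𝓘(ℝ)) ∞
      (fun z => TotalSpace.mk' ℝ (E := Bundle.Trivial M ℝ) ((extChartAt 𝓘(ℝ, E) c).symm z)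
        (g.inner ((extChartAt 𝓘(ℝ, E) c).symm z) (chartSymmDeriv c z (Y z))
          (chartSymmDeriv c z (Z z)))) y := by
    apply ContMDiffAt.clm_bundle_apply₂ (F₁ := E) (F₂ := E)
    · exact ContMDiffAt.comp y g.contMDiff.contMDiffAt (contMDiffAt_chart_symm hy)
    · exact contMDiffAt_chartSymmDeriv hy hY
    · exact contMDiffAt_chartSymmDeriv hy hZ
  rw [contMDiffAt_totalSpace] at h
  exact h.2.contDiffAt

theorem contDiffAt_metricInChart [FiniteDimensional ℝ E] (g : Metric E M) {c : M} {y : E}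
    (hy : y ∈ (extChartAt 𝓘(ℝ, E) c).target) : ContDiffAt ℝ ∞ (metricInChart g c) y :=
  contDiffAt_clm_of_apply fun _ => contDiffAt_clm_of_apply fun _ =>
    contDiffAt_metricInChart_apply g hy contDiffAt_const contDiffAt_const

theorem isInner_metricInChart (g : Metric E M) {c : M} {y : E}
    (hy : y ∈ (extChartAt 𝓘(ℝ, E) c).target) : IsInner (metricInChart g c y) where
  symm v w := (isInner_innerAt g ((extChartAt 𝓘(ℝ, E) c).symm y)).symm
    (chartSymmDeriv c y v) (chartSymmDeriv c y w)
  pos v hv := (isInner_innerAt g ((extChartAt 𝓘(ℝ, E) c).symm y)).pos (chartSymmDeriv c y v)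
    fun h0 => hv (by rw [← chartDeriv_chartSymmDeriv hy v, h0, map_zero])

theorem isMetricOn_metricInChart [FiniteDimensional ℝ E] (g : Metric E M) (c : M) :
    IsMetricOn (metricInChart g c) (extChartAt 𝓘(ℝ, E) c).target where
  isOpen := isOpen_extChartAt_target c
  smooth _ hy := contDiffAt_metricInChart g hy
  isInner _ hy := isInner_metricInChart g hy

/-- The value of a vector field, as an element of the model space. -/
def fieldAt (X : ∀ p : M, TangentSpace 𝓘(ℝ, E) p) (p : M) : E := X p

theorem fieldInChart_eq {X : ∀ p : M, TangentSpace 𝓘(ℝ, E) p} {c : M} {y : E}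
    (hy : y ∈ (extChartAt 𝓘(ℝ, E) c).target) :
    fieldInChart X c y = chartDeriv c ((extChartAt 𝓘(ℝ, E) c).symm y)
      (fieldAt X ((extChartAt 𝓘(ℝ, E) c).symm y)) := by
  let e : E ≃L[ℝ] E := ContinuousLinearEquiv.equivOfInverse (chartSymmDeriv c y)
    (chartDeriv c ((extChartAt 𝓘(ℝ, E) c).symm y)) (chartDeriv_chartSymmDeriv hy)
    (chartSymmDeriv_chartDeriv hy)
  change (e : E →L[ℝ] E).inverse _ = _
  rw [ContinuousLinearMap.inverse_equiv]
  rfl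

theorem contDiffAt_fieldInChart {X : ∀ p : M, TangentSpace 𝓘(ℝ, E) p} (hX : IsSmoothField X)
    {c : M} {y : E} (hy : y ∈ (extChartAt 𝓘(ℝ, E) c).target) :
    ContDiffAt ℝ ∞ (fieldInChart X c) y := by
  refine contMDiffAt_vectorSpace_iff_contDiffAt.1 ?_
  have h1 : ContMDiffAt 𝓘(ℝ, E) 𝓘(ℝ, E).tangent ∞ (fun z => tangentMap 𝓘(ℝ, E) 𝓘(ℝ, E)
      (extChartAt 𝓘(ℝ, E) c) ⟨(extChartAt 𝓘(ℝ, E) c).symm z, X _⟩) y := by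
    refine ContMDiffAt.comp (g := tangentMap 𝓘(ℝ, E) 𝓘(ℝ, E) (extChartAt 𝓘(ℝ, E) c)) y
      (contMDiffAt_tangentMap (isOpen_extChartAt_source c)
        (by rw [extChartAt_source]; exact contMDiffOn_extChartAt) _
        ((extChartAt 𝓘(ℝ, E) c).map_target hy)) ?_
    exact ContMDiffAt.comp y hX.contMDiffAt (contMDiffAt_chart_symm hy)
  refine h1.congr_of_eventuallyEq ?_
  filter_upwards [(isOpen_extChartAt_target c).mem_nhds hy] with z hz
  rw [fieldInChart_eq hz]
  change (⟨z, _⟩ : TangentBundle 𝓘(ℝ, E) E) = ⟨extChartAt 𝓘(ℝ, E) c _, _⟩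
  rw [(extChartAt 𝓘(ℝ, E) c).right_inv hz]
  rfl

theorem covDeriv_eq (g : Metric E M) (X : ∀ p : M, TangentSpace 𝓘(ℝ, E) p) (p : M)
    (v : TangentSpace 𝓘(ℝ, E) p) : covDeriv g X p v
      = localCov (E := E) (metricInChart g p) (fieldInChart X p) (extChartAt 𝓘(ℝ, E) p p) v := by
  have h : chartDeriv (E := E) p p = ContinuousLinearMap.id ℝ E :=
    ContinuousLinearMap.ext (chartDeriv_self p)
  -- The preferred chart at p has identity derivative at p; stating the claim for a general L allows
  -- L = id to be substituted.
  have key : ∀ (L : E →L[ℝ] E) (G : E → E →L[ℝ] E →L[ℝ] ℝ) (Y : E → E) (y u : E),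
      L = ContinuousLinearMap.id ℝ E → L.inverse (localCov G Y y (L u)) = localCov G Y y u := by
    rintro L G Y y u rfl
    rw [ContinuousLinearMap.inverse_id]
    rfl
  exact key _ _ _ _ _ h

/-- The covariant derivative, as a map between model spaces. -/
def covAt (g : Metric E M) (X : ∀ p : M, TangentSpace 𝓘(ℝ, E) p) (p : M) (v : E) : E :=
  covDeriv g X p v

/-- The Lie derivative of the metric, as a form on the model space. -/
def lieAt (g : Metric E M) (X : ∀ p : M, TangentSpace 𝓘(ℝ, E) p) (p : M) (v w : E) : ℝ :=
  lieDerivMetric g X p v w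

theorem covAt_eq (g : Metric E M) (X : ∀ p : M, TangentSpace 𝓘(ℝ, E) p) (p : M) (v : E) :
    covAt g X p v
      = localCov (metricInChart g p) (fieldInChart X p) (extChartAt 𝓘(ℝ, E) p p) v :=
  covDeriv_eq g X p v

theorem lieAt_eq [FiniteDimensional ℝ E] (g : Metric E M)
    (X : ∀ p : M, TangentSpace 𝓘(ℝ, E) p) (p : M) (v w : E) :
    lieAt g X p v w = innerAt g p (covAt g X p v) w + innerAt g p v (covAt g X p w) := by
  have h := (isMetricOn_metricInChart g p).lieDeriv_eq (mem_extChartAt_target p)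
    (fieldInChart X p) v w
  rw [covAt_eq, covAt_eq, ← metricInChart_self, ← h]
  change fderiv ℝ (metricInChart g p) _ _ (chartDeriv p p v) (chartDeriv p p w)
    + metricInChart g p _ (fderiv ℝ (fieldInChart X p) _ (chartDeriv p p v)) (chartDeriv p p w)
    + metricInChart g p _ (chartDeriv p p v) (fderiv ℝ (fieldInChart X p) _ (chartDeriv p p w)) = _
  rw [chartDeriv_self, chartDeriv_self]

section Ricci

variable [FiniteDimensional ℝ E]

/-- The Ricci tensor, as a form on the model space. -/
def ricciAt (g : Metric E M) (p : M) (v w : E) : ℝ := ricci g p v w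

theorem ricciAt_eq (g : Metric E M) (p : M) (v w : E) :
    ricciAt g p v w = ricciCoord (metricInChart g p) (extChartAt 𝓘(ℝ, E) p p) v w := by
  change ricciCoord _ _ (chartDeriv p p v) (chartDeriv p p w) = _
  rw [chartDeriv_self, chartDeriv_self]

end Ricci

end Charts

/-! ### Maps read in charts, and independence of the chart. -/

section ChartMaps

variable {E : Type*} [NormedAddCommGroup E] [NormedSpace ℝ E]
  {F : Type*} [NormedAddCommGroup F] [NormedSpace ℝ F]
  {M : Type*} [TopologicalSpace M] [ChartedSpace E M]
  {N : Type*} [TopologicalSpace N] [ChartedSpace F N]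

theorem IsAffineAt.congr {A : E → E →L[ℝ] E →L[ℝ] E} {A' : F → F →L[ℝ] F →L[ℝ] F}
    {φ ψ : E → F} {y : E} (h : IsAffineAt A A' φ y) (e : φ =ᶠ[𝓝 y] ψ) : IsAffineAt A A' ψ y := by
  intro u v
  rw [← e.fderiv.fderiv_eq, ← e.fderiv_eq, ← e.self_of_nhds]
  exact h u v

variable (E F) in
/-- The differential of `f` at `p`. -/
def diffAt (f : M → N) (p : M) : E →L[ℝ] F := mfderiv 𝓘(ℝ, E) 𝓘(ℝ, F) f p

variable (E F) in
/-- The map `f` read in the charts around `c` and `d`. -/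
def chartMap (f : M → N) (c : M) (d : N) (y : E) : F :=
  extChartAt 𝓘(ℝ, F) d (f ((extChartAt 𝓘(ℝ, E) c).symm y))

variable (E F) in
/-- The part of the chart around `c` that `f` maps into the chart around `d`. -/
def chartDomain (f : M → N) (c : M) (d : N) : Set E :=
  (extChartAt 𝓘(ℝ, E) c).target ∩
    (extChartAt 𝓘(ℝ, E) c).symm ⁻¹' (f ⁻¹' (extChartAt 𝓘(ℝ, F) d).source)

theorem isOpen_chartDomain {f : M → N} (hf : Continuous f) (c : M) (d : N) :
    IsOpen (chartDomain E F f c d) :=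
  (continuousOn_extChartAt_symm c).isOpen_inter_preimage (isOpen_extChartAt_target c)
    ((isOpen_extChartAt_source d).preimage hf)

theorem mem_chartDomain {f : M → N} {c p : M} {d : N} (hp : p ∈ (extChartAt 𝓘(ℝ, E) c).source)
    (hd : f p ∈ (extChartAt 𝓘(ℝ, F) d).source) :
    extChartAt 𝓘(ℝ, E) c p ∈ chartDomain E F f c d := by
  refine ⟨(extChartAt 𝓘(ℝ, E) c).map_source hp, ?_⟩
  rw [Set.mem_preimage, (extChartAt 𝓘(ℝ, E) c).left_inv hp]
  exact hd

theorem chartMap_chart (f : M → N) {c p : M} (d : N) (hp : p ∈ (extChartAt 𝓘(ℝ, E) c).source) :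
    chartMap E F f c d (extChartAt 𝓘(ℝ, E) c p) = extChartAt 𝓘(ℝ, F) d (f p) := by
  rw [chartMap, (extChartAt 𝓘(ℝ, E) c).left_inv hp]

theorem chartMap_mem (f : M → N) {c : M} {d : N} {y : E} (hy : y ∈ chartDomain E F f c d) :
    chartMap E F f c d y ∈ (extChartAt 𝓘(ℝ, F) d).target :=
  (extChartAt 𝓘(ℝ, F) d).map_source hy.2

theorem symm_chartMap (f : M → N) {c : M} {d : N} {y : E} (hy : y ∈ chartDomain E F f c d) :
    (extChartAt 𝓘(ℝ, F) d).symm (chartMap E F f c d y) = f ((extChartAt 𝓘(ℝ, E) c).symm y) :=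
  (extChartAt 𝓘(ℝ, F) d).left_inv hy.2

variable [IsManifold 𝓘(ℝ, E) ∞ M] [IsManifold 𝓘(ℝ, F) ∞ N]

theorem contDiffAt_chartMap {f : M → N} (hf : ContMDiff 𝓘(ℝ, E) 𝓘(ℝ, F) ∞ f) {c : M} {d : N}
    {y : E} (hy : y ∈ chartDomain E F f c d) : ContDiffAt ℝ ∞ (chartMap E F f c d) y :=
  contMDiffAt_iff_contDiffAt.1
    ((contMDiffAt_chart hy.2).comp y (hf.contMDiffAt.comp y (contMDiffAt_chart_symm hy.1)))

theorem fderiv_chartMap {f : M → N} (hf : ContMDiff 𝓘(ℝ, E) 𝓘(ℝ, F) ∞ f) {c : M} {d : N}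
    {y : E} (hy : y ∈ chartDomain E F f c d) (u : E) :
    fderiv ℝ (chartMap E F f c d) y u
      = chartDeriv d (f ((extChartAt 𝓘(ℝ, E) c).symm y))
        (diffAt E F f ((extChartAt 𝓘(ℝ, E) c).symm y) (chartSymmDeriv c y u)) := by
  have h1 := ((contMDiffAt_chart_symm hy.1).mdifferentiableAt (by simp)).hasMFDerivAt
  have h2 := ((hf.contMDiffAt (x := (extChartAt 𝓘(ℝ, E) c).symm y)).mdifferentiableAt
    (by simp)).hasMFDerivAt
  have h3 := ((contMDiffAt_chart (E := F) hy.2).mdifferentiableAt (by simp)).hasMFDerivAt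
  have h4 := (h3.comp y (h2.comp y h1)).mfderiv
  rw [← mfderiv_eq_fderiv]
  exact congrArg (fun L : E →L[ℝ] F => L u) h4

theorem fderiv_chartMap_self {f : M → N} (hf : ContMDiff 𝓘(ℝ, E) 𝓘(ℝ, F) ∞ f) (p : M) :
    fderiv ℝ (chartMap E F f p (f p)) (extChartAt 𝓘(ℝ, E) p p) = diffAt E F f p := by
  ext u
  rw [fderiv_chartMap hf (mem_chartDomain (mem_extChartAt_source p) (mem_extChartAt_source _)),
    chartSymmDeriv_self]
  have : ∀ q, q = p → chartDeriv (f q) (f q) (diffAt E F f q u) = diffAt E F f p u := by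
    rintro q rfl; exact chartDeriv_self _ _
  have key := this _ (extChartAt_to_inv (I := 𝓘(ℝ, E)) p)
  rw [extChartAt_to_inv] at key ⊢
  exact key

/-- Smooth maps that are pointwise orthogonal projections onto the tangent space followed by an
isometry. -/
structure IsOrthMap (g : Metric E M) (gN : Metric F N) (f : M → N) : Prop where
  smooth : ContMDiff 𝓘(ℝ, E) 𝓘(ℝ, F) ∞ f
  orth : ∀ p, IsOrthSubmersion (innerAt g p) (innerAt gN (f p)) (diffAt E F f p)

/-- Read in two charts, the identity is a transition map, so the theory of submersions also yields
change-of-chart formulas. -/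
theorem isOrthMap_id (g : Metric E M) : IsOrthMap g g (id : M → M) where
  smooth := contMDiff_id
  orth p := by
    have h : diffAt E E (id : M → M) p = ContinuousLinearMap.id ℝ E := mfderiv_id
    rw [h]
    exact ⟨Function.surjective_id, fun _ _ => rfl⟩

theorem IsRiemannianSubmersion.isOrthMap {g : Metric E M} {gN : Metric F N} {f : M → N}
    (hf : IsRiemannianSubmersion g gN f) : IsOrthMap g gN f :=
  ⟨hf.smooth, fun p => ⟨hf.surjective_mfderiv p, hf.isometry p⟩⟩

namespace IsOrthMap

variable {g : Metric E M} {gN : Metric F N} {f : M → N} (h : IsOrthMap g gN f)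
include h

theorem isHor_iff {c : M} {d : N} {y : E} (hy : y ∈ chartDomain E F f c d) (v : E) :
    IsHor (metricInChart g c y) (fderiv ℝ (chartMap E F f c d) y) v ↔
      IsHor (innerAt g ((extChartAt 𝓘(ℝ, E) c).symm y))
        (diffAt E F f ((extChartAt 𝓘(ℝ, E) c).symm y)) (chartSymmDeriv c y v) := by
  have hinj (b : F) (hb : chartDeriv d (f ((extChartAt 𝓘(ℝ, E) c).symm y)) b = 0) : b = 0 := by
    have := chartSymmDeriv_chartDeriv (chartMap_mem f hy) b
    rw [symm_chartMap f hy, hb, map_zero] at this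
    exact this.symm
  constructor
  · intro hv u hu
    rw [← chartSymmDeriv_chartDeriv hy.1 u] at hu ⊢
    refine hv (chartDeriv c _ u) ?_
    rw [fderiv_chartMap h.smooth hy, hu, map_zero]
  · intro hv u hu
    rw [fderiv_chartMap h.smooth hy] at hu
    exact hv _ (hinj _ hu)

theorem isOrthSubmersion_chartMap {c : M} {d : N} {y : E} (hy : y ∈ chartDomain E F f c d) :
    IsOrthSubmersion (metricInChart g c y) (metricInChart gN d (chartMap E F f c d y))
      (fderiv ℝ (chartMap E F f c d) y) := by
  have ho := h.orth ((extChartAt 𝓘(ℝ, E) c).symm y)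
  refine ⟨fun b => ?_, fun v hv => ?_⟩
  · have hb := chartDeriv_chartSymmDeriv (chartMap_mem f hy) b
    obtain ⟨w, hw⟩ := ho.surj (chartSymmDeriv d (chartMap E F f c d y) b)
    refine ⟨chartDeriv c ((extChartAt 𝓘(ℝ, E) c).symm y) w, ?_⟩
    rw [fderiv_chartMap h.smooth hy, chartSymmDeriv_chartDeriv hy.1, hw, ← symm_chartMap f hy]
    exact hb
  · have h1 := ho.isometry _ ((h.isHor_iff hy v).1 hv)
    have h2 := metricInChart_chartDeriv gN hy.2
      (diffAt E F f ((extChartAt 𝓘(ℝ, E) c).symm y) (chartSymmDeriv c y v))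
      (diffAt E F f ((extChartAt 𝓘(ℝ, E) c).symm y) (chartSymmDeriv c y v))
    rw [fderiv_chartMap h.smooth hy]
    exact h2.trans h1

variable [FiniteDimensional ℝ E] [FiniteDimensional ℝ F]

theorem isSubmersionOn (c : M) (d : N) :
    IsSubmersionOn (metricInChart g c) (metricInChart gN d) (chartMap E F f c d)
      (chartDomain E F f c d) (extChartAt 𝓘(ℝ, F) d).target where
  metric :=
    { isOpen := isOpen_chartDomain h.smooth.continuous c d
      smooth := fun _ hy => contDiffAt_metricInChart g hy.1
      isInner := fun _ hy => isInner_metricInChart g hy.1 }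
  metric' := isMetricOn_metricInChart gN d
  mapsTo _ hy := chartMap_mem f hy
  smooth _ hy := contDiffAt_chartMap h.smooth hy
  orth _ hy := h.isOrthSubmersion_chartMap hy

end IsOrthMap

variable [FiniteDimensional ℝ E] [FiniteDimensional ℝ F]

theorem injective_fderiv_chartMap_id {c d : M} {y : E} (hy : y ∈ chartDomain E E (id : M → M) c d) :
    Function.Injective (fderiv ℝ (chartMap E E (id : M → M) c d) y) := by
  refine (injective_iff_map_eq_zero _).2 fun u hu => ?_
  rw [fderiv_chartMap contMDiff_id hy] at hu
  have h : diffAt E E (id : M → M) ((extChartAt 𝓘(ℝ, E) c).symm y) = ContinuousLinearMap.id ℝ E :=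
    mfderiv_id
  have h2 := chartSymmDeriv_chartDeriv (chartMap_mem (id : M → M) hy) (chartSymmDeriv c y u)
  rw [symm_chartMap (id : M → M) hy] at h2
  rw [h] at hu
  rw [← chartDeriv_chartSymmDeriv hy.1 u, ← h2]
  erw [hu]
  simp

/-- The derivative is injective, so every vector is horizontal and the hypothesis on lifts is
automatic. -/
theorem isAffineAt_transition (g : Metric E M) {c d : M} {y : E}
    (hy : y ∈ chartDomain E E (id : M → M) c d) :
    IsAffineAt (conn (metricInChart g c)) (conn (metricInChart g d))
      (chartMap E E (id : M → M) c d) y :=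
  ((isOrthMap_id g).isSubmersionOn c d).isAffineAt hy fun a z u hu => by
    rw [injective_fderiv_chartMap_id hy (hu.trans (map_zero _).symm), map_zero]

/-- `scalarCurvature` uses at each point that point's own chart. Smoothness requires computing it in
one fixed chart on a neighbourhood. -/
theorem scalarCurvature_eq (g : Metric E M) {c p : M} (hp : p ∈ (extChartAt 𝓘(ℝ, E) c).source) :
    scalarCurvature g p = scalarCoord (metricInChart g c) (extChartAt 𝓘(ℝ, E) c p) := by
  have hy : extChartAt 𝓘(ℝ, E) c p ∈ chartDomain E E (id : M → M) c p :=
    mem_chartDomain hp (mem_extChartAt_source p)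
  have := ((isOrthMap_id g).isSubmersionOn c p).scalarCoord_eq_of_injective hy
    (fun x hx => isAffineAt_transition g hx) (injective_fderiv_chartMap_id hy)
  rw [this, chartMap_chart _ _ hp]
  rfl

theorem contMDiff_scalarCurvature (g : Metric E M) :
    ContMDiff 𝓘(ℝ, E) 𝓘(ℝ) ∞ (scalarCurvature g) := by
  intro p
  have hp := mem_extChartAt_source (I := 𝓘(ℝ, E)) p
  have h1 := ((isMetricOn_metricInChart g p).contDiffAt_scalarCoord
    ((extChartAt 𝓘(ℝ, E) p).map_source hp)).contMDiffAt.comp p (contMDiffAt_chart hp)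
  refine h1.congr_of_eventuallyEq ?_
  filter_upwards [(isOpen_extChartAt_source (I := 𝓘(ℝ, E)) p).mem_nhds hp] with q hq
  exact scalarCurvature_eq g hq

end ChartMaps

/-! ### A parallel horizontal distribution makes the submersion affine in all charts. -/

section ParallelHorizontal

variable {E : Type*} [NormedAddCommGroup E] [NormedSpace ℝ E] [FiniteDimensional ℝ E]
  {F : Type*} [NormedAddCommGroup F] [NormedSpace ℝ F] [FiniteDimensional ℝ F]
  {M : Type*} [TopologicalSpace M] [ChartedSpace E M] [IsManifold 𝓘(ℝ, E) ∞ M]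
  {N : Type*} [TopologicalSpace N] [ChartedSpace F N] [IsManifold 𝓘(ℝ, F) ∞ N]

theorem isHorizontal_iff {g : Metric E M} {f : M → N} {p : M} {v : E} :
    IsHorizontal (F := F) g f p v ↔ IsHor (innerAt g p) (diffAt E F f p) v := Iff.rfl

theorem localCov_congr {G : E → E →L[ℝ] E →L[ℝ] ℝ} {Y Z : E → E} {y : E} (h : Y =ᶠ[𝓝 y] Z)
    (v : E) : localCov G Y y v = localCov G Z y v := by
  rw [localCov, localCov, h.fderiv_eq, h.self_of_nhds]

theorem isHor_localCov_of_isHorizontal_covDeriv {g : Metric E M} {f : M → N}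
    (hf : ContMDiff 𝓘(ℝ, E) 𝓘(ℝ, F) ∞ f) {X : ∀ p : M, TangentSpace 𝓘(ℝ, E) p} {p : M}
    {v : TangentSpace 𝓘(ℝ, E) p} (h : IsHorizontal (F := F) g f p (covDeriv g X p v)) :
    IsHor (metricInChart g p (extChartAt 𝓘(ℝ, E) p p))
      (fderiv ℝ (chartMap E F f p (f p)) (extChartAt 𝓘(ℝ, E) p p))
      (localCov (metricInChart g p) (fieldInChart X p) (extChartAt 𝓘(ℝ, E) p p) v) := by
  rw [covDeriv_eq, isHorizontal_iff] at h
  rwa [metricInChart_self, fderiv_chartMap_self hf]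

/-- The field on `M` with components `L` in the chart around `c`. -/
def fieldOfChart (c : M) (L : E → E) (q : M) : TangentSpace 𝓘(ℝ, E) q :=
  chartSymmDeriv c (extChartAt 𝓘(ℝ, E) c q) (L (extChartAt 𝓘(ℝ, E) c q))

theorem contMDiffAt_fieldOfChart {c q : M} (hq : q ∈ (extChartAt 𝓘(ℝ, E) c).source) {L : E → E}
    (hL : ContDiffAt ℝ ∞ L (extChartAt 𝓘(ℝ, E) c q)) :
    ContMDiffAt 𝓘(ℝ, E) 𝓘(ℝ, E).tangent ∞
      (fun r => (⟨r, fieldOfChart c L r⟩ : TangentBundle 𝓘(ℝ, E) M)) q := by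
  have h := (contMDiffAt_chartSymmDeriv ((extChartAt 𝓘(ℝ, E) c).map_source hq) hL).comp q
    (contMDiffAt_chart hq)
  refine h.congr_of_eventuallyEq ?_
  filter_upwards [(isOpen_extChartAt_source (I := 𝓘(ℝ, E)) c).mem_nhds hq] with r hr
  have : ∀ (r' : M) (v : E), r = r' → (⟨r, v⟩ : TangentBundle 𝓘(ℝ, E) M) = ⟨r', v⟩ := by
    rintro _ _ rfl; rfl
  exact this _ _ ((extChartAt 𝓘(ℝ, E) c).left_inv hr).symm

theorem fieldInChart_smul_fieldOfChart (c : M) (L : E → E) {y : E}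
    (hy : y ∈ (extChartAt 𝓘(ℝ, E) c).target) (ψ : M → ℝ) :
    fieldInChart (fun q => ψ q • fieldOfChart c L q) c y
      = ψ ((extChartAt 𝓘(ℝ, E) c).symm y) • L y := by
  rw [fieldInChart_eq hy]
  change chartDeriv (E := E) c _ (ψ _ • chartSymmDeriv (E := E) c _ (L _)) = _
  rw [(extChartAt 𝓘(ℝ, E) c).right_inv hy, map_smul, chartDeriv_chartSymmDeriv hy]

variable [T2Space M] {g : Metric E M} {gN : Metric F N} {f : M → N}
  (hf : IsOrthMap g gN f) (hpar : IsHorizontalParallel (F := F) g f)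
include hf hpar

/-- `IsHorizontalParallel` concerns global fields, so the horizontal lifts of constant fields,
defined near p, are cut off by a bump function equal to 1 near p. As `covDeriv` at p is computed in
the chart at p, these charts come first. -/
theorem isAffineAt_chartMap_self (p : M) :
    IsAffineAt (conn (metricInChart g p)) (conn (metricInChart gN (f p)))
      (chartMap E F f p (f p)) (extChartAt 𝓘(ℝ, E) p p) := by
  have hdom : extChartAt 𝓘(ℝ, E) p p ∈ chartDomain E F f p (f p) :=
    mem_chartDomain (mem_extChartAt_source p) (mem_extChartAt_source _)
  have hsub := hf.isSubmersionOn p (f p)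
  refine hsub.isAffineAt hdom fun a z => ?_
  set L := liftField (metricInChart g p) (metricInChart gN (f p)) (chartMap E F f p (f p)) a
    with hL
  set u : Set M := (extChartAt 𝓘(ℝ, E) p).source ∩ f ⁻¹' (extChartAt 𝓘(ℝ, F) (f p)).source
  have hu : IsOpen u := (isOpen_extChartAt_source p).inter
    ((isOpen_extChartAt_source (f p)).preimage hf.smooth.continuous)
  have hpu : p ∈ u := ⟨mem_extChartAt_source p, mem_extChartAt_source (I := 𝓘(ℝ, F)) (f p)⟩
  obtain ⟨ψ, -, hψ⟩ := (SmoothBumpFunction.nhds_basis_tsupport (I := 𝓘(ℝ, E)) p).mem_iff.1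
    (hu.mem_nhds hpu)
  have hX : IsSmoothField (fun q => ψ q • fieldOfChart p L q) := by
    refine ContMDiffOn.smul_section_of_tsupport (s := fieldOfChart p L)
      ψ.contMDiff.contMDiffOn hu hψ fun q hq => ?_
    exact (contMDiffAt_fieldOfChart hq.1 (hsub.contDiffAt_liftField
      (mem_chartDomain hq.1 hq.2) a)).contMDiffWithinAt
  have hor (q : M) : IsHorizontal (F := F) g f q (ψ q • fieldOfChart p L q) := by
    intro (v : E) hv
    by_cases hq : q ∈ u
    · have hd : extChartAt 𝓘(ℝ, E) p q ∈ chartDomain E F f p (f p) := mem_chartDomain hq.1 hq.2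
      have h1 := (hf.isHor_iff hd (L (extChartAt 𝓘(ℝ, E) p q))).1
        ((isInner_metricInChart g hd.1).isHor_horLift _ _ _)
      rw [(extChartAt 𝓘(ℝ, E) p).left_inv hq.1] at h1
      have h2 := h1 v hv
      change innerAt g q (ψ q • chartSymmDeriv (E := E) p _ (L _)) v = 0
      rw [map_smul, _root_.smul_apply, h2, smul_zero]
    · have h0 : ψ q = 0 := image_eq_zero_of_notMem_tsupport fun h => hq (hψ h)
      change innerAt g q (ψ q • chartSymmDeriv (E := E) p _ (L _)) v = 0
      rw [h0, zero_smul, map_zero, _root_.zero_apply]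
  have hcov := isHor_localCov_of_isHorizontal_covDeriv hf.smooth (hpar _ hX hor p z)
  have e : fieldInChart (fun q => ψ q • fieldOfChart p L q) p =ᶠ[𝓝 (extChartAt 𝓘(ℝ, E) p p)] L := by
    have hc := (contMDiffAt_chart_symm (mem_extChartAt_target (I := 𝓘(ℝ, E)) p)).continuousAt
    rw [ContinuousAt, extChartAt_to_inv] at hc
    filter_upwards [(isOpen_extChartAt_target (I := 𝓘(ℝ, E)) p).mem_nhds (mem_extChartAt_target p),
      hc.eventually ψ.eventuallyEq_one] with y hy h1
    rw [fieldInChart_smul_fieldOfChart p L hy, h1, Pi.one_apply, one_smul]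
  rwa [localCov_congr e] at hcov

/-- Near y the map is a composite of a transition to the chart at p, the map in the charts at p and
f(p), and a transition to the chart at d; all three are affine. -/
theorem isAffineAt_chartMap {c : M} {d : N} {y : E} (hy : y ∈ chartDomain E F f c d) :
    IsAffineAt (conn (metricInChart g c)) (conn (metricInChart gN d)) (chartMap E F f c d) y := by
  set p := (extChartAt 𝓘(ℝ, E) c).symm y with hp
  have hps : p ∈ (extChartAt 𝓘(ℝ, E) c).source := (extChartAt 𝓘(ℝ, E) c).map_target hy.1
  have hyp : extChartAt 𝓘(ℝ, E) c p = y := (extChartAt 𝓘(ℝ, E) c).right_inv hy.1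
  have d1 : y ∈ chartDomain E E (id : M → M) c p := by
    rw [← hyp]; exact mem_chartDomain hps (mem_extChartAt_source p)
  have e1 : chartMap E E (id : M → M) c p y = extChartAt 𝓘(ℝ, E) p p := by
    rw [← hyp]; exact chartMap_chart _ _ hps
  have d2 : extChartAt 𝓘(ℝ, E) p p ∈ chartDomain E F f p (f p) :=
    mem_chartDomain (mem_extChartAt_source p) (mem_extChartAt_source _)
  have e2 : chartMap E F f p (f p) (extChartAt 𝓘(ℝ, E) p p) = extChartAt 𝓘(ℝ, F) (f p) (f p) :=
    chartMap_chart _ _ (mem_extChartAt_source p)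
  have d3 : extChartAt 𝓘(ℝ, F) (f p) (f p) ∈ chartDomain F F (id : N → N) (f p) d :=
    mem_chartDomain (mem_extChartAt_source _) hy.2
  have a1 := isAffineAt_transition g d1
  have a2 := isAffineAt_chartMap_self hf hpar p
  have a3 := isAffineAt_transition gN d3
  have o1 := (isOpen_chartDomain (E := E) (F := E) continuous_id c p).mem_nhds d1
  have o2 := (isOpen_chartDomain hf.smooth.continuous p (f p)).mem_nhds d2
  have o3 := (isOpen_chartDomain (E := F) (F := F) continuous_id (f p) d).mem_nhds d3
  have c1 := Filter.mem_of_superset o1 fun x hx => contDiffAt_chartMap contMDiff_id hx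
  have c2 := Filter.mem_of_superset o2 fun x hx => contDiffAt_chartMap hf.smooth hx
  have c3 := Filter.mem_of_superset o3 fun x hx => contDiffAt_chartMap contMDiff_id hx
  have cc1 : ContinuousAt (chartMap E E (id : M → M) c p) y :=
    (contDiffAt_chartMap contMDiff_id d1).continuousAt
  have cc2 : ContinuousAt (chartMap E F f p (f p)) (extChartAt 𝓘(ℝ, E) p p) :=
    (contDiffAt_chartMap hf.smooth d2).continuousAt
  rw [← e2] at a3 c3
  have a32 := a3.comp a2 c3 c2
  have c32 : ∀ᶠ x in 𝓝 (extChartAt 𝓘(ℝ, E) p p), ContDiffAt ℝ ∞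
      (chartMap F F (id : N → N) (f p) d ∘ chartMap E F f p (f p)) x := by
    filter_upwards [c2, cc2.eventually c3] with x hx hx'
    exact ContDiffAt.comp x hx' hx
  rw [← e1] at a32 c32
  refine (a32.comp a1 c32 c1).congr ?_
  rw [← e1] at o2
  filter_upwards [o1, cc1.preimage_mem_nhds o2] with x hx hx'
  have hx'' : f ((extChartAt 𝓘(ℝ, E) c).symm x) ∈ (extChartAt 𝓘(ℝ, F) (f p)).source := by
    have := hx'.2
    rwa [Set.mem_preimage, Set.mem_preimage, symm_chartMap (id : M → M) hx] at this
  have e3 : chartMap E F f p (f p) (chartMap E E (id : M → M) c p x)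
      = extChartAt 𝓘(ℝ, F) (f p) (f ((extChartAt 𝓘(ℝ, E) c).symm x)) := by
    rw [chartMap, symm_chartMap (id : M → M) hx]
    rfl
  rw [Function.comp_apply, Function.comp_apply, e3, chartMap_chart _ _ hx'']
  rfl

end ParallelHorizontal

/-! ### Local structure of smooth submersions. -/

section Straightening

variable {E : Type*} [NormedAddCommGroup E] [NormedSpace ℝ E] [FiniteDimensional ℝ E]
  {F : Type*} [NormedAddCommGroup F] [NormedSpace ℝ F] [FiniteDimensional ℝ F]
  {H : Type*} [NormedAddCommGroup H] [NormedSpace ℝ H]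

/-- A submersion is, up to a smooth change of coordinates, a projection `F × K → F`. -/
theorem exists_straightening {φ : E → F} {y : E} (hφ : ContDiffAt ℝ ∞ φ y)
    (hs : Function.Surjective (fderiv ℝ φ y)) :
    ∃ (K : Submodule ℝ E) (Θ : F × K → E) (ρ : E → K), ContDiffAt ℝ ∞ Θ (φ y, ρ y) ∧
      ContinuousAt ρ y ∧ (∀ᶠ x in 𝓝 y, Θ (φ x, ρ x) = x) ∧
      ∀ᶠ z in 𝓝 (φ y, ρ y), φ (Θ z) = z.1 := by
  have := FiniteDimensional.complete ℝ E
  have := FiniteDimensional.complete ℝ F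
  have hstrict : HasStrictFDerivAt φ (fderiv ℝ φ y) y := hφ.hasStrictFDerivAt (by simp)
  -- Here K is the kernel of Dφ at y, and ρ(x) is the projection of x − y to K.
  set D := hstrict.implicitFunctionDataOfComplemented φ (fderiv ℝ φ y)
    (LinearMap.range_eq_top.2 hs)
    (fderiv ℝ φ y).ker_closedComplemented_of_finiteDimensional_range with hD
  have hr : ContDiff ℝ ∞ D.rightFun :=
    (ContinuousLinearMap.contDiff D.rightDeriv).comp (contDiff_id.sub (contDiff_const (c := y)))
  exact ⟨_, fun z => D.implicitFunction z.1 z.2, D.rightFun,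
    D.contDiffAt_implicitFunction (n := ∞) hφ hr.contDiffAt (by simp),
    hr.continuous.continuousAt, D.implicitFunction_apply_image, D.leftFun_implicitFunction⟩

/-- Freeze the K-coordinate of the straightening at ρ(y). -/
theorem exists_local_section {φ : E → F} {y : E} (hφ : ContDiffAt ℝ ∞ φ y)
    (hs : Function.Surjective (fderiv ℝ φ y)) :
    ∃ σ : F → E, ContDiffAt ℝ ∞ σ (φ y) ∧ σ (φ y) = y ∧ ∀ᶠ x in 𝓝 (φ y), φ (σ x) = x := by
  obtain ⟨K, Θ, ρ, h1, -, h3, h4⟩ := exists_straightening hφ hs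
  have hc : ContDiffAt ℝ ∞ (fun x : F => (x, ρ y)) (φ y) := contDiffAt_id.prodMk contDiffAt_const
  exact ⟨fun x => Θ (x, ρ y), h1.comp (φ y) hc, h3.self_of_nhds,
    hc.continuousAt.eventually h4⟩

/-- A function whose derivative vanishes on the kernel of the derivative of a submersion `φ` is
locally constant on the fibres of `φ`. -/
theorem eventually_eq_of_fderiv_eq_zero {φ : E → F} {y : E} (hφ : ContDiffAt ℝ ∞ φ y)
    (hs : Function.Surjective (fderiv ℝ φ y)) {k : E → H}
    (hk : ∀ᶠ x in 𝓝 y, DifferentiableAt ℝ k x ∧ DifferentiableAt ℝ φ x ∧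
      ∀ v, fderiv ℝ φ x v = 0 → fderiv ℝ k x v = 0) :
    ∀ᶠ x in 𝓝 y, φ x = φ y → k x = k y := by
  obtain ⟨K, Θ, ρ, h1, h2, h3, h4⟩ := exists_straightening hφ hs
  have hy : Θ (φ y, ρ y) = y := h3.self_of_nhds
  have hΘc : Filter.Tendsto Θ (𝓝 (φ y, ρ y)) (𝓝 y) := by
    have := h1.continuousAt
    rwa [ContinuousAt, hy] at this
  have hdiff : ∀ᶠ z in 𝓝 (φ y, ρ y), DifferentiableAt ℝ Θ z :=
    ((h1.of_le (m := 1) (by simp)).eventually (by simp)).mono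
      fun z hz => hz.differentiableAt (by simp)
  obtain ⟨ε, hε, hball⟩ := Metric.eventually_nhds_iff_ball.1
    (hdiff.and ((hΘc.eventually hk).and h4.eventually_nhds))
  -- Since φ ∘ Θ is the first projection, moving κ moves Θ(φ y, κ) along ker Dφ, where k has zero
  -- derivative.
  have hder (κ : K) (hκ : κ ∈ Metric.ball (ρ y) ε) :
      HasFDerivAt (fun κ => k (Θ (φ y, κ))) (0 : K →L[ℝ] H) κ := by
    have hmem : (φ y, κ) ∈ Metric.ball (φ y, ρ y) ε := by
      rw [← ball_prod_same]
      exact ⟨Metric.mem_ball_self hε, hκ⟩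
    obtain ⟨d1, ⟨d2, d3, d4⟩, d5⟩ := hball _ hmem
    have hin : HasFDerivAt (fun κ : K => (φ y, κ)) (ContinuousLinearMap.inr ℝ F K) κ :=
      hasFDerivAt_prodMk_right _ _
    have e1 := d2.hasFDerivAt.comp κ (d1.hasFDerivAt.comp κ hin)
    have e2 := (d3.hasFDerivAt.comp (φ y, κ) d1.hasFDerivAt).congr_of_eventuallyEq
      (show (fun z : F × K => z.1) =ᶠ[𝓝 (φ y, κ)] φ ∘ Θ from d5.mono fun z hz => hz.symm)
    have e3 := e2.unique hasFDerivAt_fst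
    refine e1.congr_fderiv ?_
    ext w
    refine d4 _ ?_
    have := congrArg (fun L : F × K →L[ℝ] F => L (0, w)) e3
    exact this
  have hmem : ∀ᶠ x in 𝓝 y, ρ x ∈ Metric.ball (ρ y) ε :=
    h2.eventually (Metric.ball_mem_nhds _ hε)
  filter_upwards [hmem, h3] with x hx hx' hxy
  have := Metric.isOpen_ball.is_const_of_fderiv_eq_zero (convex_ball (ρ y) ε).isPreconnected
    (fun κ hκ => (hder κ hκ).differentiableAt.differentiableWithinAt)
    (fun κ hκ => (hder κ hκ).fderiv) hx (Metric.mem_ball_self hε)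
  rw [← hxy, hx', hxy, hy] at this
  exact this

end Straightening

/-! ### Descent of functions, fields and forms from M to N, with smoothness. -/

section Descent

theorem eq_of_eventually_eq_on_fibre {M N Y : Type*} [TopologicalSpace M] {f : M → N} {k : M → Y}
    (hk : ∀ p, ∀ᶠ p' in 𝓝 p, f p' = f p → k p' = k p)
    (hfib : ∀ q : N, IsPreconnected (f ⁻¹' {q})) {p p' : M} (h : f p = f p') : k p = k p' := by
  have := isPreconnected_iff_preconnectedSpace.1 (hfib (f p'))
  have hl : IsLocallyConstant fun x : f ⁻¹' {f p'} => k x := by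
    refine (IsLocallyConstant.iff_eventually_eq _).2 fun x => ?_
    filter_upwards [continuous_subtype_val.continuousAt.eventually (hk x)] with z hz
    exact hz (z.2.trans x.2.symm)
  exact hl.apply_eq_of_preconnectedSpace ⟨p, h⟩ ⟨p', rfl⟩

variable {E : Type*} [NormedAddCommGroup E] [NormedSpace ℝ E] [FiniteDimensional ℝ E]
  {F : Type*} [NormedAddCommGroup F] [NormedSpace ℝ F] [FiniteDimensional ℝ F]
  {M : Type*} [TopologicalSpace M] [ChartedSpace E M] [IsManifold 𝓘(ℝ, E) ∞ M]
  {N : Type*} [TopologicalSpace N] [ChartedSpace F N] [IsManifold 𝓘(ℝ, F) ∞ N]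

theorem form_congr (θ : ∀ q : N, TangentSpace 𝓘(ℝ, F) q →L[ℝ] ℝ) {q q' : N} {v v' : F}
    (hq : q = q') (hv : v = v') : θ q v = θ q' v' := by
  subst hq hv; rfl

/-- Smoothness of a `1`-form in terms of its components in charts. -/
theorem isSmoothForm_of_chart {θ : ∀ q : N, TangentSpace 𝓘(ℝ, F) q →L[ℝ] ℝ}
    (h : ∀ (q : N) (a : F), ContDiffAt ℝ ∞
      (fun x => θ ((extChartAt 𝓘(ℝ, F) q).symm x) (chartSymmDeriv q x a))
      (extChartAt 𝓘(ℝ, F) q q)) : IsSmoothForm θ := by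
  intro q
  refine (contMDiffAt_hom_bundle _).2 ⟨contMDiffAt_id, ?_⟩
  let Θ : F → F →L[ℝ] ℝ := fun x =>
    ContinuousLinearMap.comp (θ ((extChartAt 𝓘(ℝ, F) q).symm x) : F →L[ℝ] ℝ) (chartSymmDeriv q x)
  have hΘ : ContDiffAt ℝ ∞ Θ (extChartAt 𝓘(ℝ, F) q q) := contDiffAt_clm_of_apply (h q)
  have hq := mem_extChartAt_source (I := 𝓘(ℝ, F)) q
  refine (hΘ.contMDiffAt.comp q (contMDiffAt_chart hq)).congr_of_eventuallyEq ?_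
  filter_upwards [(isOpen_extChartAt_source (I := 𝓘(ℝ, F)) q).mem_nhds hq] with r hr
  have hr' := hr
  rw [extChartAt_source] at hr'
  -- Over r, the inverse of the tangent trivialisation at q is the derivative of the inverse chart;
  -- this identifies bundle components with those in the hypothesis.
  have e := TangentBundle.symmL_trivializationAt (I := 𝓘(ℝ, F)) hr'
  rw [ModelWithCorners.range_eq_univ, mfderivWithin_univ] at e
  ext a
  have e' := congrArg (fun L : F →L[ℝ] F => L a) e
  have t : (trivializationAt ℝ (Bundle.Trivial N ℝ) q).continuousLinearMapAt ℝ r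
      = ContinuousLinearMap.id ℝ ℝ := Bundle.Trivial.continuousLinearMapAt_trivialization ℝ N ℝ r
  refine (congrArg (fun L : ℝ →L[ℝ] ℝ => L (θ r ((trivializationAt F
    (TangentSpace 𝓘(ℝ, F)) q).symmL ℝ r a))) t).trans ?_
  exact form_congr θ ((extChartAt 𝓘(ℝ, F) q).left_inv hr).symm e'

theorem IsOrthMap.exists_local_section {g : Metric E M} {gN : Metric F N} {f : M → N}
    (hf : IsOrthMap g gN f) (p : M) : ∃ s : N → M, ContMDiffAt 𝓘(ℝ, F) 𝓘(ℝ, E) ∞ s (f p) ∧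
      s (f p) = p ∧ ∀ᶠ q in 𝓝 (f p), f (s q) = q := by
  have hp := mem_extChartAt_source (I := 𝓘(ℝ, E)) p
  have hq := mem_extChartAt_source (I := 𝓘(ℝ, F)) (f p)
  have hdom : extChartAt 𝓘(ℝ, E) p p ∈ chartDomain E F f p (f p) := mem_chartDomain hp hq
  obtain ⟨σ, h1, h2, h3⟩ := RicciYamabe.exists_local_section (contDiffAt_chartMap hf.smooth hdom)
    (hf.isOrthSubmersion_chartMap hdom).surj
  rw [chartMap_chart _ _ hp] at h1 h2 h3
  have hc := contMDiffAt_chart (E := F) hq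
  have h1' : ContMDiffAt 𝓘(ℝ, F) 𝓘(ℝ, E) ∞ (fun q => σ (extChartAt 𝓘(ℝ, F) (f p) q)) (f p) :=
    h1.contMDiffAt.comp (f p) hc
  have h4 := h1'.continuousAt
  rw [ContinuousAt, h2] at h4
  refine ⟨fun q => (extChartAt 𝓘(ℝ, E) p).symm (σ (extChartAt 𝓘(ℝ, F) (f p) q)), ?_, ?_, ?_⟩
  · refine ContMDiffAt.comp (g := (extChartAt 𝓘(ℝ, E) p).symm) (f p) ?_ h1'
    rw [h2]
    exact contMDiffAt_chart_symm hdom.1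
  · simp only [h2]
    exact extChartAt_to_inv p
  · filter_upwards [hc.continuousAt.eventually h3,
      h4.eventually ((isOpen_chartDomain hf.smooth.continuous p (f p)).mem_nhds hdom),
      (isOpen_extChartAt_source (I := 𝓘(ℝ, F)) (f p)).mem_nhds hq] with q hq1 hq2 hq3
    refine (extChartAt 𝓘(ℝ, F) (f p)).injOn hq2.2 hq3 ?_
    exact hq1

variable {g : Metric E M} {gN : Metric F N} {f : M → N} (hf : IsOrthMap g gN f)
  (hsurj : Function.Surjective f)
include hf hsurj

/-- Locally k is (k ∘ f) ∘ s for a smooth local section s of f. -/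
theorem contMDiff_of_comp {k : N → ℝ} (hk : ContMDiff 𝓘(ℝ, E) 𝓘(ℝ) ∞ (fun p => k (f p))) :
    ContMDiff 𝓘(ℝ, F) 𝓘(ℝ) ∞ k := by
  intro q
  obtain ⟨p, rfl⟩ := hsurj q
  obtain ⟨s, h1, h2, h3⟩ := hf.exists_local_section p
  refine ((hk.contMDiffAt (x := s (f p))).comp (f p) h1).congr_of_eventuallyEq ?_
  filter_upwards [h3] with q hq
  rw [Function.comp_apply, hq]

theorem IsRelatedField.isSmoothField {U : ∀ p : M, TangentSpace 𝓘(ℝ, E) p}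
    {W : ∀ q : N, TangentSpace 𝓘(ℝ, F) q} (h : IsRelatedField f U W) (hU : IsSmoothField U) :
    IsSmoothField W := by
  intro q
  obtain ⟨p, rfl⟩ := hsurj q
  obtain ⟨s, h1, h2, h3⟩ := hf.exists_local_section p
  have h4 : ContMDiffAt 𝓘(ℝ, F) 𝓘(ℝ, F).tangent ∞
      (fun q => tangentMap 𝓘(ℝ, E) 𝓘(ℝ, F) f ⟨s q, U (s q)⟩) (f p) := by
    refine ContMDiffAt.comp (g := tangentMap 𝓘(ℝ, E) 𝓘(ℝ, F) f) (f p)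
      (contMDiffAt_tangentMap isOpen_univ hf.smooth.contMDiffOn _ trivial) ?_
    exact ContMDiffAt.comp (f p) hU.contMDiffAt h1
  refine h4.congr_of_eventuallyEq ?_
  filter_upwards [h3] with q hq
  change (⟨q, W q⟩ : TangentBundle 𝓘(ℝ, F) N)
    = ⟨f (s q), mfderiv 𝓘(ℝ, E) 𝓘(ℝ, F) f (s q) (U (s q))⟩
  rw [h, hq]

/-- Along a local section of f, the components of θ are the values of η on the smooth horizontal
lifts of the coordinate fields. -/
theorem IsInducedForm.isSmoothForm {η : ∀ p : M, TangentSpace 𝓘(ℝ, E) p →L[ℝ] ℝ}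
    {θ : ∀ q : N, TangentSpace 𝓘(ℝ, F) q →L[ℝ] ℝ} (h : IsInducedForm g f η θ)
    (hη : IsSmoothForm η) : IsSmoothForm θ := by
  refine isSmoothForm_of_chart fun q a => ?_
  obtain ⟨p, rfl⟩ := hsurj q
  have hp := mem_extChartAt_source (I := 𝓘(ℝ, E)) p
  have hq := mem_extChartAt_source (I := 𝓘(ℝ, F)) (f p)
  have hdom : extChartAt 𝓘(ℝ, E) p p ∈ chartDomain E F f p (f p) := mem_chartDomain hp hq
  have hsub := hf.isSubmersionOn p (f p)
  obtain ⟨σ, h1, h2, h3⟩ := RicciYamabe.exists_local_section (contDiffAt_chartMap hf.smooth hdom)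
    (hf.isOrthSubmersion_chartMap hdom).surj
  rw [chartMap_chart _ _ hp] at h1 h2 h3
  have h4 := contDiffAt_formInChart hη hdom.1 (hsub.contDiffAt_liftField hdom a)
  rw [← h2] at h4
  have hσ := h1.continuousAt
  rw [ContinuousAt, h2] at hσ
  refine (h4.comp _ h1).congr_of_eventuallyEq ?_
  filter_upwards [h3, hσ.eventually ((isOpen_chartDomain hf.smooth.continuous p (f p)).mem_nhds
    hdom)] with x hx hx'
  have e1 := (hf.isHor_iff hx' _).1 ((isInner_metricInChart g hx'.1).isHor_horLift
    (metricInChart gN (f p) (chartMap E F f p (f p) (σ x)))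
    (fderiv ℝ (chartMap E F f p (f p)) (σ x)) a)
  have e2 := h _ _ e1
  have e3 := hsub.apply_liftField hx' a
  rw [fderiv_chartMap hf.smooth hx'] at e3
  have e4 := congrArg (chartSymmDeriv (f p) (chartMap E F f p (f p) (σ x))) e3
  rw [← symm_chartMap f hx', chartSymmDeriv_chartDeriv (chartMap_mem f hx'), hx] at e4
  refine Eq.trans ?_ e2.symm
  refine form_congr θ ?_ e4.symm
  rw [← symm_chartMap f hx', hx]

end Descent

/-! ### Comparison of Ricci tensor, covariant derivative and scalar curvature on M and N. -/

section Comparison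

variable {E : Type*} [NormedAddCommGroup E] [NormedSpace ℝ E] [FiniteDimensional ℝ E]
  {F : Type*} [NormedAddCommGroup F] [NormedSpace ℝ F] [FiniteDimensional ℝ F]
  {M : Type*} [TopologicalSpace M] [ChartedSpace E M] [IsManifold 𝓘(ℝ, E) ∞ M]
  {N : Type*} [TopologicalSpace N] [ChartedSpace F N] [IsManifold 𝓘(ℝ, F) ∞ N]

theorem mem_chartDomain_self (f : M → N) (p : M) :
    extChartAt 𝓘(ℝ, E) p p ∈ chartDomain E F f p (f p) :=
  mem_chartDomain (mem_extChartAt_source p) (mem_extChartAt_source _)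

/-- Related vector fields have related components. -/
theorem IsRelatedField.fderiv_fieldInChart {f : M → N} (hf : ContMDiff 𝓘(ℝ, E) 𝓘(ℝ, F) ∞ f)
    {U : ∀ p : M, TangentSpace 𝓘(ℝ, E) p} {W : ∀ q : N, TangentSpace 𝓘(ℝ, F) q}
    (h : IsRelatedField f U W) {c : M} {d : N} {y : E} (hy : y ∈ chartDomain E F f c d) :
    fderiv ℝ (chartMap E F f c d) y (fieldInChart U c y)
      = fieldInChart W d (chartMap E F f c d y) := by
  rw [fderiv_chartMap hf hy, fieldInChart_eq hy.1, chartSymmDeriv_chartDeriv hy.1,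
    fieldInChart_eq (chartMap_mem f hy), symm_chartMap f hy]
  exact congrArg (chartDeriv (E := F) d _) (h ((extChartAt 𝓘(ℝ, E) c).symm y))

theorem isRelatedField_id (U : ∀ p : M, TangentSpace 𝓘(ℝ, E) p) :
    IsRelatedField (id : M → M) U U := fun p =>
  congrArg (fun L : E →L[ℝ] E => L (U p)) (mfderiv_id (I := 𝓘(ℝ, E)) (x := p))

theorem eventually_fderiv_fieldInChart {f : M → N} (hf : ContMDiff 𝓘(ℝ, E) 𝓘(ℝ, F) ∞ f)
    {U : ∀ p : M, TangentSpace 𝓘(ℝ, E) p} {W : ∀ q : N, TangentSpace 𝓘(ℝ, F) q}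
    (h : IsRelatedField f U W) {c : M} {d : N} {y : E} (hy : y ∈ chartDomain E F f c d) :
    ∀ᶠ x in 𝓝 y, fderiv ℝ (chartMap E F f c d) x (fieldInChart U c x)
      = fieldInChart W d (chartMap E F f c d x) := by
  filter_upwards [(isOpen_chartDomain hf.continuous c d).mem_nhds hy] with x hx
  exact h.fderiv_fieldInChart hf hx

/-- The coordinate formula for the covariant derivative in an arbitrary chart. -/
theorem chartSymmDeriv_localCov (g : Metric E M) {U : ∀ p : M, TangentSpace 𝓘(ℝ, E) p}
    (hU : IsSmoothField U) {c : M} {y : E} (hy : y ∈ (extChartAt 𝓘(ℝ, E) c).target) (v : E) :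
    chartSymmDeriv c y (localCov (metricInChart g c) (fieldInChart U c) y v)
      = covAt g U ((extChartAt 𝓘(ℝ, E) c).symm y) (chartSymmDeriv c y v) := by
  set p := (extChartAt 𝓘(ℝ, E) c).symm y with hp
  have hd : y ∈ chartDomain E E (id : M → M) c p := ⟨hy, mem_extChartAt_source _⟩
  have hD (u : E) : fderiv ℝ (chartMap E E (id : M → M) c p) y u = chartSymmDeriv c y u := by
    rw [fderiv_chartMap contMDiff_id hd]
    have h : diffAt E E (id : M → M) p = ContinuousLinearMap.id ℝ E := mfderiv_id
    rw [← hp, h]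
    exact chartDeriv_self p _
  have hval : chartMap E E (id : M → M) c p y = extChartAt 𝓘(ℝ, E) p p := rfl
  have h := ((isOrthMap_id g).isSubmersionOn c p).apply_localCov_of_related hd
    (isAffineAt_transition g hd)
    (differentiableAt_of_contDiffAt_infty (contDiffAt_fieldInChart hU hy))
    (differentiableAt_of_contDiffAt_infty (contDiffAt_fieldInChart hU (chartMap_mem _ hd)))
    (eventually_fderiv_fieldInChart contMDiff_id (isRelatedField_id U) hd) v
  rw [hD, hD, hval] at h
  rw [h]
  exact (covAt_eq g U p _).symm

theorem IsOrthMap.inner_eq {g : Metric E M} {gN : Metric F N} {f : M → N}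
    (hf : IsOrthMap g gN f) {p : M} {v : E} (hv : IsHor (innerAt g p) (diffAt E F f p) v) (u : E) :
    innerAt g p v u = innerAt gN (f p) (diffAt E F f p v) (diffAt E F f p u) :=
  (hf.orth p).inner_eq (isInner_innerAt g p) (isInner_innerAt gN (f p)) hv u

variable [T2Space M] {g : Metric E M} {gN : Metric F N} {f : M → N}
  (hf : IsOrthMap g gN f) (hpar : IsHorizontalParallel (F := F) g f)
include hf hpar

theorem ricciAt_eq_of_isHor {p : M} (v : E) {w : E}
    (hw : IsHor (innerAt g p) (diffAt E F f p) w) :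
    ricciAt g p v w = ricciAt gN (f p) (diffAt E F f p v) (diffAt E F f p w) := by
  rw [ricciAt_eq, ricciAt_eq, ← fderiv_chartMap_self hf.smooth,
    ← chartMap_chart f (f p) (mem_extChartAt_source (I := 𝓘(ℝ, E)) p)]
  refine (hf.isSubmersionOn p (f p)).ricciCoord_eq (mem_chartDomain_self f p)
    (fun x hx => isAffineAt_chartMap hf hpar hx) v ?_
  rw [fderiv_chartMap_self hf.smooth, metricInChart_self]
  exact hw

theorem diffAt_covAt {U : ∀ p : M, TangentSpace 𝓘(ℝ, E) p} (hU : IsSmoothField U)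
    {W : ∀ q : N, TangentSpace 𝓘(ℝ, F) q} (hW : IsSmoothField W) (h : IsRelatedField f U W)
    {p : M} (v : E) :
    diffAt E F f p (covAt g U p v) = covAt gN W (f p) (diffAt E F f p v) := by
  have hd := mem_chartDomain_self (E := E) (F := F) f p
  have key := (hf.isSubmersionOn p (f p)).apply_localCov_of_related hd
    (isAffineAt_chartMap hf hpar hd)
    (differentiableAt_of_contDiffAt_infty (contDiffAt_fieldInChart hU hd.1))
    (differentiableAt_of_contDiffAt_infty (contDiffAt_fieldInChart hW (chartMap_mem _ hd)))
    (eventually_fderiv_fieldInChart hf.smooth h hd) v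
  rw [fderiv_chartMap_self hf.smooth, chartMap_chart f (f p) (mem_extChartAt_source p)] at key
  rwa [covAt_eq, covAt_eq]

theorem lieAt_eq_of_isRelatedField {U : ∀ p : M, TangentSpace 𝓘(ℝ, E) p}
    (hU : IsSmoothField U) {W : ∀ q : N, TangentSpace 𝓘(ℝ, F) q} (hW : IsSmoothField W)
    (h : IsRelatedField f U W) {p : M} {v w : E}
    (hv : IsHor (innerAt g p) (diffAt E F f p) v) (hw : IsHor (innerAt g p) (diffAt E F f p) w) :
    lieAt g U p v w = lieAt gN W (f p) (diffAt E F f p v) (diffAt E F f p w) := by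
  rw [lieAt_eq, lieAt_eq, (isInner_innerAt g p).symm, hf.inner_eq hw, hf.inner_eq hv,
    diffAt_covAt hf hpar hU hW h, diffAt_covAt hf hpar hU hW h,
    (isInner_innerAt gN (f p)).symm (diffAt E F f p w)]

/-- If `U` is parallel along the fibres, then `f_* U` is locally constant on the fibres. -/
theorem eventually_diffAt_field_eq {U : ∀ p : M, TangentSpace 𝓘(ℝ, E) p} (hU : IsSmoothField U)
    (hcov : ∀ (p : M) (v : E), diffAt E F f p v = 0 → covAt g U p v = 0)
    (p : M) : ∀ᶠ p' in 𝓝 p, f p' = f p → diffAt E F f p' (fieldAt U p') = diffAt E F f p (fieldAt U p) := by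
  have hd := mem_chartDomain_self (E := E) (F := F) f p
  have hsub := hf.isSubmersionOn p (f p)
  set φ := chartMap E F f p (f p)
  -- On the fibre through p all image vectors are based at f p, where the chart has identity
  -- derivative, so components are the vectors themselves.
  have hval {p' : M} (hp' : p' ∈ (extChartAt 𝓘(ℝ, E) p).source) (hfp : f p' = f p) :
      fderiv ℝ φ (extChartAt 𝓘(ℝ, E) p p') (fieldInChart U p (extChartAt 𝓘(ℝ, E) p p'))
        = diffAt E F f p' (fieldAt U p') := by
    have hd' : extChartAt 𝓘(ℝ, E) p p' ∈ chartDomain E F f p (f p) :=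
      mem_chartDomain hp' (hfp ▸ mem_extChartAt_source _)
    rw [fderiv_chartMap hf.smooth hd', fieldInChart_eq hd'.1, chartSymmDeriv_chartDeriv hd'.1]
    have : ∀ r, r = p' → chartDeriv (f p) (f r) (diffAt E F f r (fieldAt U r))
        = diffAt E F f p' (fieldAt U p') := by
      rintro r rfl
      rw [hfp]
      exact chartDeriv_self _ _
    exact this _ ((extChartAt 𝓘(ℝ, E) p).left_inv hp')
  have key := eventually_eq_of_fderiv_eq_zero (hsub.smooth _ hd) (hsub.orth _ hd).surj
    (k := fun x => fderiv ℝ φ x (fieldInChart U p x)) (by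
      filter_upwards [(isOpen_chartDomain hf.smooth.continuous p (f p)).mem_nhds hd] with x hx
      have dY := differentiableAt_of_contDiffAt_infty (contDiffAt_fieldInChart hU hx.1)
      have dφ := differentiableAt_of_contDiffAt_infty
        (contDiffAt_infty_fderiv (hsub.smooth _ hx))
      refine ⟨dφ.clm_apply dY, differentiableAt_of_contDiffAt_infty (hsub.smooth _ hx),
        fun v hv => ?_⟩
      -- For vertical v the Γ_N-term vanishes, so the derivative of Dφ(Y) along v is Dφ(∇_v Y),
      -- which is zero by `hcov`.
      have h1 := hsub.apply_localCov hx (isAffineAt_chartMap hf hpar hx) dY v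
      rw [hv, map_zero, _root_.zero_apply, add_zero] at h1
      rw [← h1, fderiv_chartMap hf.smooth hx, chartSymmDeriv_localCov g hU hx.1, hcov]
      · rw [map_zero, map_zero]
      · rw [fderiv_chartMap hf.smooth hx] at hv
        have h2 := chartSymmDeriv_chartDeriv (chartMap_mem f hx)
          (diffAt E F f ((extChartAt 𝓘(ℝ, E) p).symm x) (chartSymmDeriv p x v))
        rw [symm_chartMap f hx, hv, map_zero] at h2
        exact h2.symm)
  have hp := mem_extChartAt_source (I := 𝓘(ℝ, E)) p
  filter_upwards [(contMDiffAt_chart hp).continuousAt.eventually key,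
    (isOpen_extChartAt_source (I := 𝓘(ℝ, E)) p).mem_nhds hp] with p' h1 h2 h3
  have h4 := h1 (by
    change chartMap E F f p (f p) _ = chartMap E F f p (f p) _
    rw [chartMap_chart f _ h2, chartMap_chart f _ hp, h3])
  rwa [hval h2 h3, hval hp rfl] at h4

/-- If the scalar curvature of the total space descends, it differs from that of the base by a
constant. -/
theorem exists_scalarCurvature_eq_add_const [ConnectedSpace N] (hsurj : Function.Surjective f)
    {r : N → ℝ} (hr : ∀ p, r (f p) = scalarCurvature g p) :
    ∃ k : ℝ, ∀ q, r q = scalarCurvature gN q + k := by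
  have hrs : ContMDiff 𝓘(ℝ, F) 𝓘(ℝ) ∞ r := contMDiff_of_comp hf hsurj (by
    simpa only [hr] using contMDiff_scalarCurvature g)
  have hκ : ContMDiff 𝓘(ℝ, F) 𝓘(ℝ) ∞ fun q => r q - scalarCurvature gN q :=
    hrs.sub (contMDiff_scalarCurvature gN)
  set κ := fun q => r q - scalarCurvature gN q with hκdef
  have hdiff (q : N) {x : F} (hx : x ∈ (extChartAt 𝓘(ℝ, F) q).target) :
      DifferentiableAt ℝ (fun z => κ ((extChartAt 𝓘(ℝ, F) q).symm z)) x :=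
    differentiableAt_of_contDiffAt_infty
      (hκ.contMDiffAt.comp x (contMDiffAt_chart_symm hx)).contDiffAt
  -- Choose p over x and differentiate κ ∘ φ along the horizontal lift of b at p: the result is
  -- dR(lift of b) − dR_N(b), and this vanishes by `fderiv_scalarCoord_eq`.
  have hzero (q : N) {x : F} (hx : x ∈ (extChartAt 𝓘(ℝ, F) q).target) :
      fderiv ℝ (fun z => κ ((extChartAt 𝓘(ℝ, F) q).symm z)) x = 0 := by
    ext b
    obtain ⟨p, hp⟩ := hsurj ((extChartAt 𝓘(ℝ, F) q).symm x)
    have hps := mem_extChartAt_source (I := 𝓘(ℝ, E)) p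
    have hd : extChartAt 𝓘(ℝ, E) p p ∈ chartDomain E F f p q :=
      mem_chartDomain hps (hp ▸ (extChartAt 𝓘(ℝ, F) q).map_target hx)
    have hsub := hf.isSubmersionOn p q
    have hφ : chartMap E F f p q (extChartAt 𝓘(ℝ, E) p p) = x := by
      rw [chartMap_chart f q hps, hp, (extChartAt 𝓘(ℝ, F) q).right_inv hx]
    have dφ := differentiableAt_of_contDiffAt_infty (hsub.smooth _ hd)
    have e : (fun y => κ ((extChartAt 𝓘(ℝ, F) q).symm (chartMap E F f p q y)))
        =ᶠ[𝓝 (extChartAt 𝓘(ℝ, E) p p)] fun y => scalarCoord (metricInChart g p) y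
          - scalarCoord (metricInChart gN q) (chartMap E F f p q y) := by
      filter_upwards [(isOpen_chartDomain hf.smooth.continuous p q).mem_nhds hd] with y hy
      rw [symm_chartMap f hy, hκdef]
      simp only
      rw [hr, scalarCurvature_eq g ((extChartAt 𝓘(ℝ, E) p).map_target hy.1),
        scalarCurvature_eq gN hy.2, (extChartAt 𝓘(ℝ, E) p).right_inv hy.1]
      rfl
    have hor := (isInner_metricInChart g hd.1).isHor_horLift
      (metricInChart gN q (chartMap E F f p q (extChartAt 𝓘(ℝ, E) p p)))
      (fderiv ℝ (chartMap E F f p q) (extChartAt 𝓘(ℝ, E) p p)) b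
    have h1 := hsub.fderiv_scalarCoord_eq hd (fun x hx => isAffineAt_chartMap hf hpar hx) hor
    have h2 := hsub.apply_liftField hd b
    have ds := differentiableAt_of_contDiffAt_infty (hsub.metric.contDiffAt_scalarCoord hd)
    have ds' := differentiableAt_of_contDiffAt_infty
      (hsub.metric'.contDiffAt_scalarCoord (hsub.mapsTo _ hd))
    have h3 := fderiv_apply_congr e (liftField (metricInChart g p) (metricInChart gN q)
      (chartMap E F f p q) b (extChartAt 𝓘(ℝ, E) p p))
    rw [fderiv_comp_apply (c := fun z => κ ((extChartAt 𝓘(ℝ, F) q).symm z))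
      (hdiff q (hsub.mapsTo _ hd)) dφ, h2, hφ] at h3
    have h4 : fderiv ℝ (fun y => scalarCoord (metricInChart g p) y
        - scalarCoord (metricInChart gN q) (chartMap E F f p q y)) (extChartAt 𝓘(ℝ, E) p p)
        (liftField (metricInChart g p) (metricInChart gN q)
          (chartMap E F f p q) b (extChartAt 𝓘(ℝ, E) p p)) = 0 := by
      have dc : DifferentiableAt ℝ (fun y => scalarCoord (metricInChart gN q)
          (chartMap E F f p q y)) (extChartAt 𝓘(ℝ, E) p p) :=
        DifferentiableAt.comp (g := scalarCoord (metricInChart gN q)) _ ds' dφ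
      rw [fderiv_fun_sub ds dc, _root_.sub_apply,
        fderiv_comp_apply (c := scalarCoord (metricInChart gN q)) ds' dφ, sub_eq_zero]
      exact h1
    rw [h3, h4, _root_.zero_apply]
  have hloc : IsLocallyConstant κ := by
    refine (IsLocallyConstant.iff_eventually_eq _).2 fun q => ?_
    have hq := mem_extChartAt_source (I := 𝓘(ℝ, F)) q
    obtain ⟨ε, hε, hball⟩ := Metric.isOpen_iff.1 (isOpen_extChartAt_target (I := 𝓘(ℝ, F)) q) _
      (mem_extChartAt_target q)
    filter_upwards [(contMDiffAt_chart (E := F) hq).continuousAt.eventually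
      (Metric.ball_mem_nhds _ hε), (isOpen_extChartAt_source (I := 𝓘(ℝ, F)) q).mem_nhds hq]
      with q' h1 h2
    have := Metric.isOpen_ball.is_const_of_fderiv_eq_zero
      (convex_ball (extChartAt 𝓘(ℝ, F) q q) ε).isPreconnected
      (fun x hx => (hdiff q (hball hx)).differentiableWithinAt)
      (fun x hx => hzero q (hball hx)) h1 (Metric.mem_ball_self hε)
    rwa [(extChartAt 𝓘(ℝ, F) q).left_inv h2, extChartAt_to_inv] at this
  obtain ⟨p⟩ : Nonempty N := inferInstance
  refine ⟨κ p, fun q => ?_⟩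
  have h := hloc.apply_eq_of_preconnectedSpace q p
  rw [← h, hκdef]
  ring

end Comparison

/-! ### Uniqueness of the metric coefficient. -/

section LinearAlgebra

variable {F : Type*} [NormedAddCommGroup F] [NormedSpace ℝ F] [FiniteDimensional ℝ F]

/-- The coefficient `r` of `r B + c τ ⊗ τ` is determined if `c = 0` or the dimension is at
least `2`. -/
theorem IsInner.coeff_eq {B : F →L[ℝ] F →L[ℝ] ℝ} (hB : IsInner B) {τ τ' : F →L[ℝ] ℝ} {r r' c : ℝ}
    (h : ∀ a, r * B a a + c * (τ a * τ a) = r' * B a a + c * (τ' a * τ' a))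
    (hn : c = 0 ∧ finrank ℝ F ≠ 0 ∨ 2 ≤ finrank ℝ F) : r = r' := by
  rcases hn with ⟨rfl, hn⟩ | hn
  · have : Nontrivial F := Module.finrank_pos_iff.1 (Nat.pos_of_ne_zero hn)
    obtain ⟨a, ha⟩ := exists_ne (0 : F)
    have h1 := h a
    simp only [zero_mul, add_zero] at h1
    exact mul_right_cancel₀ (hB.pos a ha).ne' h1
  · have hker (σ : F →L[ℝ] ℝ) : ∃ a, a ≠ 0 ∧ σ a = 0 := by
      have h1 : LinearMap.ker (σ : F →ₗ[ℝ] ℝ) ≠ ⊥ :=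
        LinearMap.ker_ne_bot_of_finrank_lt (by rw [finrank_self]; omega)
      obtain ⟨a, ha, ha0⟩ := Submodule.exists_mem_ne_zero_of_ne_bot h1
      exact ⟨a, ha0, ha⟩
    -- On ker τ and ker τ' respectively, (r − r')B(a, a) = c τ'(a)² and (r − r')B(b, b) = −c τ(b)².
    -- Multiplying, (r − r')² times a positive number is ≤ 0.
    obtain ⟨a, ha, ha'⟩ := hker τ
    obtain ⟨b, hb, hb'⟩ := hker τ'
    have h1 := h a
    have h2 := h b
    rw [ha'] at h1
    rw [hb'] at h2
    have pa := hB.pos a ha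
    have pb := hB.pos b hb
    have e1 : (r - r') * B a a = c * (τ' a * τ' a) := by linarith
    have e2 : (r - r') * B b b = -(c * (τ b * τ b)) := by linarith
    by_contra hne
    have hd : 0 < (r - r') * (r - r') := mul_self_pos.2 (sub_ne_zero.2 hne)
    have e3 : (r - r') * (r - r') * (B a a * B b b) = -((c * (τ' a * τ b)) * (c * (τ' a * τ b))) := by
      linear_combination (r - r') * B b b * e1 + c * (τ' a * τ' a) * e2
    have := mul_pos hd (mul_pos pa pb)
    have := mul_self_nonneg (c * (τ' a * τ b))
    linarith

end LinearAlgebra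

/-! ### The form η on horizontal lifts, and constancy of its sign along fibres. -/

section DescentOfForms

variable {E : Type*} [NormedAddCommGroup E] [NormedSpace ℝ E] [FiniteDimensional ℝ E]
  {F : Type*} [NormedAddCommGroup F] [NormedSpace ℝ F] [FiniteDimensional ℝ F]
  {M : Type*} [TopologicalSpace M] [ChartedSpace E M] [IsManifold 𝓘(ℝ, E) ∞ M]
  {N : Type*} [TopologicalSpace N] [ChartedSpace F N] [IsManifold 𝓘(ℝ, F) ∞ N]

/-- The horizontal lift at `p`. -/
def liftAt (g : Metric E M) (gN : Metric F N) (f : M → N) (p : M) (a : F) : E :=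
  horLift (innerAt g p) (innerAt gN (f p)) (diffAt E F f p) a

/-- A form on `M`, with values in the dual of the model space. -/
def formAt (η : ∀ p : M, TangentSpace 𝓘(ℝ, E) p →L[ℝ] ℝ) (p : M) : E →L[ℝ] ℝ := η p

/-- The form `η` evaluated on horizontal lifts. -/
def descendAt (g : Metric E M) (gN : Metric F N) (f : M → N)
    (η : ∀ p : M, TangentSpace 𝓘(ℝ, E) p →L[ℝ] ℝ) (p : M) : F →L[ℝ] ℝ :=
  LinearMap.toContinuousLinearMap
    { toFun := fun a => formAt η p (liftAt g gN f p a)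
      map_add' := fun a b => by
        simp only [liftAt, horLift, map_add, ContinuousLinearMap.add_comp]
      map_smul' := fun c a => by
        simp only [liftAt, horLift, map_smul, ContinuousLinearMap.smul_comp, RingHom.id_apply] }

theorem descendAt_apply (g : Metric E M) (gN : Metric F N) (f : M → N)
    (η : ∀ p : M, TangentSpace 𝓘(ℝ, E) p →L[ℝ] ℝ) (p : M) (a : F) :
    descendAt g gN f η p a = formAt η p (liftAt g gN f p a) := rfl

theorem isHor_liftAt (g : Metric E M) (gN : Metric F N) (f : M → N) (p : M) (a : F) :
    IsHor (innerAt g p) (diffAt E F f p) (liftAt g gN f p a) :=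
  (isInner_innerAt g p).isHor_horLift _ _ a

variable {g : Metric E M} {gN : Metric F N} {f : M → N} (hf : IsOrthMap g gN f)
include hf

theorem diffAt_liftAt (p : M) (a : F) : diffAt E F f p (liftAt g gN f p a) = a :=
  (hf.orth p).apply_horLift (isInner_innerAt g p) (isInner_innerAt gN (f p)) a

theorem liftAt_diffAt {p : M} {v : E} (hv : IsHor (innerAt g p) (diffAt E F f p) v) :
    liftAt g gN f p (diffAt E F f p v) = v :=
  (hf.orth p).horLift_apply (isInner_innerAt g p) (isInner_innerAt gN (f p)) hv

theorem inner_liftAt (p : M) (a b : F) :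
    innerAt g p (liftAt g gN f p a) (liftAt g gN f p b) = innerAt gN (f p) a b := by
  rw [hf.inner_eq (isHor_liftAt g gN f p a), diffAt_liftAt hf, diffAt_liftAt hf]

/-- In the fibre through `p`, the form `η` evaluated on horizontal lifts depends continuously on
the point. -/
theorem exists_continuousAt_descendAt {η : ∀ p : M, TangentSpace 𝓘(ℝ, E) p →L[ℝ] ℝ}
    (hη : IsSmoothForm η) (p : M) (a : F) : ∃ k : M → ℝ, ContinuousAt k p ∧
      ∀ᶠ p' in 𝓝 p, f p' = f p → k p' = descendAt g gN f η p' a := by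
  have hp := mem_extChartAt_source (I := 𝓘(ℝ, E)) p
  have hd := mem_chartDomain_self (E := E) (F := F) f p
  have hsub := hf.isSubmersionOn p (f p)
  have h1 := (contDiffAt_formInChart hη hd.1 (hsub.contDiffAt_liftField hd a)).continuousAt
  -- The function k lifts the vector with components a in the fixed chart at f p. That vector is a
  -- itself only over f p, so agreement holds on the fibre only.
  refine ⟨_, ContinuousAt.comp (f := extChartAt 𝓘(ℝ, E) p) h1 (contMDiffAt_chart hp).continuousAt,
    ?_⟩
  filter_upwards [(isOpen_extChartAt_source (I := 𝓘(ℝ, E)) p).mem_nhds hp] with p' hp' hfp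
  have hd' : extChartAt 𝓘(ℝ, E) p p' ∈ chartDomain E F f p (f p) :=
    mem_chartDomain hp' (hfp ▸ mem_extChartAt_source _)
  have e1 := (hf.isHor_iff hd' _).1 ((isInner_metricInChart g hd'.1).isHor_horLift
    (metricInChart gN (f p) (chartMap E F f p (f p) (extChartAt 𝓘(ℝ, E) p p')))
    (fderiv ℝ (chartMap E F f p (f p)) (extChartAt 𝓘(ℝ, E) p p')) a)
  have e3 := hsub.apply_liftField hd' a
  rw [fderiv_chartMap hf.smooth hd'] at e3
  rw [Function.comp_apply, descendAt_apply]
  have key : ∀ r : M, r = p' → ∀ v : E, IsHor (innerAt g r) (diffAt E F f r) v →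
      chartDeriv (f p) (f r) (diffAt E F f r v) = a →
      formAt η r v = formAt η p' (liftAt g gN f p' a) := by
    rintro r rfl v h2 h3
    rw [hfp, chartDeriv_self] at h3
    rw [← h3, liftAt_diffAt hf h2]
  exact key _ ((extChartAt 𝓘(ℝ, E) p).left_inv hp') _ e1 e3

/-- Equal squares leave only a sign undetermined. Near a point where the form is nonzero on some a,
continuity excludes the change of sign, and the products with b then fix the whole form. Where the
form vanishes, it vanishes on the entire fibre. -/
theorem descendAt_eq_of_mul_self_eq {η : ∀ p : M, TangentSpace 𝓘(ℝ, E) p →L[ℝ] ℝ}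
    (hη : IsSmoothForm η) (hfib : ∀ q : N, IsPreconnected (f ⁻¹' {q}))
    (h : ∀ p p', f p = f p' → ∀ a b, descendAt g gN f η p a * descendAt g gN f η p b
      = descendAt g gN f η p' a * descendAt g gN f η p' b) {p p' : M} (hp : f p = f p') :
    descendAt g gN f η p = descendAt g gN f η p' := by
  refine eq_of_eventually_eq_on_fibre (fun p => ?_) hfib hp
  by_cases h0 : descendAt g gN f η p = 0
  · refine Filter.Eventually.of_forall fun p' hp' => ?_
    rw [h0]
    ext a
    have := h p' p hp' a a
    rw [h0, _root_.zero_apply, mul_zero] at this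
    exact mul_self_eq_zero.1 this
  · obtain ⟨a, ha⟩ : ∃ a, descendAt g gN f η p a ≠ 0 := by
      by_contra! hcon
      exact h0 (ContinuousLinearMap.ext hcon)
    obtain ⟨k, hk, hk'⟩ := exists_continuousAt_descendAt hf hη p a
    have hkp : k p = descendAt g gN f η p a := hk'.self_of_nhds rfl
    have hpos : ∀ᶠ p' in 𝓝 p, 0 < k p' * k p :=
      (hk.mul_const (k p)).eventually_const_lt (by simpa only [hkp] using mul_self_pos.2 ha)
    filter_upwards [hpos, hk'] with p' h1 h2 h3
    rw [h2 h3, hkp] at h1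
    have e : descendAt g gN f η p' a = descendAt g gN f η p a := by
      rcases mul_self_eq_mul_self_iff.1 (h p' p h3 a a) with e | e
      · exact e
      · rw [e, neg_mul] at h1
        linarith [mul_self_nonneg (descendAt g gN f η p a)]
    ext b
    have := h p' p h3 a b
    rw [e] at this
    exact mul_left_cancel₀ ha this

end DescentOfForms

/-! ### The soliton equation on horizontal vectors and its descent. -/

section Soliton

variable {E : Type*} [NormedAddCommGroup E] [NormedSpace ℝ E] [FiniteDimensional ℝ E]
  {F : Type*} [NormedAddCommGroup F] [NormedSpace ℝ F] [FiniteDimensional ℝ F]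
  {M : Type*} [TopologicalSpace M] [T2Space M] [ChartedSpace E M] [IsManifold 𝓘(ℝ, E) ∞ M]
  {N : Type*} [TopologicalSpace N] [ChartedSpace F N] [IsManifold 𝓘(ℝ, F) ∞ N]
  {g : Metric E M} {gN : Metric F N} {f : M → N}
  {U : ∀ p : M, TangentSpace 𝓘(ℝ, E) p} {η : ∀ p : M, TangentSpace 𝓘(ℝ, E) p →L[ℝ] ℝ}
  {lam mu α β : ℝ}

theorem isSmoothForm_zero : IsSmoothForm (0 : ∀ q : N, TangentSpace 𝓘(ℝ, F) q →L[ℝ] ℝ) :=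
  isSmoothForm_of_chart fun _ _ => contDiffAt_const

theorem isSmoothField_zero : IsSmoothField (0 : ∀ q : N, TangentSpace 𝓘(ℝ, F) q) :=
  contMDiff_zeroSection ℝ (TangentSpace 𝓘(ℝ, F) : N → Type _)

theorem lieAt_zero (q : N) (a b : F) :
    lieAt gN (0 : ∀ q : N, TangentSpace 𝓘(ℝ, F) q) q a b = 0 := by
  have h (x : F) (hx : x ∈ (extChartAt 𝓘(ℝ, F) q).target) :
      fieldInChart (0 : ∀ q : N, TangentSpace 𝓘(ℝ, F) q) q x = 0 := by
    rw [fieldInChart_eq hx]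
    exact map_zero _
  have e : fieldInChart (0 : ∀ q : N, TangentSpace 𝓘(ℝ, F) q) q
      =ᶠ[𝓝 (extChartAt 𝓘(ℝ, F) q q)] fun _ => 0 := by
    filter_upwards [(isOpen_extChartAt_target (I := 𝓘(ℝ, F)) q).mem_nhds
      (mem_extChartAt_target q)] with x hx using h x hx
  have hc (v : F) : covAt gN (0 : ∀ q : N, TangentSpace 𝓘(ℝ, F) q) q v = 0 := by
    rw [covAt_eq, localCov_congr e,
      (isMetricOn_metricInChart gN q).localCov_eq (mem_extChartAt_target q), fderiv_const_apply,
      map_zero, _root_.zero_apply, add_zero]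
  rw [lieAt_eq, hc, hc, map_zero, map_zero, _root_.zero_apply, add_zero]

/-- All arguments are multiples of one vector e, and R(e, e) = 0 by skewness. -/
theorem ricciAt_eq_zero_of_finrank_le_one (hn : finrank ℝ F ≤ 1) (q : N) (a b : F) :
    ricciAt gN q a b = 0 := by
  have hG := isMetricOn_metricInChart gN q
  have hq := mem_extChartAt_target (I := 𝓘(ℝ, F)) q
  obtain ⟨e, he⟩ := finrank_le_one_iff.1 hn
  rw [ricciAt_eq, ricciCoord]
  refine Finset.sum_eq_zero fun i _ => ?_
  obtain ⟨c, hc⟩ := he (finBasis ℝ F i)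
  obtain ⟨d, hd⟩ := he a
  have hsk := connCurv_skew (conn (metricInChart gN q)) (extChartAt 𝓘(ℝ, F) q q) e e b
  have hee : connCurv (conn (metricInChart gN q)) (extChartAt 𝓘(ℝ, F) q q) e e b = 0 :=
    (smul_eq_zero.1 ((two_smul ℝ _).trans (add_eq_zero_iff_eq_neg.2 hsk))).resolve_left two_ne_zero
  have ht := isTrilinear_connCurv (conn (metricInChart gN q)) (extChartAt 𝓘(ℝ, F) q q)
  rw [hG.curvature_eq hq, ← hc, ← hd]
  rw [ht.smul₁, ht.smul₂, hee, smul_zero, smul_zero, map_zero]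

theorem ricciAt_zero_left (q : N) (b : F) : ricciAt gN q 0 b = 0 := by
  have hG := isMetricOn_metricInChart gN q
  rw [ricciAt_eq, ← hG.inner_ricOp (mem_extChartAt_target q), map_zero, map_zero,
    _root_.zero_apply]

variable (hf : IsOrthMap g gN f) (hpar : IsHorizontalParallel (F := F) g f)
  (hsol : IsEtaRicciYamabeSoliton g U η lam mu α β)
include hf hpar hsol

/-- The soliton equation on horizontal vectors. -/
theorem soliton_horizontal {W : ∀ q : N, TangentSpace 𝓘(ℝ, F) q} (hW : IsSmoothField W)
    (hUW : IsRelatedField f U W) (p : M) (a b : F) :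
    lieAt gN W (f p) a b + 2 * α * ricciAt gN (f p) a b
      + (2 * lam - β * scalarCurvature g p) * innerAt gN (f p) a b
      + 2 * mu * (descendAt g gN f η p a * descendAt g gN f η p b) = 0 := by
  have h : lieAt g U p (liftAt g gN f p a) (liftAt g gN f p b)
      + 2 * α * ricciAt g p (liftAt g gN f p a) (liftAt g gN f p b)
      + (2 * lam - β * scalarCurvature g p)
        * innerAt g p (liftAt g gN f p a) (liftAt g gN f p b)
      + 2 * mu * (descendAt g gN f η p a * descendAt g gN f η p b) = 0 :=
    hsol.equation p (liftAt (E := E) g gN f p a) (liftAt (E := E) g gN f p b)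
  rwa [lieAt_eq_of_isRelatedField hf hpar hsol.smooth_field hW hUW (isHor_liftAt g gN f p a)
    (isHor_liftAt g gN f p b), ricciAt_eq_of_isHor hf hpar _ (isHor_liftAt g gN f p b),
    inner_liftAt hf, diffAt_liftAt hf, diffAt_liftAt hf] at h

/-- The data of the soliton descend to the base. -/
theorem exists_descent (hsurj : Function.Surjective f)
    (hfib : ∀ q : N, IsPreconnected (f ⁻¹' {q})) (hn : finrank ℝ F ≠ 0)
    (hc : mu = 0 ∨ finrank ℝ F ≠ 1 ∨ β = 0) {W : ∀ q : N, TangentSpace 𝓘(ℝ, F) q}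
    (hW : IsSmoothField W) (hUW : IsRelatedField f U W) :
    ∃ (r : N → ℝ) (θ : ∀ q : N, TangentSpace 𝓘(ℝ, F) q →L[ℝ] ℝ),
      ContMDiff 𝓘(ℝ, F) 𝓘(ℝ) ∞ r ∧ IsSmoothForm θ ∧ (∀ p, r (f p) = β * scalarCurvature g p) ∧
      (mu ≠ 0 → IsInducedForm g f η θ) ∧ ∀ q (a b : F), lieAt gN W q a b
        + 2 * α * ricciAt gN q a b + (2 * lam - r q) * innerAt gN q a b
        + 2 * mu * (formAt θ q a * formAt θ q b) = 0 := by
  have key : ∀ p q, f p = q → ∀ a b : F, lieAt gN W q a b + 2 * α * ricciAt gN q a b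
      + (2 * lam - β * scalarCurvature g p) * innerAt gN q a b
      + 2 * mu * (descendAt g gN f η p a * descendAt g gN f η p b) = 0 := by
    rintro p _ rfl a b
    exact soliton_horizontal hf hpar hsol hW hUW p a b
  have hR (p p' : M) (hp : f p = f p') : β * scalarCurvature g p = β * scalarCurvature g p' := by
    by_cases hβ : β = 0
    · rw [hβ, zero_mul, zero_mul]
    · have h1 := key p (f p') hp
      have h2 := key p' (f p') rfl
      -- The Lie and Ricci terms on N are the same at p and p', so subtracting the two equations
      -- leaves only the metric and η terms.
      have := (isInner_innerAt gN (f p')).coeff_eq (τ := descendAt g gN f η p)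
        (τ' := descendAt g gN f η p') (r := -(β * scalarCurvature g p))
        (r' := -(β * scalarCurvature g p')) (c := 2 * mu)
        (fun a => by linarith [h1 a a, h2 a a]) (by
          by_cases hmu : mu = 0
          · exact Or.inl ⟨by rw [hmu, mul_zero], hn⟩
          · right
            have : finrank ℝ F ≠ 1 := by tauto
            omega)
      exact neg_injective this
  have hs (q : N) : f (Function.surjInv hsurj q) = q := Function.surjInv_eq hsurj q
  set r : N → ℝ := fun q => β * scalarCurvature g (Function.surjInv hsurj q) with hr
  have hrf (p : M) : r (f p) = β * scalarCurvature g p := hR _ _ (hs (f p))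
  have hrs : ContMDiff 𝓘(ℝ, F) 𝓘(ℝ) ∞ r := by
    refine contMDiff_of_comp hf hsurj ?_
    simp only [hrf]
    exact contMDiff_const.mul (contMDiff_scalarCurvature g)
  by_cases hmu : mu = 0
  -- With μ = 0 the η-term is absent, so any smooth form will do; η itself need not descend.
  · refine ⟨r, 0, hrs, isSmoothForm_zero, hrf, fun h => absurd hmu h, fun q a b => ?_⟩
    have h1 := key _ q (hs q) a b
    rw [hmu, mul_zero, zero_mul] at h1 ⊢
    exact h1
  · have hdesc {p p' : M} (hp : f p = f p') :
        descendAt g gN f η p = descendAt g gN f η p' := by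
      refine descendAt_eq_of_mul_self_eq hf hsol.smooth_form hfib (fun p p' hp a b => ?_) hp
      have h1 := key p (f p') hp a b
      have h2 := key p' (f p') rfl a b
      rw [hR p p' hp] at h1
      have h3 : 2 * mu ≠ 0 := mul_ne_zero two_ne_zero hmu
      refine mul_left_cancel₀ h3 ?_
      linarith
    set θ : ∀ q : N, TangentSpace 𝓘(ℝ, F) q →L[ℝ] ℝ :=
      fun q => descendAt (F := F) g gN f η (Function.surjInv hsurj q) with hθ
    have hind : IsInducedForm g f η θ := by
      intro p v hv
      have h1 : descendAt g gN f η (Function.surjInv hsurj (f p)) (diffAt E F f p v)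
          = formAt η p v := by
        rw [hdesc (hs (f p)), descendAt_apply, liftAt_diffAt hf hv]
      exact h1.symm
    exact ⟨r, θ, hrs, hind.isSmoothForm hf hsurj hsol.smooth_form, hrf, fun _ => hind,
      fun q a b => key _ q (hs q) a b⟩

/-- If `U` is horizontal and `mu = 0`, then `U` is parallel along the fibres. -/
theorem covAt_eq_zero_of_vertical (hU : ∀ p, IsHorizontal (F := F) g f p (U p)) (hmu : mu = 0)
    (p : M) (v : E) (hv : diffAt E F f p v = 0) : covAt g U p v = 0 := by
  have hor (u : E) : IsHor (innerAt g p) (diffAt E F f p) (covAt g U p u) :=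
    hpar U hsol.smooth_field hU p u
  -- The second argument w = ∇_v U is horizontal and v is vertical. The Ricci and metric terms
  -- vanish, as does ⟨v, ∇_w U⟩, so L_U g contributes exactly |∇_v U|².
  have h : lieAt g U p v (covAt g U p v) + 2 * α * ricciAt g p v (covAt g U p v)
      + (2 * lam - β * scalarCurvature g p) * innerAt g p v (covAt g U p v)
      + 2 * mu * (formAt η p v * formAt η p (covAt g U p v)) = 0 :=
    hsol.equation p v (covAt (E := E) g U p v)
  have hI := isInner_innerAt g p
  rw [lieAt_eq, ricciAt_eq_of_isHor hf hpar v (hor v), hv, ricciAt_zero_left, hI.symm v,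
    hI.symm v, hor _ v hv, hor _ v hv, hmu] at h
  refine hI.eq_zero_of_self ?_
  linarith

end Soliton

/-! ### The two conclusions on the base, including dim N ≤ 1. -/

section Base

variable {E : Type*} [NormedAddCommGroup E] [NormedSpace ℝ E] [FiniteDimensional ℝ E]
  {F : Type*} [NormedAddCommGroup F] [NormedSpace ℝ F] [FiniteDimensional ℝ F]
  {M : Type*} [TopologicalSpace M] [T2Space M] [ChartedSpace E M] [IsManifold 𝓘(ℝ, E) ∞ M]
  {N : Type*} [TopologicalSpace N] [ChartedSpace F N] [IsManifold 𝓘(ℝ, F) ∞ N]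
  {g : Metric E M} {gN : Metric F N} {f : M → N}
  {U : ∀ p : M, TangentSpace 𝓘(ℝ, E) p} {η : ∀ p : M, TangentSpace 𝓘(ℝ, E) p →L[ℝ] ℝ}
  {lam mu α β : ℝ}

theorem isInducedForm_zero_of_subsingleton [Subsingleton F] (g : Metric E M) (f : M → N)
    (η : ∀ p : M, TangentSpace 𝓘(ℝ, E) p →L[ℝ] ℝ) :
    IsInducedForm g f η (0 : ∀ q : N, TangentSpace 𝓘(ℝ, F) q →L[ℝ] ℝ) := by
  intro p v hv
  have h0 : (v : E) = 0 :=
    (isInner_innerAt g p).eq_zero_of_self (hv v (Subsingleton.elim (α := F) _ _))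
  have h1 : formAt η p v = 0 := (congrArg (formAt η p) h0).trans (map_zero _)
  exact h1

variable (hf : IsOrthMap g gN f) (hpar : IsHorizontalParallel (F := F) g f)
  (hsol : IsEtaRicciYamabeSoliton g U η lam mu α β) (hsurj : Function.Surjective f)
  (hfib : ∀ q : N, IsPreconnected (f ⁻¹' {q}))
include hf hpar hsol hsurj hfib

theorem exists_isEtaEinstein (hU : ∀ p, IsVertical (F := F) f p (U p)) (hα : α ≠ 0) :
    ∃ θ : ∀ q : N, TangentSpace 𝓘(ℝ, F) q →L[ℝ] ℝ, IsEtaEinstein gN θ ∧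
      (mu ≠ 0 → (finrank ℝ F ≠ 1 ∨ β = 0) → IsInducedForm g f η θ) := by
  by_cases hgood : finrank ℝ F ≠ 0 ∧ (mu = 0 ∨ finrank ℝ F ≠ 1 ∨ β = 0)
  -- Verticality of U says precisely that U is related to the zero field; its Lie term on N vanishes
  -- and the equation can be solved for S_N.
  · obtain ⟨r, θ, hr, hθ, -, hind, heq⟩ := exists_descent hf hpar hsol hsurj hfib hgood.1 hgood.2
      isSmoothField_zero hU
    refine ⟨θ, ⟨hθ, fun q => (r q - 2 * lam) * (2 * α)⁻¹, fun _ => -mu / α,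
      (hr.sub contMDiff_const).mul contMDiff_const, contMDiff_const, fun q v w => ?_⟩,
      fun hmu _ => hind hmu⟩
    have key : ∀ v w : F, ricciAt gN q v w = (r q - 2 * lam) * (2 * α)⁻¹ * innerAt gN q v w
        + -mu / α * (formAt θ q v * formAt θ q w) := by
      intro v w
      have h := heq q v w
      rw [lieAt_zero] at h
      field_simp
      linarith
    exact key v w
  -- What remains is dim N = 0, or dim N = 1 with μ and β both nonzero. In the latter case no
  -- induced form is claimed.
  · have hn : finrank ℝ F ≤ 1 := by
      by_contra hlt
      exact hgood ⟨by omega, Or.inr (Or.inl (by omega))⟩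
    refine ⟨0, ⟨isSmoothForm_zero, fun _ => 0, fun _ => 0, contMDiff_const, contMDiff_const,
      fun q v w => ?_⟩, fun _ hc => ?_⟩
    · rw [zero_mul, zero_mul, add_zero]
      exact ricciAt_eq_zero_of_finrank_le_one hn q v w
    · have h0 : finrank ℝ F = 0 := by
        by_contra h0
        exact hgood ⟨h0, Or.inr hc⟩
      have := Module.finrank_zero_iff.1 h0
      exact isInducedForm_zero_of_subsingleton g f η

/-- If `U` is horizontal and `mu = 0`, then `U` is projectable. -/
theorem exists_isRelatedField (hU : ∀ p, IsHorizontal (F := F) g f p (U p)) (hmu : mu = 0) :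
    ∃ W : ∀ q : N, TangentSpace 𝓘(ℝ, F) q, IsRelatedField f U W := by
  refine ⟨fun q => diffAt E F f (Function.surjInv hsurj q) (fieldAt U (Function.surjInv hsurj q)),
    fun p => ?_⟩
  exact eq_of_eventually_eq_on_fibre (k := fun p => diffAt E F f p (fieldAt U p))
    (eventually_diffAt_field_eq hf hpar hsol.smooth_field
      (covAt_eq_zero_of_vertical hf hpar hsol hU hmu)) hfib (Function.surjInv_eq hsurj (f p)).symm

theorem exists_isEtaRicciYamabeSoliton [ConnectedSpace N]
    (hU : ∀ p, IsHorizontal (F := F) g f p (U p))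
    (hrel : mu = 0 ∨ ∃ W : ∀ q : N, TangentSpace 𝓘(ℝ, F) q, IsRelatedField f U W)
    (hc : mu = 0 ∨ finrank ℝ F ≠ 1 ∨ β = 0) :
    ∃ (W : ∀ q : N, TangentSpace 𝓘(ℝ, F) q) (θ : ∀ q : N, TangentSpace 𝓘(ℝ, F) q →L[ℝ] ℝ)
      (lamN : ℝ), IsRelatedField f U W ∧ IsEtaRicciYamabeSoliton gN W θ lamN mu α β ∧
        (mu ≠ 0 → IsInducedForm g f η θ) := by
  by_cases hn : finrank ℝ F = 0
  · have := Module.finrank_zero_iff.1 hn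
    -- N has dimension 0: all tangent vectors vanish, and the value of λ_N is irrelevant.
    refine ⟨0, 0, 0, fun p => Subsingleton.elim (α := F) _ _,
      ⟨isSmoothField_zero, isSmoothForm_zero, fun q v w => ?_⟩,
      fun _ => isInducedForm_zero_of_subsingleton g f η⟩
    have key : ∀ v w : F, lieAt gN (0 : ∀ q : N, TangentSpace 𝓘(ℝ, F) q) q v w
        + 2 * α * ricciAt gN q v w + (2 * 0 - β * scalarCurvature gN q) * innerAt gN q v w
        + 2 * mu * (formAt (0 : ∀ q : N, TangentSpace 𝓘(ℝ, F) q →L[ℝ] ℝ) q v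
          * formAt (0 : ∀ q : N, TangentSpace 𝓘(ℝ, F) q →L[ℝ] ℝ) q w) = 0 := by
      intro v w
      rw [Subsingleton.elim v 0, lieAt_zero, ricciAt_zero_left, map_zero, map_zero,
        _root_.zero_apply]
      ring
    exact key v w
  · obtain ⟨W, hW⟩ : ∃ W : ∀ q : N, TangentSpace 𝓘(ℝ, F) q, IsRelatedField f U W :=
      hrel.elim (exists_isRelatedField hf hpar hsol hsurj hfib hU) id
    have hWs := hW.isSmoothField hf hsurj hsol.smooth_field
    obtain ⟨r, θ, hr, hθ, hrR, hind, heq⟩ := exists_descent hf hpar hsol hsurj hfib hn hc hWs hW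
    obtain ⟨lamN, hlam⟩ : ∃ lamN : ℝ, ∀ q, 2 * lam - r q
        = 2 * lamN - β * scalarCurvature gN q := by
      by_cases hβ : β = 0
      · refine ⟨lam, fun q => ?_⟩
        obtain ⟨p, rfl⟩ := hsurj q
        rw [hrR, hβ, zero_mul, zero_mul]
      -- The descended function r is βR, so r/β is the descended R and equals R_N + k.
      · obtain ⟨k, hk⟩ := exists_scalarCurvature_eq_add_const hf hpar hsurj
          (r := fun q => r q / β) (fun p => by rw [hrR, mul_div_cancel_left₀ _ hβ])
        -- Chosen so that 2λ − β(R_N + k) = 2λ_N − βR_N.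
        refine ⟨lam - β * k / 2, fun q => ?_⟩
        have h := hk q
        rw [div_eq_iff hβ] at h
        rw [h]
        ring
    refine ⟨W, θ, lamN, hW, ⟨hWs, hθ, fun q v w => ?_⟩, hind⟩
    rw [← hlam q]
    exact heq q v w

end Base

end RicciYamabe

end

open RicciYamabe in
theorem theorem4p16
    {E : Type*} [NormedAddCommGroup E] [NormedSpace ℝ E] [FiniteDimensional ℝ E]
    {F : Type*} [NormedAddCommGroup F] [NormedSpace ℝ F] [FiniteDimensional ℝ F]
    {M : Type*} [TopologicalSpace M] [T2Space M] [SecondCountableTopology M] [ConnectedSpace M]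
    [ChartedSpace E M] [IsManifold 𝓘(ℝ, E) ∞ M]
    {N : Type*} [TopologicalSpace N] [T2Space N] [SecondCountableTopology N] [ConnectedSpace N]
    [ChartedSpace F N] [IsManifold 𝓘(ℝ, F) ∞ N]
    (g : Metric E M) (gN : Metric F N) (f : M → N)
    (hf : IsRiemannianSubmersion g gN f)
    (hfib : ∀ q : N, IsConnected (f ⁻¹' {q}))
    (U : ∀ p : M, TangentSpace 𝓘(ℝ, E) p) (η : ∀ p : M, TangentSpace 𝓘(ℝ, E) p →L[ℝ] ℝ)
    (lam mu α β : ℝ)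
    (hsol : IsEtaRicciYamabeSoliton g U η lam mu α β)
    (hpar : IsHorizontalParallel (F := F) g f) :
    ((∀ p, IsVertical (F := F) f p (U p)) → α ≠ 0 →
      ∃ θ : ∀ q : N, TangentSpace 𝓘(ℝ, F) q →L[ℝ] ℝ,
        IsEtaEinstein gN θ ∧
        (mu ≠ 0 → (finrank ℝ F ≠ 1 ∨ β = 0) → IsInducedForm g f η θ)) ∧
    ((∀ p, IsHorizontal (F := F) g f p (U p)) →
      (mu = 0 ∨ ∃ W : ∀ q : N, TangentSpace 𝓘(ℝ, F) q, IsRelatedField f U W) →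
      (mu = 0 ∨ finrank ℝ F ≠ 1 ∨ β = 0) →
      ∃ (W : ∀ q : N, TangentSpace 𝓘(ℝ, F) q)
        (θ : ∀ q : N, TangentSpace 𝓘(ℝ, F) q →L[ℝ] ℝ) (lamN : ℝ),
        IsRelatedField f U W ∧ IsEtaRicciYamabeSoliton gN W θ lamN mu α β ∧
        (mu ≠ 0 → IsInducedForm g f η θ)) :=
  ⟨exists_isEtaEinstein hf.isOrthMap hpar hsol hf.surjective fun q => (hfib q).isPreconnected,
    exists_isEtaRicciYamabeSoliton hf.isOrthMap hpar hsol hf.surjective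
      fun q => (hfib q).isPreconnected⟩
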